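/- **Setting.** Consider $\min\{\psi_0(x)=f_0(x)+\chi_0(x): x\in X,\ \psi_i(x)=f_i(x)+\chi_i(x)\le 0,\ i=1,\dots,m\}$, where $X\subset\mathbb{R}^n$ is convex and compact, $f_0,\dots,f_m:X\to\mathbb{R}$ are convex and continuous, $\chi_0:X\to\mathbb{R}$ is convex and lower semicontinuous, and $\chi_1,\dots,\chi_m:X\to\mathbb{R}$ are convex and continuous. Let $\|\cdot\|$ be a norm on $\mathbb{R}^n$ with dual norm $\|\cdot\|_*$. Let $\omega:X\to\mathbb{R}$ be continuously differentiable with Lipschitz gradient and $1$-strongly convex with respect to $\|\cdot\|$. Put $W(y,x)=\omega(y)-\omega(x)-\langle\nabla\omega(x),y-x\rangle$ and $D_X=\max_{x,y\in X}\sqrt{2W(x,y)}$. Assume that $\chi_0$ is $\alpha_0$-strongly convex with respect to $W$, i.e. $\chi_0-\alpha_0\omega$ is convex, with $\alpha_0>0$. For a convex function $h$ on $X$ and $x$ in the relative interior of $X$, $\partial h(x)$ denotes the set of subgradients of $h$ at $x$ lying in $\mathrm{lin}(X-X)$; for other $x\in X$ it denotes the set of all limits $\lim_k h'_k$ with $h'_k\in\partial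 h(x_k)$, $x_k$ in the relative interior and $x_k\to x$. Assume that, with nonnegative constants $L_i,H_i$ ($0\le i\le m$) and $M_{f,i},M_{\chi,i}$ ($1\le i\le m$), for all $x_1,x_2\in X$, $$f_i(x_1)-f_i(x_2)-\langle f_i'(x_2),x_1-x_2\rangle\le \tfrac{L_i}{2}\|x_1-x_2\|^2+H_i\|x_1-x_2\|\quad\text{for all } f_i'(x_2)\in\partial f_i(x_2),\ 0\le i\le m,$$ $$f_i(x_1)-f_i(x_2)\le M_{f,i}\|x_1-x_2\|,\qquad \chi_i(x_1)-\chi_i(x_2)\le M_{\chi,i}\|x_1-x_2\|,\qquad 1\le i\le m.$$ A stochastic oracle returns, at $x\in X$ and for a random $\xi$, quantities $G_0(x,\xi)$, $G_i(x,\xi)$, $F(x,\xi)$ (jointly measurable) with means $f_0'(x)\in\partial f_0(x)$, $f_i'(x)\in\partial f_i(x)$, $f(x)=(f_1(x),\dots,f_m(x))$, and with $\mathbb{E}\|G_0-f_0'\|_*^2\le\sigma_0^2$, $\mathbb{E}\|G_i-f_i'\|_*^2\le\sigma_i^2$ ($1\le i\le m$), $\mathbb{E}\|F-f\|_2^2\le\sigma_f^2$.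 Assume that the Lagrangian $\psi_0(x)+\sum_i y^{(i)}\psi_i(x)$ has a saddle point $(x^*,y^*)$ on $X\times\mathbb{R}^m_{\ge0}$. Let $M_f,M_\chi,L_f,H_f,\|\sigma\|_2$ be the Euclidean norms of the families $(M_{f,i}),(M_{\chi,i}),(L_i),(H_i),(\sigma_i)$, $1\le i\le m$. **Method (ConEx, $T\ge1$ iterations).** Let $\xi_t,\bar\xi_t$ ($t\ge0$) be independent copies of $\xi$. Start at $x_{-1}=x_0\in X$, $y_0=0$. Put $\ell_F(x_{t+1})=F(x_t,\bar\xi_t)+\big(\langle G_i(x_t,\bar\xi_t),x_{t+1}-x_t\rangle\big)_{i=1}^m$ for $t\ge0$, $\ell_F(x_0)=\ell_F(x_{-1})=F(x_0,\bar\xi_0)$, and $\chi=(\chi_1,\dots,\chi_m)$. For $t=0,\dots,T-1$ set $$s_t=(1+\theta_t)[\chi(x_t)+\ell_F(x_t)]-\theta_t[\chi(x_{t-1})+\ell_F(x_{t-1})],\qquad y_{t+1}=\Big[y_t+\tfrac1{\tau_t}s_t\Big]_+,$$ $$x_{t+1}=\operatorname*{argmin}_{x\in X}\Big\{\chi_0(x)+\sum_i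 y_{t+1}^{(i)}\chi_i(x)+\Big\langle G_0(x_t,\xi_t)+\sum_i y_{t+1}^{(i)}G_i(x_t,\xi_t),x\Big\rangle+\eta_tW(x,x_t)\Big\},$$ and output $\bar x_T=\big(\sum_{t<T}\gamma_t\big)^{-1}\sum_{t<T}\gamma_tx_{t+1}$. Here $B\ge1$ is a constant, $t_0=\frac{4(L_0+BL_f)}{\alpha_0}+2$, $\mathcal M=\max\{2M_f,M_\chi+M_f\}$, $\sigma_{X,f}=(\sigma_f^2+D_X^2\|\sigma\|_2^2)^{1/2}$ and $$\gamma_t=t+t_0+2,\quad \eta_t=\tfrac{\alpha_0(t+t_0+1)}2,\quad \theta_t=\tfrac{t+t_0+1}{t+t_0+2},\quad \tau_t=\tfrac1{t+1}\max\Big\{\tfrac{32\mathcal M^2}{\alpha_0},\tfrac{384\|\sigma\|_2^2T}{\alpha_0},\tfrac{\sigma_{X,f}T^{3/2}}{B(t_0+2)^{1/2}}\Big\}$$ (in the degenerate case $\tau_t=0$, where all constraint data are constant and noise-free, $\frac1{\tau_t}s_t$ is read as $0$). Let $$\mathcal H_*=H_0+(\|y^*\|_2+1)H_f+\tfrac{L_fD_X[\|y^*\|_2+1-B]_+}2,$$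 $$\zeta=2e\Big\{\sigma_0^2+12(t_0+3)\|\sigma\|_2^2\|y^*\|_2^2+96(t_0+2)B^2\|\sigma\|_2^2+\tfrac{\mathcal H_*^2}2+\tfrac{3\alpha_0B\sigma_{X,f}(t_0+2)^{3/2}}2\Big\}^{1/2}.$$ **Corollary 2.2.** Let $\varepsilon>0$. If $T\ge1$ is an integer with $T\ge T_\varepsilon$, where $$T_\varepsilon=\max\Big\{\Big(\tfrac{5\alpha_0(t_0+2)(t_0+1)D_X^2}{\varepsilon}+\tfrac{960(t_0+2)(\|y^*\|_2+1)^2\mathcal M^2}{\alpha_0\varepsilon}\Big)^{1/2},\ \Big(\tfrac{65B\sigma_{X,f}(t_0+2)^{3/2}}{\varepsilon}\Big)^{2/3},$$ $$\tfrac{80(\zeta^2+\mathcal H_*^2+144(t_0+2)(\|y^*\|_2+1)^2\|\sigma\|_2^2)}{\alpha_0\varepsilon},\ \Big(\tfrac{30(\|y^*\|_2+1)^2\sigma_{X,f}}{B}\Big)^2\tfrac{t_0+2}{\varepsilon^2},\ \Big(\tfrac{130B\sigma_{X,f}}3\Big)^2\tfrac{t_0+2}{\varepsilon^2}\Big\},$$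 then $\bar x_T\in X$ is a stochastic $(\varepsilon,\varepsilon)$-approximately optimal solution: $\mathbb{E}[\psi_0(\bar x_T)-\psi_0^*]\le\varepsilon$, where $\psi_0^*$ is the optimal value, and $\mathbb{E}\|[\psi(\bar x_T)]_+\|_2\le\varepsilon$, where $\psi=(\psi_1,\dots,\psi_m)$. Moreover, if $T\ge1$ is an integer with $$T\ge\max\Big\{\Big(\tfrac{5(t_0+2)(t_0+1)D_X^2}{\varepsilon}+\tfrac{960(t_0+2)(\|y^*\|_2+1)^2\mathcal M^2}{\alpha_0^2\varepsilon}\Big)^{1/2},\ \Big(\tfrac{60B\sigma_{X,f}(t_0+2)^{3/2}}{\alpha_0\varepsilon}\Big)^{2/3},$$ $$\tfrac{80(\zeta^2+\mathcal H_*^2+144(t_0+2)(\|y^*\|_2+1)^2\|\sigma\|_2^2)}{\alpha_0^2\varepsilon},\ \Big(\tfrac{5\|y^*\|_2^2\sigma_{X,f}}{B\alpha_0}\Big)^2\tfrac{t_0+2}{\varepsilon^2},\ \Big(\tfrac{40B\sigma_{X,f}}{\alpha_0}\Big)^2\tfrac{t_0+2}{\varepsilon^2}\Big\},$$ then $\mathbb{E}[W(x^*,x_T)]\le\varepsilon$.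 All three expectations exist. -/

import Mathlib

open MeasureTheory ProbabilityTheory

noncomputable section

namespace ConEx

/-- `ℝⁿ` with its standard inner product and Euclidean norm. -/
abbrev Vec (n : ℕ) := EuclideanSpace ℝ (Fin n)

/-- The dual norm `‖z‖_* = sup {zᵀx : ‖x‖ ≤ 1}` of the norm `N`. -/
def dualNorm {n : ℕ} (N : Seminorm ℝ (Vec n)) (z : Vec n) : ℝ :=
  sSup {r : ℝ | ∃ x : Vec n, N x ≤ 1 ∧ r = inner ℝ z x}

/-- The subdifferential of a convex function `h : X → ℝ`.  At a point of the relative interior of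
`X` it consists of the subgradients of `h` lying in the linear span of `X - X`; at any other point
of `X` it consists of the limits of subgradients at points of the relative interior. -/
def subdiff {n : ℕ} (X : Set (Vec n)) (h : Vec n → ℝ) (x : Vec n) : Set (Vec n) :=
  let interiorSubgrad : Vec n → Set (Vec n) := fun u =>
    {g | g ∈ vectorSpan ℝ X ∧ ∀ z ∈ X, h u + inner ℝ g (z - u) ≤ h z}
  {g | (x ∈ intrinsicInterior ℝ X ∧ g ∈ interiorSubgrad x) ∨
    (x ∈ X ∧ x ∉ intrinsicInterior ℝ X ∧
      ∃ (u : ℕ → Vec n) (v : ℕ → Vec n),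
        (∀ k, u k ∈ intrinsicInterior ℝ X ∧ v k ∈ interiorSubgrad (u k)) ∧
        Filter.Tendsto u Filter.atTop (nhds x) ∧ Filter.Tendsto v Filter.atTop (nhds g))}

/-- The data of the composite problem
`min {f₀ x + χ₀ x : x ∈ X, fᵢ x + χᵢ x ≤ 0 for i = 1, …, m}`. -/
structure Problem (n m : ℕ) where
  X : Set (Vec n)
  f₀ : Vec n → ℝ
  χ₀ : Vec n → ℝ
  f : Fin m → Vec n → ℝ
  χ : Fin m → Vec n → ℝ

namespace Problem

variable {n m : ℕ} (P : Problem n m)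

/-- The objective `ψ₀ = f₀ + χ₀`. -/
def ψ₀ (x : Vec n) : ℝ := P.f₀ x + P.χ₀ x

/-- The constraint functions `ψᵢ = fᵢ + χᵢ`. -/
def ψ (i : Fin m) (x : Vec n) : ℝ := P.f i x + P.χ i x

/-- The optimal value `ψ₀^*`. -/
def optVal : ℝ := sInf (P.ψ₀ '' {x | x ∈ P.X ∧ ∀ i, P.ψ i x ≤ 0})

/-- The infeasibility measure `‖[ψ(x)]₊‖₂`. -/
def infeas (x : Vec n) : ℝ := Real.sqrt (∑ i, (max (P.ψ i x) 0) ^ 2)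

/-- The Lagrange function. -/
def lagrangian (x : Vec n) (y : Vec m) : ℝ := P.ψ₀ x + ∑ i, y i * P.ψ i x

/-- `(x^*, y^*)` is a saddle point of the Lagrange function on `X × {y ≥ 0}`. -/
def IsSaddle (xs : Vec n) (ys : Vec m) : Prop :=
  xs ∈ P.X ∧ (∀ i, 0 ≤ ys i) ∧
    (∀ y : Vec m, (∀ i, 0 ≤ y i) → P.lagrangian xs y ≤ P.lagrangian xs ys) ∧
    (∀ x ∈ P.X, P.lagrangian xs ys ≤ P.lagrangian x ys)

end Problem

/-- The random point `xbar` is a stochastic `(δo, δc)`-approximately optimal solution.  The two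
expectations are required to exist. -/
def IsStochasticOptimal {n m : ℕ} {Ω : Type*} [MeasurableSpace Ω] (P : Problem n m)
    (μ : Measure Ω) (xbar : Ω → Vec n) (δo δc : ℝ) : Prop :=
  (∀ s, xbar s ∈ P.X) ∧
    (Integrable (fun s => P.ψ₀ (xbar s) - P.optVal) μ ∧
      ∫ s, (P.ψ₀ (xbar s) - P.optVal) ∂μ ≤ δo) ∧
    (Integrable (fun s => P.infeas (xbar s)) μ ∧ ∫ s, P.infeas (xbar s) ∂μ ≤ δc)

/-- The prox-function (Bregman divergence)
`W(y, x) = ω(y) - ω(x) - ⟨∇ω(x), y - x⟩` of `ω` with gradient map `gω`. -/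
def breg {n : ℕ} (ω : Vec n → ℝ) (gω : Vec n → Vec n) (y x : Vec n) : ℝ :=
  ω y - ω x - inner ℝ (gω x) (y - x)

/-- `ω : X → ℝ` is continuously differentiable with gradient map `gω`, its gradient is Lipschitz
with respect to `N` and the dual norm, and `ω` is `1`-strongly convex with respect to `N`. -/
structure IsProxGenerator {n : ℕ} (N : Seminorm ℝ (Vec n)) (X : Set (Vec n))
    (ω : Vec n → ℝ) (gω : Vec n → Vec n) : Prop where
  grad : ∀ x ∈ X, HasGradientWithinAt ω (gω x) X x
  grad_cont : ContinuousOn gω X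
  grad_lip : ∃ Lω : ℝ, 0 ≤ Lω ∧
    ∀ x ∈ X, ∀ y ∈ X, dualNorm N (gω x - gω y) ≤ Lω * N (x - y)
  strong : ∀ x ∈ X, ∀ y ∈ X, ω x + inner ℝ (gω x) (y - x) + 1 / 2 * N (y - x) ^ 2 ≤ ω y

/-- `D_X = max {√(2 W(x, y)) : x, y ∈ X}`. -/
def diamX {n : ℕ} (X : Set (Vec n)) (ω : Vec n → ℝ) (gω : Vec n → Vec n) : ℝ :=
  sSup {d : ℝ | ∃ x ∈ X, ∃ y ∈ X, d = Real.sqrt (2 * breg ω gω x y)}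

/-- `r` is `β`-strongly convex on `X` with respect to the Bregman divergence of `ω`, i.e.
`r - β ω` is convex on `X`.  Where `r` is differentiable this says
`r(x) ≥ r(y) + ⟨∇r(y), x - y⟩ + β W(x, y)`. -/
def StronglyConvexRel {n : ℕ} (X : Set (Vec n)) (ω : Vec n → ℝ) (β : ℝ) (r : Vec n → ℝ) : Prop :=
  ConvexOn ℝ X (fun x => r x - β * ω x)

/-- The numerical constants of the problem class. Index `0` refers to the objective, the families
to the constraints. -/
structure Constants (m : ℕ) where
  α₀ : ℝ
  L₀ : ℝ
  H₀ : ℝ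
  L : Fin m → ℝ
  H : Fin m → ℝ
  Mf : Fin m → ℝ
  Mχ : Fin m → ℝ
  σ₀ : ℝ
  σ : Fin m → ℝ
  σf : ℝ

/-- Euclidean norm of a finite family of reals. -/
def l2 {m : ℕ} (a : Fin m → ℝ) : ℝ := Real.sqrt (∑ i, a i ^ 2)

/-- The convex composite setting with a strongly convex objective: `X` is convex and compact,
`f₀, fᵢ` are convex and continuous, `χ₀` is convex, lower semicontinuous and `α₀`-strongly convex
with respect to `W` (`α₀ > 0`), the `χᵢ` are convex and continuous, and the smoothness / nonsmoothness
and Lipschitz conditions hold. -/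
structure IsConvexSetting {n m : ℕ} (P : Problem n m) (N : Seminorm ℝ (Vec n)) (ω : Vec n → ℝ)
    (c : Constants m) : Prop where
  X_convex : Convex ℝ P.X
  X_compact : IsCompact P.X
  f₀_convex : ConvexOn ℝ P.X P.f₀
  f₀_cont : ContinuousOn P.f₀ P.X
  f_convex : ∀ i, ConvexOn ℝ P.X (P.f i)
  f_cont : ∀ i, ContinuousOn (P.f i) P.X
  χ₀_convex : ConvexOn ℝ P.X P.χ₀
  χ₀_lsc : LowerSemicontinuousOn P.χ₀ P.X
  χ_convex : ∀ i, ConvexOn ℝ P.X (P.χ i)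
  χ_cont : ∀ i, ContinuousOn (P.χ i) P.X
  α₀_pos : 0 < c.α₀
  χ₀_strong : StronglyConvexRel P.X ω c.α₀ P.χ₀
  L₀_nonneg : 0 ≤ c.L₀
  H₀_nonneg : 0 ≤ c.H₀
  L_nonneg : ∀ i, 0 ≤ c.L i
  H_nonneg : ∀ i, 0 ≤ c.H i
  Mf_nonneg : ∀ i, 0 ≤ c.Mf i
  Mχ_nonneg : ∀ i, 0 ≤ c.Mχ i
  f₀_smooth : ∀ x₁ ∈ P.X, ∀ x₂ ∈ P.X, ∀ g ∈ subdiff P.X P.f₀ x₂,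
    P.f₀ x₁ - P.f₀ x₂ - inner ℝ g (x₁ - x₂)
      ≤ c.L₀ / 2 * N (x₁ - x₂) ^ 2 + c.H₀ * N (x₁ - x₂)
  f_smooth : ∀ i, ∀ x₁ ∈ P.X, ∀ x₂ ∈ P.X, ∀ g ∈ subdiff P.X (P.f i) x₂,
    P.f i x₁ - P.f i x₂ - inner ℝ g (x₁ - x₂)
      ≤ c.L i / 2 * N (x₁ - x₂) ^ 2 + c.H i * N (x₁ - x₂)
  f_lip : ∀ i, ∀ x₁ ∈ P.X, ∀ x₂ ∈ P.X, P.f i x₁ - P.f i x₂ ≤ c.Mf i * N (x₁ - x₂)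
  χ_lip : ∀ i, ∀ x₁ ∈ P.X, ∀ x₂ ∈ P.X, P.χ i x₁ - P.χ i x₂ ≤ c.Mχ i * N (x₁ - x₂)

/-- The outputs `G₀(x, ξ)`, `Gᵢ(x, ξ)`, `F(x, ξ)` of a stochastic oracle and the law of `ξ`. -/
structure Oracle (n m : ℕ) (Ξ : Type*) [MeasurableSpace Ξ] where
  law : Measure Ξ
  G₀ : Vec n → Ξ → Vec n
  G : Fin m → Vec n → Ξ → Vec n
  F : Vec n → Ξ → Vec m

/-- The oracle is unbiased, for subgradients `f₀'(x) = df₀ x`, `fᵢ'(x) = df i x`, and its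
variances are bounded by `σ₀²`, `σᵢ²`, `σ_f²`. -/
structure IsStochasticOracle {n m : ℕ} {Ξ : Type*} [MeasurableSpace Ξ] (P : Problem n m)
    (N : Seminorm ℝ (Vec n)) (c : Constants m) (O : Oracle n m Ξ)
    (df₀ : Vec n → Vec n) (df : Fin m → Vec n → Vec n) : Prop where
  law_prob : IsProbabilityMeasure O.law
  meas_G₀ : Measurable fun p : Vec n × Ξ => O.G₀ p.1 p.2
  meas_G : ∀ i, Measurable fun p : Vec n × Ξ => O.G i p.1 p.2
  meas_F : Measurable fun p : Vec n × Ξ => O.F p.1 p.2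
  σ₀_nonneg : 0 ≤ c.σ₀
  σ_nonneg : ∀ i, 0 ≤ c.σ i
  σf_nonneg : 0 ≤ c.σf
  df₀_mem : ∀ x ∈ P.X, df₀ x ∈ subdiff P.X P.f₀ x
  df_mem : ∀ i, ∀ x ∈ P.X, df i x ∈ subdiff P.X (P.f i) x
  mean_G₀ : ∀ x ∈ P.X, Integrable (O.G₀ x) O.law ∧ ∫ s, O.G₀ x s ∂O.law = df₀ x
  mean_G : ∀ i, ∀ x ∈ P.X, Integrable (O.G i x) O.law ∧ ∫ s, O.G i x s ∂O.law = df i x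
  mean_F : ∀ x ∈ P.X, Integrable (O.F x) O.law ∧
    ∫ s, O.F x s ∂O.law = WithLp.toLp 2 (fun i => P.f i x)
  var_G₀ : ∀ x ∈ P.X, Integrable (fun s => dualNorm N (O.G₀ x s - df₀ x) ^ 2) O.law ∧
    ∫ s, dualNorm N (O.G₀ x s - df₀ x) ^ 2 ∂O.law ≤ c.σ₀ ^ 2
  var_G : ∀ i, ∀ x ∈ P.X, Integrable (fun s => dualNorm N (O.G i x s - df i x) ^ 2) O.law ∧
    ∫ s, dualNorm N (O.G i x s - df i x) ^ 2 ∂O.law ≤ c.σ i ^ 2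
  var_F : ∀ x ∈ P.X,
    Integrable (fun s => ‖O.F x s - WithLp.toLp 2 (fun i => P.f i x)‖ ^ 2) O.law ∧
    ∫ s, ‖O.F x s - WithLp.toLp 2 (fun i => P.f i x)‖ ^ 2 ∂O.law ≤ c.σf ^ 2

/-- `ξ₀, ξ₁, …` and `ξ̄₀, ξ̄₁, …` are independent samples, all with distribution `ν`. -/
structure IsSampling {Ω Ξ : Type*} [MeasurableSpace Ω] [MeasurableSpace Ξ] (μ : Measure Ω)
    (ν : Measure Ξ) (ξ ξbar : ℕ → Ω → Ξ) : Prop where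
  meas : ∀ t, Measurable (ξ t)
  meas_bar : ∀ t, Measurable (ξbar t)
  dist : ∀ t, μ.map (ξ t) = ν
  dist_bar : ∀ t, μ.map (ξbar t) = ν
  indep : iIndepFun (Sum.elim ξ ξbar) μ

/-- The stepsize parameters of the algorithm. -/
structure Stepsizes where
  γ : ℕ → ℝ
  η : ℕ → ℝ
  τ : ℕ → ℝ
  θ : ℕ → ℝ

/-- The point `xplus` is `prox(w, v, xt, η)`, i.e. it minimizes
`χ₀(u) + ∑ wᵢ χᵢ(u) + ⟨v, u⟩ + η W(u, xt)` over `u ∈ X`. -/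
def IsProx {n m : ℕ} (P : Problem n m) (ω : Vec n → ℝ) (gω : Vec n → Vec n)
    (w : Vec m) (v xt : Vec n) (η : ℝ) (xplus : Vec n) : Prop :=
  xplus ∈ P.X ∧
    IsMinOn (fun u => P.χ₀ u + ∑ i, w i * P.χ i u + inner ℝ v u + η * breg ω gω u xt) P.X xplus

section Algorithm

variable {n m : ℕ} {Ξ : Type*} [MeasurableSpace Ξ]

/-- The stochastic linearization `ℓ_F(x_t)` along the iterates `x` and samples `ξbar`:
`ℓ_F(x_{t+1}) = F(x_t, ξ̄_t) + G(x_t, ξ̄_t)ᵀ (x_{t+1} - x_t)`, and `ℓ_F(x_0) = F(x_0, ξ̄_0)` because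
of the initialization `x_{-1} = x_0`, `F(x_{-1}) = F(x_0, ξ̄_0)`. -/
def linF (O : Oracle n m Ξ) (x : ℕ → Vec n) (ξbar : ℕ → Ξ) : ℕ → Vec m
  | 0 => O.F (x 0) (ξbar 0)
  | t + 1 => O.F (x t) (ξbar t) +
      WithLp.toLp 2 (fun i => (inner ℝ (O.G i (x t) (ξbar t)) (x (t + 1) - x t) : ℝ))

/-- `χ(x_t) + ℓ_F(x_t)`. -/
def constrEst (P : Problem n m) (O : Oracle n m Ξ) (x : ℕ → Vec n) (ξbar : ℕ → Ξ) (t : ℕ) : Vec m :=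
  WithLp.toLp 2 (fun i => P.χ i (x t)) + linF O x ξbar t

/-- The extrapolation
`s_t = (1 + θ_t) [χ(x_t) + ℓ_F(x_t)] - θ_t [χ(x_{t-1}) + ℓ_F(x_{t-1})]`, with `x_{-1} = x_0` and
`ℓ_F(x_{-1}) = ℓ_F(x_0)`. -/
def extrap (P : Problem n m) (O : Oracle n m Ξ) (θ : ℕ → ℝ) (x : ℕ → Vec n) (ξbar : ℕ → Ξ) :
    ℕ → Vec m
  | 0 => (1 + θ 0) • constrEst P O x ξbar 0 - θ 0 • constrEst P O x ξbar 0
  | t + 1 => (1 + θ (t + 1)) • constrEst P O x ξbar (t + 1) - θ (t + 1) • constrEst P O x ξbar t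

/-- `x_0, …, x_T` and `y_0, …, y_T` are the iterates of `T` iterations of the constraint
extrapolation method started at `(x0, y0)` with samples `ξ`, `ξbar`. -/
structure IsRun (P : Problem n m) (ω : Vec n → ℝ) (gω : Vec n → Vec n) (O : Oracle n m Ξ)
    (S : Stepsizes) (x0 : Vec n) (y0 : Vec m) (T : ℕ) (ξ ξbar : ℕ → Ξ)
    (x : ℕ → Vec n) (y : ℕ → Vec m) : Prop where
  x_init : x 0 = x0
  y_init : y 0 = y0
  y_step : ∀ t < T, ∀ i,
    y (t + 1) i = max (y t i + 1 / S.τ t * extrap P O S.θ x ξbar t i) 0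
  x_step : ∀ t < T, IsProx P ω gω (y (t + 1))
    (O.G₀ (x t) (ξ t) + ∑ i, y (t + 1) i • O.G i (x t) (ξ t)) (x t) (S.η t) (x (t + 1))

/-- The output `x̄_T = (∑_{t<T} γ_t)⁻¹ ∑_{t<T} γ_t x_{t+1}`. -/
def output (S : Stepsizes) (T : ℕ) (x : ℕ → Vec n) : Vec n :=
  (∑ t ∈ Finset.range T, S.γ t)⁻¹ • ∑ t ∈ Finset.range T, S.γ t • x (t + 1)

end Algorithm

namespace Constants

variable {m : ℕ} (c : Constants m)

/-- `t₀ = 4 (L₀ + B L_f) / α₀ + 2`. -/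
def t₀ (B : ℝ) : ℝ := 4 * (c.L₀ + B * l2 c.L) / c.α₀ + 2

/-- `𝓜 = max {2 M_f, M_χ + M_f}`. -/
def bigM : ℝ := max (2 * l2 c.Mf) (l2 c.Mχ + l2 c.Mf)

/-- `σ_{X,f} = (σ_f² + D_X² ‖σ‖₂²)^{1/2}`. -/
def σX (D : ℝ) : ℝ := Real.sqrt (c.σf ^ 2 + D ^ 2 * l2 c.σ ^ 2)

/-- The stepsize policy for a total number `T` of iterations. -/
def steps (B D : ℝ) (T : ℕ) : Stepsizes where
  γ t := t + c.t₀ B + 2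
  η t := c.α₀ * (t + c.t₀ B + 1) / 2
  τ t := 1 / ((t : ℝ) + 1) *
    max (max (32 * c.bigM ^ 2 / c.α₀) (384 * l2 c.σ ^ 2 * T / c.α₀))
      (c.σX D * (T : ℝ) ^ (3 / 2 : ℝ) / (B * (c.t₀ B + 2) ^ (1 / 2 : ℝ)))
  θ t := (t + c.t₀ B + 1) / (t + c.t₀ B + 2)

/-- `𝓗_* = H₀ + (‖y^*‖₂ + 1) H_f + L_f D_X [‖y^*‖₂ + 1 - B]₊ / 2`, where `Y = ‖y^*‖₂`. -/
def Hstar (B D Y : ℝ) : ℝ :=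
  c.H₀ + (Y + 1) * l2 c.H + l2 c.L * D * max (Y + 1 - B) 0 / 2

/-- The constant `ζ`, where `Y = ‖y^*‖₂`. -/
def ζ (B D Y : ℝ) : ℝ :=
  2 * Real.exp 1 * Real.sqrt (c.σ₀ ^ 2 + 12 * (c.t₀ B + 3) * l2 c.σ ^ 2 * Y ^ 2
    + 96 * (c.t₀ B + 2) * B ^ 2 * l2 c.σ ^ 2 + c.Hstar B D Y ^ 2 / 2
    + 3 * c.α₀ * B * c.σX D * (c.t₀ B + 2) ^ (3 / 2 : ℝ) / 2)

/-- The iteration count `T_ε` for an `(ε, ε)`-optimal solution, where `Y = ‖y^*‖₂`. -/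
def Teps (B D Y ε : ℝ) : ℝ :=
  max (max (max (max
    ((5 * c.α₀ * (c.t₀ B + 2) * (c.t₀ B + 1) * D ^ 2 / ε
      + 960 * (c.t₀ B + 2) * (Y + 1) ^ 2 * c.bigM ^ 2 / (c.α₀ * ε)) ^ (1 / 2 : ℝ))
    ((65 * B * c.σX D * (c.t₀ B + 2) ^ (3 / 2 : ℝ) / ε) ^ (2 / 3 : ℝ)))
    (80 * (c.ζ B D Y ^ 2 + c.Hstar B D Y ^ 2
      + 144 * (c.t₀ B + 2) * (Y + 1) ^ 2 * l2 c.σ ^ 2) / (c.α₀ * ε)))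
    ((30 * (Y + 1) ^ 2 * c.σX D / B) ^ 2 * ((c.t₀ B + 2) / ε ^ 2)))
    ((130 * B * c.σX D / 3) ^ 2 * ((c.t₀ B + 2) / ε ^ 2))

/-- The iteration count for `𝔼[W(x^*, x_T)] ≤ ε`, where `Y = ‖y^*‖₂`. -/
def TepsLast (B D Y ε : ℝ) : ℝ :=
  max (max (max (max
    ((5 * (c.t₀ B + 2) * (c.t₀ B + 1) * D ^ 2 / ε
      + 960 * (c.t₀ B + 2) * (Y + 1) ^ 2 * c.bigM ^ 2 / (c.α₀ ^ 2 * ε)) ^ (1 / 2 : ℝ))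
    ((60 * B * c.σX D * (c.t₀ B + 2) ^ (3 / 2 : ℝ) / (c.α₀ * ε)) ^ (2 / 3 : ℝ)))
    (80 * (c.ζ B D Y ^ 2 + c.Hstar B D Y ^ 2
      + 144 * (c.t₀ B + 2) * (Y + 1) ^ 2 * l2 c.σ ^ 2) / (c.α₀ ^ 2 * ε)))
    ((5 * Y ^ 2 * c.σX D / (B * c.α₀)) ^ 2 * ((c.t₀ B + 2) / ε ^ 2)))
    ((40 * B * c.σX D / c.α₀) ^ 2 * ((c.t₀ B + 2) / ε ^ 2))

end Constants

end ConEx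

end

/-! The method is a primal-dual proximal scheme for the Lagrange function. Write `a` for `t₀`, `γ_t
= t + a + 2` and `τ_t = K / (t + 1)`. The proof bounds, outcome by outcome, the weighted sum of gaps
against a pair `(xs, v)` with `v ≥ 0`, and takes expectations only afterwards.

Pathwise part. Since `χ₀ - α₀ ω` is convex, the prox step satisfies a three-point inequality with
the improved weight `η_t + α₀` (`IsProx.three_point`, used in `IsConExPath.primal_step`); the
multiplier step is a projection (`IsConExPath.dual_step`). Multiplied by `γ_t` and added, these
telescope: `γ_t (η_t + α₀) = γ_{t+1} η_{t+1}` for the Bregman terms, `γ_t τ_t` is nonincreasing for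
the dual distances, and `γ_t θ_t = t + a + 1` is the previous weight, so each extrapolation term
cancels against the next one. What is left pairs the change of the constraint estimate with `y_{t+1}
- y_t`. Young's inequality and `K ≥ 32 𝓜² / α₀` turn it into squared primal steps, which the
negative quadratic term of the primal inequality pays for (`step_budget`). The outcome is
`IsConExPath.estimate`.

Stochastic part. The iterates are adapted to the samples, so the terms linear in the oracle errors
have mean zero. The first iteration is an exception: `y_1`, hence `x_1`, already depends on `ξ̄_0`,
and only the value error `φ 0` is kept as a mean-zero term. The variance of the primal gradient
error contains `𝔼‖y_{t+1}‖²`, for which no bound is known beforehand. The estimate with `v = y^*`,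
where the gaps are nonnegative, bounds `𝔼‖y^* - y_k‖²` by a constant plus `1 / (12 T)` times the sum
of these same variances, thanks to `K ≥ 384 ‖σ‖₂² T / α₀`. The loop closes at the largest variance
(`le_of_averaged_recursion`), with `ζ² / 2` as uniform bound (`IsExperiment.mean_primalErr_le`).

Conclusion. The choice `v = y^*` controls the last iterate, and `v = 0` the objective at the
average. For infeasibility `v` is the multiplier of norm `‖y^*‖₂ + 1` aligned with `[ψ(x̄)]₊`. It is
random, so the weighted sum of constraint errors no longer averages out against it; its second
moment is used instead (`moment_errSum`). The iteration counts make all contributions fit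
(`accuracy_budget`, `errSum_budget`).

If the prescribed `K` vanishes, the constraints are constant and almost surely noise-free, the
multipliers stay at zero, and the same trajectory obeys the recursion for every positive `K`
(`exists_rate`). -/

namespace ConEx

/-! ### Norms and dual norms -/

section Norm

variable {n : ℕ} {N : Seminorm ℝ (Vec n)}

lemma seminorm_continuous (N : Seminorm ℝ (Vec n)) : Continuous N := by
  have h := (N.convexOn).continuousOn_interior
  simpa using h

/-- A definite seminorm attains a positive minimum on the compact Euclidean unit sphere. -/
lemma exists_seminorm_lower (hN : ∀ v, N v = 0 → v = 0) :
    ∃ r : ℝ, 0 < r ∧ ∀ x, r * ‖x‖ ≤ N x := by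
  by_cases hne : (Metric.sphere (0 : Vec n) 1).Nonempty
  · obtain ⟨u, hu, hmin⟩ := (isCompact_sphere (0 : Vec n) 1).exists_isMinOn hne
      (seminorm_continuous N).continuousOn
    have hu1 : ‖u‖ = 1 := by simpa using hu
    refine ⟨N u, lt_of_le_of_ne (apply_nonneg N u) (fun h => ?_), fun x => ?_⟩
    · have := hN u h.symm
      simp [this] at hu1
    · by_cases hx : x = 0
      · simp [hx]
      · have hx' : ‖x‖ ≠ 0 := by simpa using hx
        have hm : N u ≤ N (‖x‖⁻¹ • x) := hmin (by simp [norm_smul, hx'])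
        rw [map_smul_eq_mul, norm_inv, norm_norm] at hm
        calc N u * ‖x‖ ≤ ‖x‖⁻¹ * N x * ‖x‖ := by gcongr
          _ = N x := by field_simp
  -- An empty sphere means dimension zero, where any constant works.
  · refine ⟨1, one_pos, fun x => ?_⟩
    by_cases hx : x = 0
    · simp [hx]
    · exact absurd ⟨‖x‖⁻¹ • x, by simp [norm_smul, hx]⟩ hne

/-- The real `sSup` is meaningful only for bounded sets, so every inequality for the dual norm rests
on this. -/
lemma bddAbove_dualNorm (hN : ∀ v, N v = 0 → v = 0) (z : Vec n) :
    BddAbove {r : ℝ | ∃ x : Vec n, N x ≤ 1 ∧ r = inner ℝ z x} := by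
  obtain ⟨r, hr, h⟩ := exists_seminorm_lower hN
  refine ⟨‖z‖ * r⁻¹, ?_⟩
  rintro _ ⟨x, hx, rfl⟩
  refine (real_inner_le_norm z x).trans ?_
  gcongr
  rw [← one_div, le_div_iff₀ hr, mul_comm]
  exact (h x).trans hx

lemma dualNorm_nonneg (hN : ∀ v, N v = 0 → v = 0) (z : Vec n) : 0 ≤ dualNorm N z :=
  le_csSup (bddAbove_dualNorm hN z) ⟨0, by simp, by simp⟩

lemma inner_le_dualNorm_mul (hN : ∀ v, N v = 0 → v = 0) (z x : Vec n) :
    inner ℝ z x ≤ dualNorm N z * N x := by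
  by_cases hx : N x = 0
  · simp [hN x hx]
  · have hpos : 0 < N x := lt_of_le_of_ne (apply_nonneg N x) (Ne.symm hx)
    have h1 : inner ℝ z ((N x)⁻¹ • x) ≤ dualNorm N z :=
      le_csSup (bddAbove_dualNorm hN z)
        ⟨_, by rw [map_smul_eq_mul, norm_inv, Real.norm_of_nonneg hpos.le, inv_mul_cancel₀ hx], rfl⟩
    rw [inner_smul_right, inv_mul_le_iff₀ hpos] at h1
    linarith

lemma abs_inner_le_dualNorm_mul (hN : ∀ v, N v = 0 → v = 0) (z x : Vec n) :
    |inner ℝ z x| ≤ dualNorm N z * N x := by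
  rw [abs_le]
  constructor
  · have := inner_le_dualNorm_mul hN z (-x)
    rw [inner_neg_right, map_neg_eq_map] at this
    linarith
  · exact inner_le_dualNorm_mul hN z x

lemma dualNorm_le (z : Vec n) {r : ℝ}
    (h : ∀ x, N x ≤ 1 → inner ℝ z x ≤ r) : dualNorm N z ≤ r := by
  refine csSup_le ⟨0, 0, by simp, by simp⟩ ?_
  rintro _ ⟨x, hx, rfl⟩
  exact h x hx

lemma dualNorm_add_le (hN : ∀ v, N v = 0 → v = 0) (z w : Vec n) :
    dualNorm N (z + w) ≤ dualNorm N z + dualNorm N w := by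
  refine dualNorm_le _ fun x hx => ?_
  rw [inner_add_left]
  have h1 := inner_le_dualNorm_mul hN z x
  have h2 := inner_le_dualNorm_mul hN w x
  have := dualNorm_nonneg hN z
  have := dualNorm_nonneg hN w
  nlinarith

lemma exists_dualNorm_le_norm (hN : ∀ v, N v = 0 → v = 0) :
    ∃ C : ℝ, 0 ≤ C ∧ ∀ z, dualNorm N z ≤ C * ‖z‖ := by
  obtain ⟨r, hr, h⟩ := exists_seminorm_lower hN
  refine ⟨r⁻¹, by positivity, fun z => dualNorm_le _ fun x hx => ?_⟩
  refine (real_inner_le_norm z x).trans ?_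
  rw [mul_comm]
  gcongr
  rw [← one_div, le_div_iff₀ hr, mul_comm]
  exact (h x).trans hx

/-- Needed for the measurability of the squared oracle errors. -/
lemma continuous_dualNorm (hN : ∀ v, N v = 0 → v = 0) : Continuous (dualNorm N) := by
  obtain ⟨C, hC, h⟩ := exists_dualNorm_le_norm hN
  have : LipschitzWith ⟨C, hC⟩ (dualNorm N) := by
    refine LipschitzWith.of_le_add_mul _ fun z w => ?_
    have h1 := dualNorm_add_le hN w (z - w)
    rw [add_sub_cancel] at h1
    have h2 := h (z - w)
    rw [dist_eq_norm]
    exact h1.trans (by gcongr; exact h2)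
  exact this.continuous

end Norm

/-! ### Subgradients and Lipschitz bounds -/

section Subdiff

variable {n : ℕ} {N : Seminorm ℝ (Vec n)} {X : Set (Vec n)} {h : Vec n → ℝ}

/-- At relative boundary points the inequality survives the limit because `h` is continuous on `X`.
-/
lemma subdiff_subgradient (hc : ContinuousOn h X) {x g : Vec n} (hg : g ∈ subdiff X h x)
    {z : Vec n} (hz : z ∈ X) : h x + inner ℝ g (z - x) ≤ h z := by
  rcases hg with ⟨-, hg⟩ | ⟨hx, -, u, v, huv, hu, hv⟩
  · exact hg.2 z hz
  · have hux : Filter.Tendsto u Filter.atTop (nhdsWithin x X) :=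
      tendsto_nhdsWithin_iff.2 ⟨hu, Filter.Eventually.of_forall fun k =>
        intrinsicInterior_subset (huv k).1⟩
    have h1 : Filter.Tendsto (fun k => h (u k) + inner ℝ (v k) (z - u k)) Filter.atTop
        (nhds (h x + inner ℝ g (z - x))) :=
      ((hc x hx).tendsto.comp hux).add (hv.inner (tendsto_const_nhds.sub hu))
    exact le_of_tendsto h1 (Filter.Eventually.of_forall fun k => (huv k).2.2 z hz)

lemma exists_pos_add_smul_mem {u d : Vec n} (hu : u ∈ intrinsicInterior ℝ X)
    (hd : d ∈ vectorSpan ℝ X) : ∃ s : ℝ, 0 < s ∧ u + s • d ∈ X := by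
  obtain ⟨p, hp, rfl⟩ := hu
  have hmem : ∀ s : ℝ, (p : Vec n) + s • d ∈ affineSpan ℝ X := fun s => by
    have : s • d ∈ (affineSpan ℝ X).direction := by
      rw [direction_affineSpan]; exact Submodule.smul_mem _ _ hd
    have := AffineSubspace.vadd_mem_of_mem_direction this p.2
    rwa [vadd_eq_add, add_comm] at this
  let c : ℝ → affineSpan ℝ X := fun s => ⟨(p : Vec n) + s • d, hmem s⟩
  have hc : Continuous c := by
    refine Continuous.subtype_mk ?_ _
    fun_prop
  have hc0 : c 0 = p := by ext1; simp [c]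
  have hn : ∀ᶠ s in nhds (0 : ℝ), c s ∈ interior ((↑) ⁻¹' X : Set (affineSpan ℝ X)) := by
    refine hc.continuousAt.eventually_mem ?_
    rw [hc0]
    exact isOpen_interior.mem_nhds hp
  obtain ⟨r, hr, hball⟩ := Metric.eventually_nhds_iff.1 hn
  refine ⟨r / 2, by positivity, ?_⟩
  have := interior_subset (hball (y := r / 2) (by
    rw [Real.dist_eq, sub_zero, abs_of_pos (by positivity)]; linarith))
  exact this

/-- At a relative interior point small steps along `d` and `-d` remain in `X`, so the Lipschitz
bound controls the slope both ways; the bound then passes to limits. An arbitrary subgradient at a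
boundary point could be as steep as one likes in the normal direction, which is why boundary
subgradients are taken as limits. -/
lemma abs_inner_subdiff_le {M : ℝ}
    (hl : ∀ x₁ ∈ X, ∀ x₂ ∈ X, h x₁ - h x₂ ≤ M * N (x₁ - x₂))
    {x g : Vec n} (hg : g ∈ subdiff X h x) {d : Vec n} (hd : d ∈ vectorSpan ℝ X) :
    |inner ℝ g d| ≤ M * N d := by
  have key : ∀ u ∈ intrinsicInterior ℝ X, ∀ g : Vec n,
      (∀ z ∈ X, h u + inner ℝ g (z - u) ≤ h z) → ∀ d ∈ vectorSpan ℝ X,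
        inner ℝ g d ≤ M * N d := by
    intro u hu g hg d hd
    obtain ⟨s, hs, hmem⟩ := exists_pos_add_smul_mem hu hd
    have h1 := hg _ hmem
    have h2 := hl _ hmem u (intrinsicInterior_subset hu)
    rw [add_sub_cancel_left, inner_smul_right] at h1
    rw [add_sub_cancel_left, map_smul_eq_mul, Real.norm_of_nonneg hs.le] at h2
    have h3 : s * inner ℝ g d ≤ s * (M * N d) := by linarith
    exact le_of_mul_le_mul_left h3 hs
  have key2 : ∀ u ∈ intrinsicInterior ℝ X, ∀ g : Vec n,
      (∀ z ∈ X, h u + inner ℝ g (z - u) ≤ h z) → |inner ℝ g d| ≤ M * N d := by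
    intro u hu g hg
    rw [abs_le]
    constructor
    · have := key u hu g hg (-d) (Submodule.neg_mem _ hd)
      rw [inner_neg_right, map_neg_eq_map] at this
      linarith
    · exact key u hu g hg d hd
  rcases hg with ⟨hx, hg⟩ | ⟨-, -, u, v, huv, -, hv⟩
  · exact key2 x hx g hg.2
  · have h1 : Filter.Tendsto (fun k => |inner ℝ (v k) d|) Filter.atTop (nhds |inner ℝ g d|) :=
      (hv.inner tendsto_const_nhds).abs
    exact le_of_tendsto h1 (Filter.Eventually.of_forall fun k =>
      key2 (u k) (huv k).1 (v k) (huv k).2.2)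

end Subdiff

/-! ### The Bregman divergence and the diameter of `X` -/

section Bregman

variable {n m : ℕ} {N : Seminorm ℝ (Vec n)} {X : Set (Vec n)} {ω : Vec n → ℝ}
  {gω : Vec n → Vec n}

lemma IsProxGenerator.continuousOn (hω : IsProxGenerator N X ω gω) : ContinuousOn ω X :=
  fun x hx => (hω.grad x hx).continuousWithinAt

lemma IsProxGenerator.continuousOn_breg (hω : IsProxGenerator N X ω gω) :
    ContinuousOn (fun p : Vec n × Vec n => breg ω gω p.1 p.2) (X ×ˢ X) := by
  unfold breg
  have h1 : ContinuousOn (fun p : Vec n × Vec n => ω p.1) (X ×ˢ X) :=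
    hω.continuousOn.comp continuousOn_fst fun p hp => hp.1
  have h2 : ContinuousOn (fun p : Vec n × Vec n => ω p.2) (X ×ˢ X) :=
    hω.continuousOn.comp continuousOn_snd fun p hp => hp.2
  have h3 : ContinuousOn (fun p : Vec n × Vec n => gω p.2) (X ×ˢ X) :=
    hω.grad_cont.comp continuousOn_snd fun p hp => hp.2
  exact (h1.sub h2).sub (h3.inner (continuousOn_fst.sub continuousOn_snd))

lemma IsProxGenerator.sq_le_breg (hω : IsProxGenerator N X ω gω) {x z : Vec n} (hx : x ∈ X)
    (hz : z ∈ X) : 1 / 2 * N (x - z) ^ 2 ≤ breg ω gω x z := by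
  have := hω.strong z hz x hx
  unfold breg
  linarith

lemma IsProxGenerator.breg_nonneg (hω : IsProxGenerator N X ω gω) {x z : Vec n} (hx : x ∈ X)
    (hz : z ∈ X) : 0 ≤ breg ω gω x z :=
  le_trans (by positivity) (hω.sq_le_breg hx hz)

lemma diamX_nonneg (X : Set (Vec n)) (ω : Vec n → ℝ) (gω : Vec n → Vec n) :
    0 ≤ diamX X ω gω := by
  refine Real.sSup_nonneg ?_
  rintro _ ⟨x, -, y, -, rfl⟩
  exact Real.sqrt_nonneg _

lemma IsProxGenerator.two_breg_le (hω : IsProxGenerator N X ω gω) (hX : IsCompact X)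
    {x z : Vec n} (hx : x ∈ X) (hz : z ∈ X) : 2 * breg ω gω x z ≤ diamX X ω gω ^ 2 := by
  have hb : BddAbove {d : ℝ | ∃ x ∈ X, ∃ y ∈ X, d = Real.sqrt (2 * breg ω gω x y)} := by
    obtain ⟨C, hC⟩ := ((hX.prod hX).image_of_continuousOn
      (f := fun p : Vec n × Vec n => Real.sqrt (2 * breg ω gω p.1 p.2))
      (continuousOn_const.mul hω.continuousOn_breg).sqrt).bddAbove
    refine ⟨C, ?_⟩
    rintro _ ⟨x, hx, y, hy, rfl⟩
    exact hC ⟨(x, y), ⟨hx, hy⟩, rfl⟩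
  have h1 : Real.sqrt (2 * breg ω gω x z) ≤ diamX X ω gω := le_csSup hb ⟨x, hx, z, hz, rfl⟩
  have h0 : 0 ≤ 2 * breg ω gω x z := by have := hω.breg_nonneg hx hz; linarith
  calc 2 * breg ω gω x z = Real.sqrt (2 * breg ω gω x z) ^ 2 := (Real.sq_sqrt h0).symm
    _ ≤ _ := by gcongr

lemma IsProxGenerator.seminorm_le_diamX (hω : IsProxGenerator N X ω gω) (hX : IsCompact X)
    {x z : Vec n} (hx : x ∈ X) (hz : z ∈ X) : N (x - z) ≤ diamX X ω gω := by
  refine abs_le_of_sq_le_sq' ?_ (diamX_nonneg X ω gω) |>.2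
  have h1 := hω.two_breg_le hX hx hz
  have h2 := hω.sq_le_breg hx hz
  linarith

end Bregman

end ConEx

namespace ConEx

/-! ### The prox step: three-point inequality, stability, measurability -/

section Prox

variable {n m : ℕ} {N : Seminorm ℝ (Vec n)} {P : Problem n m} {ω : Vec n → ℝ}
  {gω : Vec n → Vec n} {c : Constants m}

/-- Divide by `s` and let `s → 0+`. This provides a first-order optimality condition that
differentiates only `ω`, never the nonsmooth functions. -/
lemma le_inner_gradient_of_segment {X : Set (Vec n)} (hX : Convex ℝ X) {x z g : Vec n}
    (hx : x ∈ X) (hz : z ∈ X) (hg : HasGradientWithinAt ω g X z) {b β : ℝ}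
    (h : ∀ s : ℝ, 0 < s → s ≤ 1 → s * b ≤ β * (ω (z + s • (x - z)) - ω z)) :
    b ≤ β * inner ℝ g (x - z) := by
  have hmaps : Set.MapsTo (fun s : ℝ => z + s • (x - z)) (Set.Icc 0 1) X := fun s hs =>
    hX.add_smul_sub_mem hz hx hs
  have hline : HasDerivWithinAt (fun s : ℝ => z + s • (x - z)) (x - z) (Set.Icc 0 1) 0 := by
    have := ((hasDerivWithinAt_id (0 : ℝ) (Set.Icc 0 1)).smul_const (x - z)).const_add z
    simpa using this
  have hg' : HasFDerivWithinAt ω (InnerProductSpace.toDual ℝ (Vec n) g) X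
      ((fun s : ℝ => z + s • (x - z)) 0) := by
    simpa using hg.hasFDerivWithinAt
  have hd := hg'.comp_hasDerivWithinAt (0 : ℝ) hline hmaps
  rw [hasDerivWithinAt_iff_tendsto_slope, InnerProductSpace.toDual_apply_apply] at hd
  have hset : (Set.Icc (0 : ℝ) 1 \ {0}) = Set.Ioc 0 1 := by
    ext s; simp only [Set.mem_sdiff, Set.mem_Icc, Set.mem_singleton_iff, Set.mem_Ioc]
    constructor
    · rintro ⟨⟨h1, h2⟩, h3⟩; exact ⟨lt_of_le_of_ne h1 (Ne.symm h3), h2⟩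
    · rintro ⟨h1, h2⟩; exact ⟨⟨h1.le, h2⟩, h1.ne'⟩
  rw [hset] at hd
  have : (nhdsWithin (0 : ℝ) (Set.Ioc 0 1)).NeBot := by
    rw [nhdsWithin_Ioc_eq_nhdsGT one_pos]; infer_instance
  refine ge_of_tendsto (hd.const_mul β) ?_
  filter_upwards [self_mem_nhdsWithin] with s hs
  have h1 := h s hs.1 hs.2
  simp only [slope_def_field, Function.comp, zero_smul, add_zero, sub_zero]
  rw [mul_div_assoc', le_div_iff₀ hs.1]
  linarith

/-- The prox objective is, up to a constant, a convex function plus `(η + α₀) ω`. Comparing the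
minimizer with nearby points of the segment to `x` yields the extra divergence with weight `η + α₀`.
-/
lemma IsProx.three_point (hω : IsProxGenerator N P.X ω gω) (hP : IsConvexSetting P N ω c)
    {w : Vec m} (hw : ∀ i, 0 ≤ w i) {v z xp : Vec n} {η : ℝ}
    (hp : IsProx P ω gω w v z η xp) {x : Vec n} (hx : x ∈ P.X) :
    P.χ₀ xp + ∑ i, w i * P.χ i xp + inner ℝ v xp + η * breg ω gω xp z
        + (η + c.α₀) * breg ω gω x xp
      ≤ P.χ₀ x + ∑ i, w i * P.χ i x + inner ℝ v x + η * breg ω gω x z := by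
  obtain ⟨hxp, hmin⟩ := hp
  -- `b` is the difference, between `xp` and `x`, of the convex part that remains when `(η + α₀) ω`
  -- is split off.
  have key := le_inner_gradient_of_segment (ω := ω) hP.X_convex hx hxp (hω.grad xp hxp)
    (b := (P.χ₀ xp - c.α₀ * ω xp + ∑ i, w i * P.χ i xp + inner ℝ v xp - η * inner ℝ (gω z) xp)
      - (P.χ₀ x - c.α₀ * ω x + ∑ i, w i * P.χ i x + inner ℝ v x - η * inner ℝ (gω z) x))
    (β := η + c.α₀) ?_
  · unfold breg
    simp only [inner_sub_right] at key ⊢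
    linarith
  · intro s hs hs1
    have hus : xp + s • (x - xp) = (1 - s) • xp + s • x := by module
    have hmem : (1 - s) • xp + s • x ∈ P.X :=
      hP.X_convex hxp hx (by linarith) hs.le (by ring)
    have h0 := hP.χ₀_strong.2 hxp hx (by linarith : 0 ≤ 1 - s) hs.le (by ring)
    have h1 : ∑ i, w i * P.χ i ((1 - s) • xp + s • x)
        ≤ (1 - s) * ∑ i, w i * P.χ i xp + s * ∑ i, w i * P.χ i x := by
      rw [Finset.mul_sum, Finset.mul_sum, ← Finset.sum_add_distrib]
      refine Finset.sum_le_sum fun i _ => ?_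
      have := (hP.χ_convex i).2 hxp hx (by linarith : 0 ≤ 1 - s) hs.le (by ring)
      simp only [smul_eq_mul] at this
      nlinarith [mul_le_mul_of_nonneg_left this (hw i)]
    have h2 := hmin hmem
    simp only [Set.mem_ofPred_eq] at h2
    rw [hus]
    unfold breg at h2
    simp only [inner_add_right, inner_sub_right, inner_smul_right, smul_eq_mul] at h0 h2 ⊢
    linarith

/-- Each three-point inequality is tested at the other minimizer and the two are added. Equal data
give uniqueness, converging data give continuity. -/
lemma IsProx.stability (hω : IsProxGenerator N P.X ω gω) (hP : IsConvexSetting P N ω c)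
    {w w' : Vec m} (hw : ∀ i, 0 ≤ w i) (hw' : ∀ i, 0 ≤ w' i) {v v' z z' u u' : Vec n} {η : ℝ}
    (hη : 0 ≤ η)
    (hp : IsProx P ω gω w v z η u) (hp' : IsProx P ω gω w' v' z' η u') :
    c.α₀ * N (u - u') ^ 2 ≤ ∑ i, (w i - w' i) * (P.χ i u' - P.χ i u) + inner ℝ (v - v') (u' - u)
      + η * inner ℝ (gω z' - gω z) (u' - u) := by
  have h1 := hp.three_point hω hP hw hp'.1
  have h2 := hp'.three_point hω hP hw' hp.1
  have h3 := hω.sq_le_breg hp.1 hp'.1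
  have h4 := hω.sq_le_breg hp'.1 hp.1
  rw [map_sub_rev N u' u] at h4
  have h5 : (η + c.α₀) * N (u - u') ^ 2 ≤ (η + c.α₀) * (breg ω gω u u' + breg ω gω u' u) := by
    have := hP.α₀_pos
    gcongr
    linarith
  have h6 : 0 ≤ η * N (u - u') ^ 2 := by positivity
  have hs : ∑ i, (w i - w' i) * (P.χ i u' - P.χ i u)
      = ∑ i, w i * P.χ i u' - ∑ i, w i * P.χ i u - ∑ i, w' i * P.χ i u' + ∑ i, w' i * P.χ i u := by
    simp only [← Finset.sum_sub_distrib, ← Finset.sum_add_distrib]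
    exact Finset.sum_congr rfl fun i _ => by ring
  rw [hs]
  unfold breg at h1 h2 h5
  simp only [inner_sub_right, inner_sub_left] at h1 h2 h5 ⊢
  linarith

lemma exists_isProx (hω : IsProxGenerator N P.X ω gω) (hP : IsConvexSetting P N ω c)
    (hne : P.X.Nonempty) (w : Vec m) (v z : Vec n) (η : ℝ) :
    ∃ u, IsProx P ω gω w v z η u := by
  have hlsc : LowerSemicontinuousOn
      (fun u => P.χ₀ u + (∑ i, w i * P.χ i u + inner ℝ v u + η * breg ω gω u z)) P.X := by
    refine hP.χ₀_lsc.add (ContinuousOn.lowerSemicontinuousOn ?_)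
    unfold breg
    have := hω.continuousOn
    have h2 : ∀ i, ContinuousOn (P.χ i) P.X := hP.χ_cont
    refine ((continuousOn_finsetSum _ fun i _ => continuousOn_const.mul (h2 i)).add
      (by fun_prop)).add ?_
    refine continuousOn_const.mul ((this.sub continuousOn_const).sub (by fun_prop))
  obtain ⟨u, hu, hmin⟩ := hlsc.exists_isMinOn hne hP.X_compact
  refine ⟨u, hu, ?_⟩
  simpa only [← add_assoc] using hmin

/-- Strong convexity makes the minimizer unique and continuous in the data, so no measurable
selection theorem is needed. -/
lemma exists_measurable_prox (hN : ∀ v, N v = 0 → v = 0) (hω : IsProxGenerator N P.X ω gω)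
    (hP : IsConvexSetting P N ω c) (hne : P.X.Nonempty) {η : ℝ} (hη : 0 ≤ η) :
    ∃ p : Vec m × Vec n × Vec n → Vec n, Measurable p ∧
      ∀ w v z u, (∀ i, 0 ≤ w i) → z ∈ P.X → IsProx P ω gω w v z η u → u = p (w, v, z) := by
  classical
  choose p hp using fun q : Vec m × Vec n × Vec n =>
    exists_isProx (η := η) hω hP hne q.1 q.2.1 q.2.2
  obtain ⟨r, hr, hrN⟩ := exists_seminorm_lower hN
  have hα := hP.α₀_pos
  let A : Set (Vec m × Vec n × Vec n) := {q | (∀ i, 0 ≤ q.1 i) ∧ q.2.2 ∈ P.X}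
  have hA : MeasurableSet A := by
    have h1 : MeasurableSet (⋂ i : Fin m, {q : Vec m × Vec n × Vec n | 0 ≤ q.1 i}) := by
      refine MeasurableSet.iInter fun i => ?_
      exact (isClosed_le continuous_const (by fun_prop)).measurableSet
    have h2 : MeasurableSet {q : Vec m × Vec n × Vec n | q.2.2 ∈ P.X} :=
      (hP.X_compact.isClosed.preimage (by fun_prop)).measurableSet
    have : A = (⋂ i : Fin m, {q : Vec m × Vec n × Vec n | 0 ≤ q.1 i}) ∩ {q | q.2.2 ∈ P.X} := by
      ext q; simp [A]
    rw [this]; exact h1.inter h2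
  have hbd : ∃ D : ℝ, 0 ≤ D ∧ (∀ i, ∀ u ∈ P.X, ∀ u' ∈ P.X, |P.χ i u' - P.χ i u| ≤ D) ∧
      ∀ u ∈ P.X, ∀ u' ∈ P.X, ‖u' - u‖ ≤ D := by
    obtain ⟨C, hC⟩ := hP.X_compact.isBounded.exists_norm_le
    have : ∀ i, ∃ Ci, ∀ u ∈ P.X, ‖P.χ i u‖ ≤ Ci := fun i => by
      obtain ⟨Ci, hCi⟩ := (hP.X_compact.image_of_continuousOn (hP.χ_cont i)).isBounded.exists_norm_le
      exact ⟨Ci, fun u hu => hCi _ ⟨u, hu, rfl⟩⟩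
    choose Ci hCi using this
    have hC0 : ∀ i, 0 ≤ Ci i := fun i => (norm_nonneg _).trans (hCi i _ hne.some_mem)
    have hCC : 0 ≤ C := (norm_nonneg _).trans (hC _ hne.some_mem)
    refine ⟨2 * (C + ∑ i, Ci i), by have := Finset.sum_nonneg fun i (_ : i ∈ Finset.univ) => hC0 i
                                    positivity, ?_, ?_⟩
    · intro i u hu u' hu'
      have h1 := hCi i u hu
      have h2 := hCi i u' hu'
      have h3 : Ci i ≤ ∑ i, Ci i := Finset.single_le_sum (fun i _ => hC0 i) (Finset.mem_univ i)
      have := norm_sub_le (P.χ i u') (P.χ i u)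
      rw [Real.norm_eq_abs (_ - _)] at this
      linarith
    · intro u hu u' hu'
      have h3 := Finset.sum_nonneg fun i (_ : i ∈ Finset.univ) => hC0 i
      have := norm_sub_le u' u
      have := hC u hu
      have := hC u' hu'
      linarith
  obtain ⟨D, hD, hDχ, hDX⟩ := hbd
  have hcont : ContinuousOn p A := by
    intro q hq
    rw [ContinuousWithinAt, tendsto_iff_norm_sub_tendsto_zero]
    let G : Vec m × Vec n × Vec n → ℝ := fun q' =>
      (r ^ 2 * c.α₀)⁻¹ * (∑ i, |q'.1 i - q.1 i| * D + ‖q'.2.1 - q.2.1‖ * D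
        + η * (‖gω q.2.2 - gω q'.2.2‖ * D))
    -- Stability bounds the squared distance of minimizers by first-order differences of the data;
    -- compactness of `X` makes the other factors bounded.
    have hle : ∀ q' ∈ A, ‖p q' - p q‖ ^ 2 ≤ G q' := by
      intro q' hq'
      have h1 := IsProx.stability hω hP hq'.1 hq.1 hη (hp q') (hp q)
      have h2 : ∑ i, (q'.1 i - q.1 i) * (P.χ i (p q) - P.χ i (p q')) ≤ ∑ i, |q'.1 i - q.1 i| * D :=
        Finset.sum_le_sum fun i _ => (le_abs_self _).trans (by
          rw [abs_mul]; gcongr; exact hDχ i _ (hp q').1 _ (hp q).1)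
      have h3 : inner ℝ (q'.2.1 - q.2.1) (p q - p q') ≤ ‖q'.2.1 - q.2.1‖ * D :=
        (real_inner_le_norm _ _).trans (by gcongr; exact hDX _ (hp q').1 _ (hp q).1)
      have h4 : inner ℝ (gω q.2.2 - gω q'.2.2) (p q - p q') ≤ ‖gω q.2.2 - gω q'.2.2‖ * D :=
        (real_inner_le_norm _ _).trans (by gcongr; exact hDX _ (hp q').1 _ (hp q).1)
      have h5 := mul_le_mul_of_nonneg_left h4 hη
      have h6 : (r * ‖p q' - p q‖) ^ 2 ≤ N (p q' - p q) ^ 2 := by gcongr; exact hrN _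
      have h7 := mul_le_mul_of_nonneg_left h6 hα.le
      change _ ≤ (r ^ 2 * c.α₀)⁻¹ * _
      rw [le_inv_mul_iff₀ (by positivity)]
      nlinarith
    have hG : Filter.Tendsto G (nhdsWithin q A) (nhds 0) := by
      have hG0 : G q = 0 := by simp [G]
      rw [← hG0]
      have hg : ContinuousWithinAt (fun q' : Vec m × Vec n × Vec n => gω q'.2.2) A q :=
        (hω.grad_cont q.2.2 hq.2).comp (f := fun q' : Vec m × Vec n × Vec n => q'.2.2)
          (by fun_prop) fun q' hq' => hq'.2
      have hgoal : ContinuousWithinAt G A q := by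
        refine continuousWithinAt_const.mul ((ContinuousWithinAt.add ?_ ?_).add ?_)
        · exact (continuous_finsetSum _ fun i _ => by fun_prop).continuousWithinAt
        · fun_prop
        · exact continuousWithinAt_const.mul
            ((continuousWithinAt_const.sub hg).norm.mul continuousWithinAt_const)
      exact hgoal
    have hsq : Filter.Tendsto (fun q' => ‖p q' - p q‖ ^ 2) (nhdsWithin q A) (nhds 0) :=
      squeeze_zero' (Filter.Eventually.of_forall fun _ => by positivity)
        (by filter_upwards [self_mem_nhdsWithin] with q' hq' using hle q' hq') hG
    have := hsq.sqrt
    simpa using this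
  -- Continuity is known only for nonnegative weights and centers in `X`; off this set the map is
  -- constant.
  refine ⟨A.piecewise p (fun _ => 0), hcont.measurable_piecewise continuousOn_const hA, ?_⟩
  intro w v z u hw hz hu
  have hmem : (w, v, z) ∈ A := ⟨hw, hz⟩
  rw [Set.piecewise_eq_of_mem _ _ _ hmem]
  have h1 := IsProx.stability hω hP hw hw hη hu (hp (w, v, z))
  simp only [sub_self, zero_mul, Finset.sum_const_zero, inner_zero_left, mul_zero, add_zero] at h1
  have h2 : N (u - p (w, v, z)) ^ 2 = 0 :=
    le_antisymm (nonpos_of_mul_nonpos_right h1 hα) (by positivity)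
  exact sub_eq_zero.1 (hN _ (pow_eq_zero_iff two_ne_zero |>.1 h2))

end Prox

end ConEx

namespace ConEx

/-! ### Euclidean estimates and trajectories with their oracle errors -/

section Euclid

variable {n m : ℕ}

lemma inner_vec_eq_sum (u v : Vec m) : inner ℝ u v = ∑ i, u i * v i := by
  rw [PiLp.inner_apply]
  exact Finset.sum_congr rfl fun _ _ => by simp [mul_comm]

lemma norm_vec_eq_l2 (u : Vec m) : ‖u‖ = l2 (fun i => u i) := by
  rw [EuclideanSpace.norm_eq, l2]
  simp

lemma l2_nonneg (a : Fin m → ℝ) : 0 ≤ l2 a := Real.sqrt_nonneg _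

lemma l2_sq (a : Fin m → ℝ) : l2 a ^ 2 = ∑ i, a i ^ 2 :=
  Real.sq_sqrt (Finset.sum_nonneg fun _ _ => sq_nonneg _)

lemma norm_vec_sq (u : Vec m) : ‖u‖ ^ 2 = ∑ i, u i ^ 2 := by
  rw [norm_vec_eq_l2, l2_sq]

lemma sum_mul_le_norm_mul_l2 (u : Vec m) (a : Fin m → ℝ) : ∑ i, u i * a i ≤ ‖u‖ * l2 a := by
  rw [norm_vec_eq_l2]
  exact Real.sum_mul_le_sqrt_mul_sqrt _ _ _

lemma norm_le_of_abs_le {u : Vec m} {a : Fin m → ℝ} (h : ∀ i, |u i| ≤ a i) : ‖u‖ ≤ l2 a := by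
  rw [norm_vec_eq_l2]
  refine Real.sqrt_le_sqrt (Finset.sum_le_sum fun i _ => ?_)
  rw [← sq_abs]
  have := h i
  gcongr

lemma l2_mul_const (a : Fin m → ℝ) {r : ℝ} (hr : 0 ≤ r) : l2 (fun i => a i * r) = l2 a * r := by
  unfold l2
  simp only [mul_pow]
  rw [← Finset.sum_mul, Real.sqrt_mul (Finset.sum_nonneg fun i _ => sq_nonneg _),
    Real.sqrt_sq hr]

end Euclid

/-- A trajectory of the method together with the errors of the oracle answers along it: `δ₀`, `δ`
are the errors of `G₀(x_t, ξ_t)`, `Gᵢ(x_t, ξ_t)`, and `φ`, `δb` those of `F(x_t, ξ̄_t)`,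
`Gᵢ(x_t, ξ̄_t)`. -/
structure Path (n m : ℕ) where
  x : ℕ → Vec n
  y : ℕ → Vec m
  δ₀ : ℕ → Vec n
  δ : ℕ → Fin m → Vec n
  φ : ℕ → Vec m
  δb : ℕ → Fin m → Vec n

namespace Path

variable {n m : ℕ} (p : Path n m)

/-- The error of the stochastic linearization `ℓ_F(x_{t+1})`. -/
noncomputable def err (t : ℕ) : Vec m :=
  p.φ t + WithLp.toLp 2 fun i => (inner ℝ (p.δb t i) (p.x (t + 1) - p.x t) : ℝ)

/-- The part of `err` that has mean zero given the past. -/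
noncomputable def mdErr (t : ℕ) : Vec m := if t = 0 then p.φ 0 else p.err t

/-- The sum of the squared dual norms of the constraint gradient errors at `ξ_t`. -/
noncomputable def gradErr (N : Seminorm ℝ (Vec n)) (t : ℕ) : ℝ := ∑ i, dualNorm N (p.δ t i) ^ 2

/-- The sum of the squared dual norms of the constraint gradient errors at `ξ̄_t`. -/
noncomputable def gradErrBar (N : Seminorm ℝ (Vec n)) (t : ℕ) : ℝ := ∑ i, dualNorm N (p.δb t i) ^ 2

/-- An upper bound of `‖err t‖²`. -/
noncomputable def noise (N : Seminorm ℝ (Vec n)) (D : ℝ) (t : ℕ) : ℝ :=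
  2 * ‖p.φ t‖ ^ 2 + 2 * D ^ 2 * p.gradErrBar N t

/-- An upper bound of the squared gradient error in the primal step. -/
noncomputable def primalErr (N : Seminorm ℝ (Vec n)) (Y : ℝ) (t : ℕ) : ℝ :=
  3 * (dualNorm N (p.δ₀ t) ^ 2 + ‖p.y (t + 1)‖ ^ 2 * p.gradErr N t
    + if t = 0 then (Y + 1) ^ 2 * p.gradErrBar N 0 else 0)

/-- The martingale difference of the method at iteration `t`, with reference point `xs`. -/
noncomputable def mart (xs : Vec n) (t : ℕ) : ℝ :=
  inner ℝ (p.δ₀ t) (p.x t - xs) + ∑ i, p.y (t + 1) i * inner ℝ (p.δ t i) (p.x t - xs)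
    - if t = 0 then 0 else inner ℝ (p.y (t + 1)) (p.err t)

/-- `χ(x_t) + ℓ_F(x_t)` along the trajectory. -/
noncomputable def est (P : Problem n m) (df : Fin m → Vec n → Vec n) : ℕ → Vec m
  | 0 => WithLp.toLp 2 (fun i => P.χ i (p.x 0) + P.f i (p.x 0)) + p.φ 0
  | t + 1 => WithLp.toLp 2 (fun i => P.χ i (p.x (t + 1)) + P.f i (p.x t)
      + inner ℝ (df i (p.x t)) (p.x (t + 1) - p.x t)) + p.err t

end Path

/-- `p` follows the constraint extrapolation method, with `τ_t = K / (t + 1)`. -/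
structure IsConExPath {n m : ℕ} (P : Problem n m) (ω : Vec n → ℝ) (gω : Vec n → Vec n)
    (α a K : ℝ) (df₀ : Vec n → Vec n) (df : Fin m → Vec n → Vec n) (T : ℕ) (p : Path n m) :
    Prop where
  x_mem : ∀ t ≤ T, p.x t ∈ P.X
  y_init : p.y 0 = 0
  y_step : ∀ t < T, ∀ i, p.y (t + 1) i = max (p.y t i + (t + 1) / K *
    (p.est P df t i + (t + a + 1) / (t + a + 2) * (p.est P df t i - p.est P df (t - 1) i))) 0
  x_step : ∀ t < T, IsProx P ω gω (p.y (t + 1))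
    (df₀ (p.x t) + p.δ₀ t + ∑ i, p.y (t + 1) i • (df i (p.x t) + p.δ t i)) (p.x t)
    (α * (t + a + 1) / 2) (p.x (t + 1))

/-! ### One primal step and one dual step -/

section Steps

variable {n m : ℕ} {N : Seminorm ℝ (Vec n)} {P : Problem n m} {ω : Vec n → ℝ}
  {gω : Vec n → Vec n} {c : Constants m} {df₀ : Vec n → Vec n} {df : Fin m → Vec n → Vec n}
  {B K : ℝ} {T : ℕ} {p : Path n m}

lemma IsConExPath.y_nonneg {α a : ℝ} (h : IsConExPath P ω gω α a K df₀ df T p) {t : ℕ}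
    (ht : t ≤ T) (i : Fin m) : 0 ≤ p.y t i := by
  cases t with
  | zero => simp [h.y_init]
  | succ t => rw [h.y_step t ht i]; exact le_max_right _ _

lemma Constants.two_le_t₀ (hP : IsConvexSetting P N ω c) (hB : 1 ≤ B) : 2 ≤ c.t₀ B := by
  have h1 := hP.α₀_pos
  have h2 := hP.L₀_nonneg
  have h3 := l2_nonneg c.L
  unfold Constants.t₀
  have : 0 ≤ 4 * (c.L₀ + B * l2 c.L) / c.α₀ := by positivity
  linarith

/-- The upper models of `f₀` and `f_i` at `x_{t+1}` (weights `v`) and the subgradient inequalities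
at `xs` (weights `y_{t+1}`) are added to the three-point inequality. The mismatch `v - y_{t+1}`
multiplies the exact linearization, which is the stochastic estimate minus its error. -/
lemma IsConExPath.primal_step (hN : ∀ v, N v = 0 → v = 0) (hω : IsProxGenerator N P.X ω gω)
    (hP : IsConvexSetting P N ω c) (hB : 1 ≤ B)
    (hdf₀ : ∀ x ∈ P.X, df₀ x ∈ subdiff P.X P.f₀ x)
    (hdf : ∀ i, ∀ x ∈ P.X, df i x ∈ subdiff P.X (P.f i) x)
    (h : IsConExPath P ω gω c.α₀ (c.t₀ B) K df₀ df T p) {t : ℕ} (ht : t < T)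
    {xs : Vec n} (hxs : xs ∈ P.X) {Y : ℝ} {v : Vec m} (hv : ∀ i, 0 ≤ v i) (hvY : ‖v‖ ≤ Y + 1) :
    P.ψ₀ (p.x (t + 1)) + ∑ i, v i * P.ψ i (p.x (t + 1)) - P.ψ₀ xs
        - ∑ i, p.y (t + 1) i * P.ψ i xs
        + c.α₀ * (t + c.t₀ B + 3) / 2 * breg ω gω xs (p.x (t + 1))
      ≤ c.α₀ * (t + c.t₀ B + 1) / 2 * breg ω gω xs (p.x t)
        - c.α₀ * (2 * t + c.t₀ B + 4) / 8 * N (p.x (t + 1) - p.x t) ^ 2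
        + (c.Hstar B (diamX P.X ω gω) Y + (dualNorm N (p.δ₀ t)
            + ‖p.y (t + 1)‖ * l2 (fun i => dualNorm N (p.δ t i)))) * N (p.x (t + 1) - p.x t)
        - (inner ℝ (p.δ₀ t) (p.x t - xs) + ∑ i, p.y (t + 1) i * inner ℝ (p.δ t i) (p.x t - xs))
        + inner ℝ (v - p.y (t + 1)) (p.est P df (t + 1) - p.err t) := by
  have hx := h.x_mem t ht.le
  have hx' := h.x_mem (t + 1) ht
  have hy := fun i => h.y_nonneg (t := t + 1) ht i
  have h3 := (h.x_step t ht).three_point hω hP hy hxs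
  set x := p.x t
  set x' := p.x (t + 1)
  set y' := p.y (t + 1)
  set D := diamX P.X ω gω
  have hα := hP.α₀_pos
  have ha := Constants.two_le_t₀ hP hB
  set a := c.t₀ B with ha_def
  -- The definition of `t₀` solved for the curvature: it says that `η_t` dominates the smoothness
  -- for multipliers of norm up to `B`.
  have hLa : c.L₀ + B * l2 c.L = c.α₀ * (a - 2) / 4 := by
    rw [ha_def, Constants.t₀]; field_simp; ring
  have hf1 := hP.f₀_smooth x' hx' x hx _ (hdf₀ x hx)
  have hf2 := subdiff_subgradient hP.f₀_cont (hdf₀ x hx) hxs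
  have hn0 : 0 ≤ N (x' - x) := apply_nonneg _ _
  set ν := N (x' - x) with hν
  have hνD : ν ≤ D := hω.seminorm_le_diamX hP.X_compact hx' hx
  have hg1 : ∑ i, v i * P.f i x' ≤ ∑ i, v i * (P.f i x + inner ℝ (df i x) (x' - x))
      + (‖v‖ * l2 c.L) / 2 * ν ^ 2 + ‖v‖ * l2 c.H * ν := by
    have e1 : ∑ i, v i * P.f i x' ≤ ∑ i, (v i * (P.f i x + inner ℝ (df i x) (x' - x))
        + v i * c.L i * (ν ^ 2 / 2) + v i * c.H i * ν) := by
      refine Finset.sum_le_sum fun i _ => ?_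
      have := mul_le_mul_of_nonneg_left (hP.f_smooth i x' hx' x hx _ (hdf i x hx)) (hv i)
      linarith
    rw [Finset.sum_add_distrib, Finset.sum_add_distrib, ← Finset.sum_mul, ← Finset.sum_mul] at e1
    have e2 := mul_le_mul_of_nonneg_right (sum_mul_le_norm_mul_l2 v c.L)
      (by positivity : 0 ≤ ν ^ 2 / 2)
    have e3 := mul_le_mul_of_nonneg_right (sum_mul_le_norm_mul_l2 v c.H) hn0
    linarith
  have hg2 : ∑ i, y' i * (P.f i x + inner ℝ (df i x) (xs - x)) ≤ ∑ i, y' i * P.f i xs :=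
    Finset.sum_le_sum fun i _ =>
      mul_le_mul_of_nonneg_left (subdiff_subgradient (hP.f_cont i) (hdf i x hx) hxs) (hy i)
  have hd0 := abs_le.1 (abs_inner_le_dualNorm_mul hN (p.δ₀ t) (x' - x))
  have hd1 : -(‖y'‖ * l2 (fun i => dualNorm N (p.δ t i)) * ν)
      ≤ ∑ i, y' i * inner ℝ (p.δ t i) (x' - x) := by
    have e1 : ∑ i, y' i * (-inner ℝ (p.δ t i) (x' - x))
        ≤ (∑ i, y' i * dualNorm N (p.δ t i)) * ν := by
      rw [Finset.sum_mul]
      refine Finset.sum_le_sum fun i _ => ?_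
      rw [mul_assoc]
      refine mul_le_mul_of_nonneg_left ?_ (hy i)
      linarith [(abs_le.1 (abs_inner_le_dualNorm_mul hN (p.δ t i) (x' - x))).1]
    have e2 := mul_le_mul_of_nonneg_right
      (sum_mul_le_norm_mul_l2 y' (fun i => dualNorm N (p.δ t i))) hn0
    simp only [mul_neg, Finset.sum_neg_distrib] at e1
    linarith
  have hW := hω.sq_le_breg hx' hx
  -- The part of `‖v‖` above `B` is not covered by `t₀`; through `ν ≤ D` its quadratic term becomes
  -- linear and enters `Hstar`.
  have hHs : ‖v‖ * l2 c.L / 2 * ν ^ 2 + ‖v‖ * l2 c.H * ν + c.H₀ * ν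
      ≤ B * l2 c.L / 2 * ν ^ 2 + c.Hstar B D Y * ν := by
    have e0 : ‖v‖ ≤ B + max (Y + 1 - B) 0 := by
      have := le_max_left (Y + 1 - B) 0; linarith
    have hm0 := le_max_right (Y + 1 - B) 0
    have hL := l2_nonneg c.L
    have hH := l2_nonneg c.H
    have e1 : ‖v‖ * (l2 c.L / 2 * ν ^ 2) ≤ (B + max (Y + 1 - B) 0) * (l2 c.L / 2 * ν ^ 2) := by
      gcongr
    have e2 : max (Y + 1 - B) 0 * l2 c.L / 2 * (ν * ν) ≤ max (Y + 1 - B) 0 * l2 c.L / 2 * (D * ν) := by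
      gcongr
    have e3 : ‖v‖ * (l2 c.H * ν) ≤ (Y + 1) * (l2 c.H * ν) := by gcongr
    unfold Constants.Hstar
    nlinarith
  have hηW : c.α₀ * (t + a + 1) / 2 * (1 / 2 * ν ^ 2) ≤ c.α₀ * (t + a + 1) / 2 * breg ω gω x' x := by
    gcongr
  have hest : inner ℝ (v - y') (p.est P df (t + 1) - p.err t)
      = ∑ i, (v i - y' i) * (P.χ i x' + P.f i x + inner ℝ (df i x) (x' - x)) := by
    rw [inner_vec_eq_sum]
    refine Finset.sum_congr rfl fun i _ => ?_
    simp [Path.est, x, x']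
  rw [hest]
  unfold Problem.ψ₀ Problem.ψ
  simp only [inner_add_left, sum_inner, inner_smul_left, inner_sub_right, mul_add, mul_sub,
    sub_mul, add_mul, Finset.sum_add_distrib, Finset.sum_sub_distrib, RCLike.conj_to_real]
    at h3 hf1 hf2 hg1 hg2 hd0 hd1 ⊢
  have hLa' := congrArg (fun r => r * ν ^ 2 / 2) hLa
  beta_reduce at hLa'
  nlinarith

/-- The multiplier update is the projection onto the nonnegative orthant, which splits into
coordinates. -/
lemma IsConExPath.dual_step {α a : ℝ} (h : IsConExPath P ω gω α a K df₀ df T p) (hK : 0 < K)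
    {t : ℕ} (ht : t < T) {v : Vec m} (hv : ∀ i, 0 ≤ v i) :
    inner ℝ (p.est P df t + ((t + a + 1) / (t + a + 2) : ℝ) • (p.est P df t - p.est P df (t - 1)))
        (v - p.y (t + 1))
      ≤ K / (t + 1) / 2 * (‖v - p.y t‖ ^ 2 - ‖v - p.y (t + 1)‖ ^ 2 - ‖p.y (t + 1) - p.y t‖ ^ 2) := by
  rw [inner_vec_eq_sum, norm_vec_sq, norm_vec_sq, norm_vec_sq, ← Finset.sum_sub_distrib,
    ← Finset.sum_sub_distrib, Finset.mul_sum]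
  refine Finset.sum_le_sum fun i _ => ?_
  have hs := h.y_step t ht i
  simp only [PiLp.sub_apply, PiLp.add_apply, PiLp.smul_apply, smul_eq_mul]
  set s := p.est P df t i + (t + a + 1) / (t + a + 2) * (p.est P df t i - p.est P df (t - 1) i)
  have ht1 : (0 : ℝ) < t + 1 := by positivity
  have hv' := hv i
  have hτ : 0 < K / ((t : ℝ) + 1) := by positivity
  have hinv : ((t : ℝ) + 1) / K * s = s / (K / (t + 1)) := by field_simp
  rw [hinv] at hs
  set τ := K / ((t : ℝ) + 1)
  set u := p.y (t + 1) i
  set b := p.y t i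
  -- Variational inequality of the projection: either the coordinate is clipped, so `u = 0 ≤ v i`,
  -- or the first factor vanishes.
  have hgoal : (s - τ * (u - b)) * (v i - u) ≤ 0 := by
    rcases le_total (b + s / τ) 0 with h0 | h0
    · rw [max_eq_right h0] at hs
      have : s + τ * b ≤ 0 := by
        have := mul_le_mul_of_nonneg_left h0 hτ.le
        rw [mul_add, mul_div_cancel₀ _ hτ.ne'] at this
        linarith
      rw [hs]
      nlinarith
    · rw [max_eq_left h0] at hs
      have : s - τ * (u - b) = 0 := by rw [hs]; field_simp; ring
      rw [this, zero_mul]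
  nlinarith

end Steps

end ConEx

/-! ### Budget of squared steps and variation of the constraint estimate -/

namespace ConEx

/-- Each `s j` is charged twice on the left, at `t = j` and `t = j + 1`, and the coefficient `3 t +
8` on the right covers both. The two terms outside the sum are the unspent budget, kept so that the
induction closes. -/
lemma step_budget {α a : ℝ} (hα : 0 ≤ α) (ha : 0 ≤ a) {s : ℕ → ℝ} (hs : ∀ t, 0 ≤ s t)
    (hs0 : s 0 = 0) (k : ℕ) :
    ∑ t ∈ Finset.range (k + 1), α * (t + a + 1) * (t + 1) / 16 * (s t + s (t - 1))
        + α * (k + a + 2) * (3 * k + 8) / 16 * s (k + 1) + α * (k + a + 1) * (k + 2) / 8 * s k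
      ≤ ∑ t ∈ Finset.range (k + 1), α * (t + a + 2) * (3 * t + 8) / 16 * s (t + 1) := by
  induction k with
  | zero => simp [hs0]
  | succ k ih =>
    rw [Finset.sum_range_succ _ (k + 1), Finset.sum_range_succ _ (k + 1)]
    simp only [Nat.add_sub_cancel]
    push_cast
    have h1 : 0 ≤ α * (k * a + 2 * a + (k : ℝ) ^ 2 + 2 * k) / 16 * s k := by
      have := hs k; positivity
    linarith

/-- The form used at the end: the unspent budget also covers the terminal extrapolation term. -/
lemma step_budget' {α a : ℝ} (hα : 0 ≤ α) (ha : 0 ≤ a) {s : ℕ → ℝ} (hs : ∀ t, 0 ≤ s t)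
    (hs0 : s 0 = 0) {k : ℕ} (hk : 1 ≤ k) :
    ∑ t ∈ Finset.range k, α * (t + a + 1) * (t + 1) / 16 * (s t + s (t - 1))
        + α * (k + a + 1) * k / 8 * (s k + s (k - 1))
      ≤ ∑ t ∈ Finset.range k, α * (t + a + 2) * (3 * t + 8) / 16 * s (t + 1) := by
  obtain ⟨j, rfl⟩ := Nat.exists_eq_add_of_le' hk
  have h := step_budget hα ha hs hs0 j
  simp only [Nat.add_sub_cancel]
  push_cast
  have h1 : 0 ≤ α * ((j + a + 2) * (j + 6)) / 16 * s (j + 1) := by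
    have := hs (j + 1); positivity
  have h2 : 0 ≤ α * a / 8 * s j := by
    have := hs j; positivity
  linarith

section Combine

variable {n m : ℕ} {N : Seminorm ℝ (Vec n)} {P : Problem n m} {ω : Vec n → ℝ}
  {gω : Vec n → Vec n} {c : Constants m} {df₀ : Vec n → Vec n} {df : Fin m → Vec n → Vec n}
  {B K : ℝ} {T : ℕ} {p : Path n m}

/-- The squared length of the step leading to `x_t`, with value `0` at the start. -/
def Path.stepSq (p : Path n m) (N : Seminorm ℝ (Vec n)) : ℕ → ℝ
  | 0 => 0
  | t + 1 => N (p.x (t + 1) - p.x t) ^ 2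

lemma Path.stepSq_nonneg (p : Path n m) (t : ℕ) : 0 ≤ p.stepSq N t := by
  cases t with
  | zero => exact le_rfl
  | succ t => exact sq_nonneg _

lemma Path.gradErr_nonneg (p : Path n m) (t : ℕ) : 0 ≤ p.gradErr N t :=
  Finset.sum_nonneg fun _ _ => sq_nonneg _

lemma Path.gradErrBar_nonneg (p : Path n m) (t : ℕ) : 0 ≤ p.gradErrBar N t :=
  Finset.sum_nonneg fun _ _ => sq_nonneg _

lemma Path.noise_nonneg (p : Path n m) (D : ℝ) (t : ℕ) : 0 ≤ p.noise N D t := by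
  have := p.gradErrBar_nonneg (N := N) t
  unfold Path.noise
  positivity

lemma Path.norm_gradTerm_le (hN : ∀ v, N v = 0 → v = 0) (p : Path n m) (t : ℕ) :
    ‖(WithLp.toLp 2 fun i => (inner ℝ (p.δb t i) (p.x (t + 1) - p.x t) : ℝ) : Vec m)‖
      ≤ Real.sqrt (p.gradErrBar N t) * N (p.x (t + 1) - p.x t) := by
  refine (norm_le_of_abs_le (a := fun i => dualNorm N (p.δb t i) * N (p.x (t + 1) - p.x t))
    fun i => abs_inner_le_dualNorm_mul hN _ _).trans ?_
  rw [l2_mul_const _ (apply_nonneg _ _)]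
  rfl

lemma norm_add_sq_le {E : Type*} [SeminormedAddCommGroup E] (u v : E) :
    ‖u + v‖ ^ 2 ≤ 2 * ‖u‖ ^ 2 + 2 * ‖v‖ ^ 2 := by
  have h := norm_add_le u v
  have : ‖u + v‖ ^ 2 ≤ (‖u‖ + ‖v‖) ^ 2 := by gcongr
  nlinarith [sq_nonneg (‖u‖ - ‖v‖)]

lemma Path.norm_gradTerm_sq_le (hN : ∀ v, N v = 0 → v = 0) (p : Path n m) (t : ℕ) {D : ℝ}
    (hD : N (p.x (t + 1) - p.x t) ≤ D) :
    ‖(WithLp.toLp 2 fun i => (inner ℝ (p.δb t i) (p.x (t + 1) - p.x t) : ℝ) : Vec m)‖ ^ 2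
      ≤ D ^ 2 * p.gradErrBar N t := by
  have h0 : 0 ≤ N (p.x (t + 1) - p.x t) := apply_nonneg _ _
  calc _ ≤ (Real.sqrt (p.gradErrBar N t) * D) ^ 2 := by
        gcongr
        exact (p.norm_gradTerm_le hN t).trans (by gcongr)
    _ = _ := by rw [mul_pow, Real.sq_sqrt (p.gradErrBar_nonneg t), mul_comm]

lemma Path.norm_err_sq_le (hN : ∀ v, N v = 0 → v = 0) (p : Path n m) (t : ℕ) {D : ℝ}
    (hD : N (p.x (t + 1) - p.x t) ≤ D) : ‖p.err t‖ ^ 2 ≤ p.noise N D t := by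
  have h1 := p.norm_gradTerm_sq_le hN t hD
  have h2 := norm_add_sq_le (p.φ t)
    (WithLp.toLp 2 fun i => (inner ℝ (p.δb t i) (p.x (t + 1) - p.x t) : ℝ))
  unfold Path.err Path.noise
  linarith

lemma Path.norm_mdErr_sq_le (hN : ∀ v, N v = 0 → v = 0) (p : Path n m) (t : ℕ) {D : ℝ}
    (hD : N (p.x (t + 1) - p.x t) ≤ D) : ‖p.mdErr t‖ ^ 2 ≤ p.noise N D t := by
  unfold Path.mdErr
  split_ifs with h
  · subst h
    have := p.gradErrBar_nonneg (N := N) 0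
    unfold Path.noise
    have h1 : 0 ≤ 2 * D ^ 2 * p.gradErrBar N 0 := by positivity
    nlinarith [sq_nonneg ‖p.φ 0‖]
  · exact p.norm_err_sq_le hN t hD

/-- Two consecutive linearizations have different base points. The newest step contributes the
increment of `χ` and a slope of `f`, hence `M_χ + M_f`; the preceding step contributes the
linearization error of `f`, hence `2 M_f`. Their maximum is `bigM`. -/
lemma Path.norm_est_sub_sq_le (hN : ∀ v, N v = 0 → v = 0) (hω : IsProxGenerator N P.X ω gω)
    (hP : IsConvexSetting P N ω c)
    (hdf : ∀ i, ∀ x ∈ P.X, df i x ∈ subdiff P.X (P.f i) x)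
    (hx : ∀ t ≤ T, p.x t ∈ P.X) {t : ℕ} (ht1 : 1 ≤ t) (ht : t ≤ T) :
    ‖p.est P df t - p.est P df (t - 1)‖ ^ 2
      ≤ 4 * c.bigM ^ 2 * (p.stepSq N t + p.stepSq N (t - 1))
        + 4 * (p.noise N (diamX P.X ω gω) (t - 1) + p.noise N (diamX P.X ω gω) (t - 2)) := by
  set D := diamX P.X ω gω
  have hND : ∀ s, s + 1 ≤ T → N (p.x (s + 1) - p.x s) ≤ D := fun s hs =>
    hω.seminorm_le_diamX hP.X_compact (hx _ hs) (hx _ (by omega))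
  have hχ : ∀ s, s + 1 ≤ T →
      ‖(WithLp.toLp 2 fun i => P.χ i (p.x (s + 1)) - P.χ i (p.x s) : Vec m)‖
        ≤ l2 c.Mχ * N (p.x (s + 1) - p.x s) := fun s hs => by
    rw [← l2_mul_const _ (apply_nonneg _ _)]
    refine norm_le_of_abs_le fun i => abs_le.2 ⟨?_, hP.χ_lip i _ (hx _ hs) _ (hx _ (by omega))⟩
    have := hP.χ_lip i _ (hx s (by omega)) _ (hx _ hs)
    rw [map_sub_rev] at this
    change -_ ≤ P.χ i (p.x (s + 1)) - P.χ i (p.x s)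
    linarith
  have hinner : ∀ s, s + 1 ≤ T → ∀ i, |inner ℝ (df i (p.x s)) (p.x (s + 1) - p.x s)|
      ≤ c.Mf i * N (p.x (s + 1) - p.x s) := fun s hs i =>
    abs_inner_subdiff_le (hP.f_lip i) (hdf i _ (hx s (by omega)))
      (vsub_mem_vectorSpan ℝ (hx _ hs) (hx _ (by omega)))
  have hg : ∀ s, s + 1 ≤ T →
      ‖(WithLp.toLp 2 fun i => (inner ℝ (df i (p.x s)) (p.x (s + 1) - p.x s) : ℝ) : Vec m)‖
        ≤ l2 c.Mf * N (p.x (s + 1) - p.x s) := fun s hs => by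
    rw [← l2_mul_const _ (apply_nonneg _ _)]
    exact norm_le_of_abs_le (hinner s hs)
  have hf : ∀ s, s + 1 ≤ T →
      ‖(WithLp.toLp 2 fun i => P.f i (p.x (s + 1)) - P.f i (p.x s)
        - inner ℝ (df i (p.x s)) (p.x (s + 1) - p.x s) : Vec m)‖
        ≤ l2 c.Mf * (2 * N (p.x (s + 1) - p.x s)) := fun s hs => by
    rw [← l2_mul_const _ (by positivity)]
    refine norm_le_of_abs_le fun i => ?_
    have h1 := hP.f_lip i _ (hx _ hs) _ (hx s (by omega))
    have h2 := hP.f_lip i _ (hx s (by omega)) _ (hx _ hs)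
    rw [map_sub_rev] at h2
    have h3 := abs_le.1 (hinner s hs i)
    change |P.f i (p.x (s + 1)) - P.f i (p.x s)
        - inner ℝ (df i (p.x s)) (p.x (s + 1) - p.x s)| ≤ _
    exact abs_le.2 ⟨by linarith, by linarith⟩
  have hM1 : 2 * l2 c.Mf ≤ c.bigM := le_max_left _ _
  have hM2 : l2 c.Mχ + l2 c.Mf ≤ c.bigM := le_max_right _ _
  have hM0 : 0 ≤ c.bigM := le_trans (by have := l2_nonneg c.Mf; positivity) hM1
  obtain ⟨s, rfl⟩ := Nat.exists_eq_add_of_le' ht1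
  have hNs : 0 ≤ N (p.x (s + 1) - p.x s) := apply_nonneg _ _
  rw [Nat.add_sub_cancel]
  cases s with
  | zero =>
    -- Both estimates use the same `F(x_0, ξ̄_0)`, so `φ 0` cancels and only the gradient error
    -- remains.
    have heq : p.est P df 1 - p.est P df 0
        = (WithLp.toLp 2 fun i => P.χ i (p.x 1) - P.χ i (p.x 0))
          + (WithLp.toLp 2 fun i => (inner ℝ (df i (p.x 0)) (p.x 1 - p.x 0) : ℝ))
          + (WithLp.toLp 2 fun i => (inner ℝ (p.δb 0 i) (p.x 1 - p.x 0) : ℝ)) := by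
      ext i
      simp [Path.est, Path.err]
      ring
    have h1 := norm_add_le (WithLp.toLp 2 fun i => P.χ i (p.x 1) - P.χ i (p.x 0) : Vec m)
      (WithLp.toLp 2 fun i => (inner ℝ (df i (p.x 0)) (p.x 1 - p.x 0) : ℝ))
    have h2 := hχ 0 ht
    have h3 := hg 0 ht
    simp only [zero_add] at h2 h3 hNs
    have h4 : (l2 c.Mχ + l2 c.Mf) * N (p.x 1 - p.x 0) ≤ c.bigM * N (p.x 1 - p.x 0) := by gcongr
    have h5 := (pow_le_pow_left₀ (norm_nonneg _)
      (h1.trans (by linarith : _ ≤ c.bigM * N (p.x 1 - p.x 0))) 2)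
    have h6 := p.norm_gradTerm_sq_le hN 0 (hND 0 ht)
    simp only [zero_add] at h6
    have h7 : D ^ 2 * p.gradErrBar N 0 ≤ p.noise N D 0 := by
      unfold Path.noise
      have := p.gradErrBar_nonneg (N := N) 0
      have : 0 ≤ D ^ 2 * p.gradErrBar N 0 := by positivity
      nlinarith [sq_nonneg ‖p.φ 0‖]
    have h8 := p.noise_nonneg (N := N) D 0
    have h9 : 0 ≤ (c.bigM * N (p.x 1 - p.x 0)) ^ 2 := by positivity
    rw [zero_add, heq]
    refine (norm_add_sq_le _ _).trans ?_
    have e1 : p.stepSq N 1 = N (p.x 1 - p.x 0) ^ 2 := rfl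
    have e0 : p.stepSq N 0 = 0 := rfl
    rw [e1, e0]
    norm_num
    nlinarith
  | succ s =>
    -- The value difference of `f` over the older step is grouped with the linear term subtracted
    -- there.
    have heq : p.est P df (s + 1 + 1) - p.est P df (s + 1)
        = ((WithLp.toLp 2 fun i => P.χ i (p.x (s + 1 + 1)) - P.χ i (p.x (s + 1)))
          + (WithLp.toLp 2 fun i =>
            (inner ℝ (df i (p.x (s + 1))) (p.x (s + 1 + 1) - p.x (s + 1)) : ℝ))
          + (WithLp.toLp 2 fun i => P.f i (p.x (s + 1)) - P.f i (p.x s)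
            - inner ℝ (df i (p.x s)) (p.x (s + 1) - p.x s)))
          + (p.err (s + 1) + -p.err s) := by
      ext i
      simp [Path.est]
      ring
    have h1 := norm_add₃_le
      (a := (WithLp.toLp 2 fun i => P.χ i (p.x (s + 1 + 1)) - P.χ i (p.x (s + 1)) : Vec m))
      (b := (WithLp.toLp 2 fun i =>
            (inner ℝ (df i (p.x (s + 1))) (p.x (s + 1 + 1) - p.x (s + 1)) : ℝ)))
      (c := (WithLp.toLp 2 fun i => P.f i (p.x (s + 1)) - P.f i (p.x s)
            - inner ℝ (df i (p.x s)) (p.x (s + 1) - p.x s)))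
    have h2 := hχ (s + 1) ht
    have h3 := hg (s + 1) ht
    have h3' := hf s (by omega)
    have hNs' : 0 ≤ N (p.x (s + 1) - p.x s) := apply_nonneg _ _
    have h4 : (l2 c.Mχ + l2 c.Mf) * N (p.x (s + 1 + 1) - p.x (s + 1))
      ≤ c.bigM * N (p.x (s + 1 + 1) - p.x (s + 1)) := by gcongr
    have h4' : (2 * l2 c.Mf) * N (p.x (s + 1) - p.x s) ≤ c.bigM * N (p.x (s + 1) - p.x s) := by
      gcongr
    have h5 := (pow_le_pow_left₀ (norm_nonneg _)
      (h1.trans (by linarith :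
        _ ≤ c.bigM * (N (p.x (s + 1 + 1) - p.x (s + 1)) + N (p.x (s + 1) - p.x s)))) 2)
    have h6 := p.norm_err_sq_le hN (s + 1) (hND (s + 1) ht)
    have h7 := p.norm_err_sq_le hN s (hND s (by omega))
    have h8 := norm_add_sq_le (p.err (s + 1)) (-p.err s)
    rw [norm_neg] at h8
    rw [heq]
    refine (norm_add_sq_le _ _).trans ?_
    have e1 : p.stepSq N (s + 1 + 1) = N (p.x (s + 1 + 1) - p.x (s + 1)) ^ 2 := rfl
    have e0 : p.stepSq N (s + 1) = N (p.x (s + 1) - p.x s) ^ 2 := rfl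
    have e2 : s + 1 + 1 - 2 = s := by omega
    rw [e1, e0, e2]
    nlinarith [mul_nonneg (sq_nonneg c.bigM)
      (sq_nonneg (N (p.x (s + 1 + 1) - p.x (s + 1)) - N (p.x (s + 1) - p.x s)))]

end Combine

end ConEx

namespace ConEx

/-! ### The pathwise recursion and its summation -/

section Pathwise

variable {n m : ℕ} {N : Seminorm ℝ (Vec n)} {P : Problem n m} {ω : Vec n → ℝ}
  {gω : Vec n → Vec n} {c : Constants m} {df₀ : Vec n → Vec n} {df : Fin m → Vec n → Vec n}
  {B K : ℝ} {T : ℕ} {p : Path n m}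

/-- The primal-dual gap of `(x, y)` against `(xs, v)`. -/
noncomputable def Problem.gap (P : Problem n m) (x : Vec n) (y : Vec m) (xs : Vec n) (v : Vec m) :
    ℝ :=
  P.ψ₀ x + ∑ i, v i * P.ψ i x - P.ψ₀ xs - ∑ i, y i * P.ψ i xs

/-- The contribution of the oracle noise at `ξ̄` to the dual step `t`. -/
noncomputable def Path.dualErr (p : Path n m) (N : Seminorm ℝ (Vec n)) (D a K : ℝ) (t : ℕ) : ℝ :=
  if t = 0 then (a + 2) * p.noise N D 0 / (2 * K)
  else 2 * ((t + a + 1) * (t + 1) / K) * (p.noise N D (t - 1) + p.noise N D (t - 2))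

/-- The potential whose decrease drives the convergence of the method. -/
noncomputable def Path.potential (p : Path n m) (P : Problem n m) (ω : Vec n → ℝ)
    (gω : Vec n → Vec n) (df : Fin m → Vec n → Vec n) (α a K : ℝ) (xs : Vec n) (v : Vec m)
    (t : ℕ) : ℝ :=
  α * (t + a + 1) * (t + a + 2) / 2 * breg ω gω xs (p.x t)
    + K * (((t - 1 : ℕ) : ℝ) + a + 2) / (((t - 1 : ℕ) : ℝ) + 1) / 2 * ‖v - p.y t‖ ^ 2
    - (t + a + 1) * inner ℝ (p.est P df t - p.est P df (t - 1)) (v - p.y t)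

/-- The weights `γ_t τ_t` do not increase, so the squared dual distances telescope with the right
sign. Truncated subtraction makes `t = 0` an equality. -/
lemma dual_weight_antitone {a K : ℝ} (ha : 0 ≤ a) (hK : 0 < K) (t : ℕ) :
    K * ((t : ℝ) + a + 2) / (t + 1)
      ≤ K * (((t - 1 : ℕ) : ℝ) + a + 2) / (((t - 1 : ℕ) : ℝ) + 1) := by
  cases t with
  | zero => simp
  | succ t =>
    simp only [Nat.add_sub_cancel]
    push_cast
    rw [div_le_div_iff₀ (by positivity) (by positivity)]
    nlinarith

lemma young {A r d z : ℝ} (hz : 0 < z) : A * r * d - z / 2 * d ^ 2 ≤ A ^ 2 * r ^ 2 / (2 * z) := by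
  rw [le_div_iff₀ (by positivity)]
  nlinarith [sq_nonneg (A * r - z * d)]

/-- The sum of the primal and dual inequalities times `γ_t`, arranged as a change of `potential`.
The last line is the only part of the extrapolation that fails to telescope. -/
lemma IsConExPath.recursion_step (hN : ∀ v, N v = 0 → v = 0)
    (hω : IsProxGenerator N P.X ω gω) (hP : IsConvexSetting P N ω c) (hB : 1 ≤ B)
    (hdf₀ : ∀ x ∈ P.X, df₀ x ∈ subdiff P.X P.f₀ x)
    (hdf : ∀ i, ∀ x ∈ P.X, df i x ∈ subdiff P.X (P.f i) x)
    (h : IsConExPath P ω gω c.α₀ (c.t₀ B) K df₀ df T p) (hK : 0 < K) {t : ℕ} (ht : t < T)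
    {xs : Vec n} (hxs : xs ∈ P.X) {Y : ℝ} {v : Vec m} (hv : ∀ i, 0 ≤ v i) (hvY : ‖v‖ ≤ Y + 1) :
    (t + c.t₀ B + 2) * P.gap (p.x (t + 1)) (p.y (t + 1)) xs v
        + p.potential P ω gω df c.α₀ (c.t₀ B) K xs v (t + 1)
      ≤ p.potential P ω gω df c.α₀ (c.t₀ B) K xs v t
        - (t + c.t₀ B + 2) * (c.α₀ * (2 * t + c.t₀ B + 4) / 8) * N (p.x (t + 1) - p.x t) ^ 2
        + (t + c.t₀ B + 2) * ((c.Hstar B (diamX P.X ω gω) Y + (dualNorm N (p.δ₀ t)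
            + ‖p.y (t + 1)‖ * l2 (fun i => dualNorm N (p.δ t i)))) * N (p.x (t + 1) - p.x t))
        - (t + c.t₀ B + 2) * (inner ℝ (p.δ₀ t) (p.x t - xs)
            + ∑ i, p.y (t + 1) i * inner ℝ (p.δ t i) (p.x t - xs))
        + (t + c.t₀ B + 2) * inner ℝ (p.y (t + 1) - v) (p.err t)
        + ((t + c.t₀ B + 1) * ‖p.est P df t - p.est P df (t - 1)‖ * ‖p.y (t + 1) - p.y t‖
          - K * (t + c.t₀ B + 2) / (t + 1) / 2 * ‖p.y (t + 1) - p.y t‖ ^ 2) := by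
  have h1 := h.primal_step hN hω hP hB hdf₀ hdf ht hxs hv hvY
  have h2 := h.dual_step hK ht hv
  have ha := Constants.two_le_t₀ hP hB
  have h3 := dual_weight_antitone (a := c.t₀ B) (by linarith) hK t
  set a := c.t₀ B
  have hγ : (0 : ℝ) < t + a + 2 := by positivity
  have h1' := mul_le_mul_of_nonneg_left h1 hγ.le
  have h2' := mul_le_mul_of_nonneg_left h2 hγ.le
  have h3' := mul_le_mul_of_nonneg_right h3 (by positivity : 0 ≤ ‖v - p.y t‖ ^ 2 / 2)
  have h4 : -(‖p.est P df t - p.est P df (t - 1)‖ * ‖p.y (t + 1) - p.y t‖)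
      ≤ inner ℝ (p.est P df t - p.est P df (t - 1)) (p.y t - p.y (t + 1)) := by
    have := abs_real_inner_le_norm (p.est P df t - p.est P df (t - 1)) (p.y t - p.y (t + 1))
    rw [norm_sub_rev (p.y t)] at this
    exact (abs_le.1 this).1
  have h4' := mul_le_mul_of_nonneg_left h4 (by positivity : (0 : ℝ) ≤ t + a + 1)
  -- `γ_t θ_t = t + a + 1`, exactly the coefficient of the cross term in `potential` at `t`.
  have e1 : (t + a + 2) * (inner ℝ (p.est P df t + ((t + a + 1) / (t + a + 2) : ℝ) •
        (p.est P df t - p.est P df (t - 1))) (v - p.y (t + 1)))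
      = (t + a + 2) * inner ℝ (p.est P df t) (v - p.y (t + 1))
        + (t + a + 1) * inner ℝ (p.est P df t - p.est P df (t - 1)) (v - p.y (t + 1)) := by
    rw [inner_add_left, inner_smul_left, RCLike.conj_to_real]
    field_simp
  rw [e1] at h2'
  have e2 : inner ℝ (p.est P df t - p.est P df (t - 1)) (v - p.y (t + 1))
      = inner ℝ (p.est P df t - p.est P df (t - 1)) (v - p.y t)
        + inner ℝ (p.est P df t - p.est P df (t - 1)) (p.y t - p.y (t + 1)) := by
    rw [← inner_add_right, sub_add_sub_cancel]
  rw [e2] at h2'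
  -- The first term on the right is the cross term of the next potential; the second cancels against
  -- the dual inequality.
  have e3 : inner ℝ (v - p.y (t + 1)) (p.est P df (t + 1) - p.err t)
      = inner ℝ (p.est P df (t + 1) - p.est P df t) (v - p.y (t + 1))
        + inner ℝ (p.est P df t) (v - p.y (t + 1)) + inner ℝ (p.y (t + 1) - v) (p.err t) := by
    rw [← inner_add_left, sub_add_cancel, inner_sub_right, real_inner_comm, ← neg_sub v,
      inner_neg_left]
    ring
  rw [e3] at h1'
  have e4 : (t + a + 2) * (K / (t + 1) / 2 *
        (‖v - p.y t‖ ^ 2 - ‖v - p.y (t + 1)‖ ^ 2 - ‖p.y (t + 1) - p.y t‖ ^ 2))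
      = K * (t + a + 2) / (t + 1) / 2 *
        (‖v - p.y t‖ ^ 2 - ‖v - p.y (t + 1)‖ ^ 2 - ‖p.y (t + 1) - p.y t‖ ^ 2) := by
    ring
  rw [e4] at h2'
  unfold Path.potential Problem.gap
  simp only [Nat.add_sub_cancel]
  push_cast
  generalize inner ℝ (p.est P df t - p.est P df (t - 1)) (v - p.y t) = A1 at *
  generalize inner ℝ (p.est P df (t + 1) - p.est P df t) (v - p.y (t + 1)) = A2 at *
  generalize K * (t + a + 2) / (t + 1) = z at *
  generalize K * (((t - 1 : ℕ) : ℝ) + a + 2) / (((t - 1 : ℕ) : ℝ) + 1) = z' at *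
  linarith

/-- Nonsmoothness and gradient noise are traded for a share `α γ² / 16` of the squared step, the
share reserved in `primal_budget`. -/
lemma primal_young {α γ H E S ν : ℝ} (hα : 0 < α) (hE : E ^ 2 ≤ S) :
    γ * ((H + E) * ν) ≤ α * γ ^ 2 / 16 * ν ^ 2 + 8 / α * (H ^ 2 + S) := by
  have q2 : 0 ≤ (α * (γ * ν) - 8 * (H + E)) ^ 2 / (16 * α) := by positivity
  have q3 : (α * (γ * ν) - 8 * (H + E)) ^ 2 / (16 * α)
      = α * γ ^ 2 / 16 * ν ^ 2 + 4 / α * (H + E) ^ 2 - γ * ((H + E) * ν) := by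
    field_simp; ring
  have q4 : 4 / α * (H + E) ^ 2 ≤ 4 / α * (2 * H ^ 2 + 2 * S) := by
    gcongr
    nlinarith [sq_nonneg (H - E)]
  have q5 : 4 / α * (2 * H ^ 2 + 2 * S) = 8 / α * (H ^ 2 + S) := by ring
  linarith

/-- After the common factor `α γ_t / 16` is removed, the difference is exactly `a - 2`; this is what
the summand `2` in `t₀` is for. -/
lemma primal_budget {α a t ν : ℝ} (hα : 0 ≤ α) (ha : 2 ≤ a) (ht : 0 ≤ t) :
    α * (t + a + 2) ^ 2 / 16 * ν ^ 2 ≤ (t + a + 2) * (α * (2 * t + a + 4) / 8) * ν ^ 2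
        - α * (t + a + 2) * (3 * t + 8) / 16 * ν ^ 2 := by
  have h1 : 0 ≤ a - 2 := by linarith
  have : 0 ≤ α * (t + a + 2) * (a - 2) / 16 * ν ^ 2 := by positivity
  linarith

/-- At `t = 0` both `y_1` and `x_1` depend on `ξ̄_0`, so `err 0` is not a martingale difference. Its
pairing with `y_1` and the gradient part of its pairing with `v` are bounded pathwise, and only `φ
0` is kept linear. -/
lemma IsConExPath.one_step_init (hN : ∀ v, N v = 0 → v = 0)
    (hω : IsProxGenerator N P.X ω gω) (hP : IsConvexSetting P N ω c) (hB : 1 ≤ B)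
    (hdf₀ : ∀ x ∈ P.X, df₀ x ∈ subdiff P.X P.f₀ x)
    (hdf : ∀ i, ∀ x ∈ P.X, df i x ∈ subdiff P.X (P.f i) x)
    (h : IsConExPath P ω gω c.α₀ (c.t₀ B) K df₀ df T p) (hK : 0 < K)
 (hT : 0 < T)
    {xs : Vec n} (hxs : xs ∈ P.X) {Y : ℝ} (hY : 0 ≤ Y) {v : Vec m} (hv : ∀ i, 0 ≤ v i)
    (hvY : ‖v‖ ≤ Y + 1) :
    (c.t₀ B + 2) * P.gap (p.x 1) (p.y 1) xs v
        + p.potential P ω gω df c.α₀ (c.t₀ B) K xs v 1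
      ≤ p.potential P ω gω df c.α₀ (c.t₀ B) K xs v 0
        - c.α₀ * (c.t₀ B + 2) * 8 / 16 * p.stepSq N 1
        + 8 / c.α₀ * (c.Hstar B (diamX P.X ω gω) Y ^ 2 + p.primalErr N Y 0)
        - (c.t₀ B + 2) * p.mart xs 0
        - (c.t₀ B + 2) * inner ℝ v (p.mdErr 0)
        + p.dualErr N (diamX P.X ω gω) (c.t₀ B) K 0 := by
  have h1 := h.recursion_step hN hω hP hB hdf₀ hdf hK hT hxs hv hvY
  have ha := Constants.two_le_t₀ hP hB
  have hα := hP.α₀_pos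
  have hbud := primal_budget (ν := N (p.x 1 - p.x 0)) hα.le ha le_rfl
  have hND : N (p.x (0 + 1) - p.x 0) ≤ diamX P.X ω gω :=
    hω.seminorm_le_diamX hP.X_compact (h.x_mem _ hT) (h.x_mem _ hT.le)
  have herr := p.norm_err_sq_le hN 0 hND
  have q2 := p.norm_gradTerm_le hN 0
  have hν : 0 ≤ N (p.x 1 - p.x 0) := apply_nonneg _ _
  have e1 : p.stepSq N 1 = N (p.x 1 - p.x 0) ^ 2 := rfl
  have hG0 : 0 ≤ l2 (fun i => dualNorm N (p.δ 0 i)) := l2_nonneg _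
  have hG2 : l2 (fun i => dualNorm N (p.δ 0 i)) ^ 2 = p.gradErr N 0 := l2_sq _
  have hGb0 : 0 ≤ Real.sqrt (p.gradErrBar N 0) := Real.sqrt_nonneg _
  have hGb2 : Real.sqrt (p.gradErrBar N 0) ^ 2 = p.gradErrBar N 0 :=
    Real.sq_sqrt (p.gradErrBar_nonneg 0)
  simp only [zero_add, Nat.cast_zero, mul_zero, Nat.zero_sub, sub_self, norm_zero, zero_mul,
    h.y_init, sub_zero, div_one] at h1 hbud herr q2
  set Gb := Real.sqrt (p.gradErrBar N 0)
  set G := l2 (fun i => dualNorm N (p.δ 0 i))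
  set a := c.t₀ B
  set D := diamX P.X ω gω
  set H := c.Hstar B D Y
  set ν := N (p.x 1 - p.x 0)
  set d0 := dualNorm N (p.δ₀ 0)
  have ha2 : 0 < a + 2 := by linarith
  have hE := primal_young (γ := a + 2) (H := H) (ν := ν) (S := p.primalErr N Y 0)
    (E := d0 + ‖p.y 1‖ * G + (Y + 1) * Gb) hα (by
      unfold Path.primalErr
      rw [if_pos rfl, ← hG2, ← hGb2]
      nlinarith [sq_nonneg (d0 - ‖p.y 1‖ * G), sq_nonneg (d0 - (Y + 1) * Gb),
        sq_nonneg (‖p.y 1‖ * G - (Y + 1) * Gb)])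
  -- Since `y_0 = 0` and the initial extrapolation difference is zero, the whole quadratic term in
  -- `y_1` is available here.
  have hY0 := young (A := a + 2) (r := ‖p.err 0‖) (d := ‖p.y 1‖) (mul_pos hK ha2)
  have hyy : (a + 2) ^ 2 * ‖p.err 0‖ ^ 2 / (2 * (K * (a + 2)))
      ≤ (a + 2) * p.noise N D 0 / (2 * K) := by
    have : (a + 2) ^ 2 * ‖p.err 0‖ ^ 2 / (2 * (K * (a + 2)))
        = (a + 2) * ‖p.err 0‖ ^ 2 / (2 * K) := by
      field_simp
    rw [this]
    gcongr
  have hcs : inner ℝ (p.y 1) (p.err 0) ≤ ‖p.err 0‖ * ‖p.y 1‖ := by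
    rw [mul_comm]; exact real_inner_le_norm _ _
  have hcs' := mul_le_mul_of_nonneg_left hcs ha2.le
  -- The gradient part is proportional to the step length, so it joins the primal error; this is the
  -- extra summand of `primalErr` at `0`.
  have hgb : -inner ℝ v (p.err 0) ≤ -inner ℝ v (p.φ 0) + (Y + 1) * Gb * ν := by
    unfold Path.err
    rw [inner_add_right]
    have q1 := (abs_le.1 (abs_real_inner_le_norm v
      (WithLp.toLp 2 fun i => (inner ℝ (p.δb 0 i) (p.x 1 - p.x 0) : ℝ)))).1
    have q3 : ‖v‖ * ‖(WithLp.toLp 2 fun i =>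
        (inner ℝ (p.δb 0 i) (p.x 1 - p.x 0) : ℝ) : Vec m)‖ ≤ (Y + 1) * (Gb * ν) := by
      gcongr
    simp only [zero_add]
    linarith
  have hgb' := mul_le_mul_of_nonneg_left hgb ha2.le
  unfold Path.mart Path.mdErr Path.dualErr
  simp only [if_true, zero_add, sub_zero]
  rw [e1]
  rw [inner_sub_left] at h1
  linarith

/-- For `t ≥ 1` the leftover product is split by Young's inequality into squared steps, with a
coefficient that `step_budget` can pay, and noise. -/
lemma IsConExPath.one_step (hN : ∀ v, N v = 0 → v = 0)
    (hω : IsProxGenerator N P.X ω gω) (hP : IsConvexSetting P N ω c) (hB : 1 ≤ B)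
    (hdf₀ : ∀ x ∈ P.X, df₀ x ∈ subdiff P.X P.f₀ x)
    (hdf : ∀ i, ∀ x ∈ P.X, df i x ∈ subdiff P.X (P.f i) x)
    (h : IsConExPath P ω gω c.α₀ (c.t₀ B) K df₀ df T p) (hK : 0 < K)
    (hKM : 32 * c.bigM ^ 2 ≤ c.α₀ * K) {t : ℕ} (ht : t < T)
    {xs : Vec n} (hxs : xs ∈ P.X) {Y : ℝ} (hY : 0 ≤ Y) {v : Vec m} (hv : ∀ i, 0 ≤ v i)
    (hvY : ‖v‖ ≤ Y + 1) :
    (t + c.t₀ B + 2) * P.gap (p.x (t + 1)) (p.y (t + 1)) xs v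
        + p.potential P ω gω df c.α₀ (c.t₀ B) K xs v (t + 1)
      ≤ p.potential P ω gω df c.α₀ (c.t₀ B) K xs v t
        - c.α₀ * (t + c.t₀ B + 2) * (3 * t + 8) / 16 * p.stepSq N (t + 1)
        + c.α₀ * (t + c.t₀ B + 1) * (t + 1) / 16 * (p.stepSq N t + p.stepSq N (t - 1))
        + 8 / c.α₀ * (c.Hstar B (diamX P.X ω gω) Y ^ 2 + p.primalErr N Y t)
        - (t + c.t₀ B + 2) * p.mart xs t
        - (t + c.t₀ B + 2) * inner ℝ v (p.mdErr t)
        + p.dualErr N (diamX P.X ω gω) (c.t₀ B) K t := by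
  have h1 := h.recursion_step hN hω hP hB hdf₀ hdf hK ht hxs hv hvY
  have ha := Constants.two_le_t₀ hP hB
  have hα := hP.α₀_pos
  set a := c.t₀ B
  set D := diamX P.X ω gω
  set H := c.Hstar B D Y
  have hD : 0 ≤ D := diamX_nonneg _ _ _
  have hND : N (p.x (t + 1) - p.x t) ≤ D :=
    hω.seminorm_le_diamX hP.X_compact (h.x_mem _ ht) (h.x_mem _ ht.le)
  have e1 : p.stepSq N (t + 1) = N (p.x (t + 1) - p.x t) ^ 2 := rfl
  set ν := N (p.x (t + 1) - p.x t)
  have hν : 0 ≤ ν := apply_nonneg _ _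
  have hγ : (0 : ℝ) < t + a + 2 := by positivity
  set G := Real.sqrt (p.gradErr N t) with hG
  have hGeq : l2 (fun i => dualNorm N (p.δ t i)) = G := rfl
  have hG0 : 0 ≤ G := Real.sqrt_nonneg _
  have hG2 : G ^ 2 = p.gradErr N t := Real.sq_sqrt (p.gradErr_nonneg t)
  rw [hGeq] at h1
  set d0 := dualNorm N (p.δ₀ t)
  have hbud := primal_budget (ν := ν) hα.le ha (Nat.cast_nonneg t)
  rw [e1]
  rcases Nat.eq_zero_or_pos t with rfl | htpos
  · have h0 := h.one_step_init hN hω hP hB hdf₀ hdf hK ht hxs hY hv hvY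
    have e0 : p.stepSq N 0 = 0 := rfl
    rw [← e1]
    simpa only [zero_add, Nat.cast_zero, mul_zero, Nat.zero_sub, e0, add_zero] using h0
  · have ht0 : t ≠ 0 := by omega
    have hE := primal_young (γ := t + a + 2) (H := H) (ν := ν) (S := p.primalErr N Y t)
      (E := d0 + ‖p.y (t + 1)‖ * G) hα (by
      unfold Path.primalErr
      rw [if_neg ht0, ← hG2]
      nlinarith [sq_nonneg (d0 - ‖p.y (t + 1)‖ * G), sq_nonneg d0,
        sq_nonneg (‖p.y (t + 1)‖ * G)])
    have hyo := young (A := t + a + 1) (r := ‖p.est P df t - p.est P df (t - 1)‖)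
      (d := ‖p.y (t + 1) - p.y t‖) (z := K * (t + a + 2) / (t + 1)) (by positivity)
    have hq := Path.norm_est_sub_sq_le hN hω hP hdf h.x_mem htpos ht.le
    set V := p.noise N D (t - 1) + p.noise N D (t - 2) with hV
    have hV0 : 0 ≤ V := add_nonneg (p.noise_nonneg _ _) (p.noise_nonneg _ _)
    set S := p.stepSq N t + p.stepSq N (t - 1)
    have hS0 : 0 ≤ S := add_nonneg (p.stepSq_nonneg _) (p.stepSq_nonneg _)
    have hfin : ((t : ℝ) + a + 1) ^ 2 * ‖p.est P df t - p.est P df (t - 1)‖ ^ 2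
          / (2 * (K * (t + a + 2) / (t + 1)))
        ≤ c.α₀ * (t + a + 1) * (t + 1) / 16 * S + 2 * ((t + a + 1) * (t + 1) / K) * V := by
      have q0 : ((t : ℝ) + a + 1) ^ 2 * ‖p.est P df t - p.est P df (t - 1)‖ ^ 2
          / (2 * (K * (t + a + 2) / (t + 1)))
          = (t + a + 1) * (t + 1) / (2 * K) * ‖p.est P df t - p.est P df (t - 1)‖ ^ 2
            * ((t + a + 1) / (t + a + 2)) := by
        field_simp
      have q1 : ((t : ℝ) + a + 1) / (t + a + 2) ≤ 1 := by
        rw [div_le_one hγ]; linarith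
      have q2 : (t + a + 1) * (t + 1) / (2 * K) * ‖p.est P df t - p.est P df (t - 1)‖ ^ 2
            * ((t + a + 1) / (t + a + 2))
          ≤ (t + a + 1) * (t + 1) / (2 * K) * (4 * c.bigM ^ 2 * S + 4 * V) * 1 := by
        gcongr
      -- This is where `K ≥ 32 𝓜² / α₀` enters.
      have q3 : 4 * c.bigM ^ 2 * S ≤ c.α₀ * K / 8 * S := by
        gcongr
        linarith
      have q4 : ((t : ℝ) + a + 1) * (t + 1) / (2 * K) * (4 * c.bigM ^ 2 * S + 4 * V) * 1
          ≤ (t + a + 1) * (t + 1) / (2 * K) * (c.α₀ * K / 8 * S + 4 * V) * 1 := by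
        gcongr
      have q5 : ((t : ℝ) + a + 1) * (t + 1) / (2 * K) * (c.α₀ * K / 8 * S + 4 * V) * 1
          = c.α₀ * (t + a + 1) * (t + 1) / 16 * S + 2 * ((t + a + 1) * (t + 1) / K) * V := by
        field_simp; ring
      linarith
    unfold Path.mart Path.mdErr Path.dualErr
    rw [if_neg ht0, if_neg ht0, if_neg ht0]
    simp only [inner_sub_left] at h1 ⊢
    linarith

/-- The random part of the convergence estimate after `k` iterations that does not involve the
dual reference point. -/
noncomputable def Path.remainder (p : Path n m) (N : Seminorm ℝ (Vec n)) (α a K D H Y : ℝ)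
    (xs : Vec n) (k : ℕ) : ℝ :=
  ∑ t ∈ Finset.range k, (8 / α * (H ^ 2 + p.primalErr N Y t) - (t + a + 2) * p.mart xs t
    + p.dualErr N D a K t)
    + 4 * ((k + a + 1) * k / K) * (p.noise N D (k - 1) + p.noise N D (k - 2))

/-- The weighted sum of the constraint errors. -/
noncomputable def Path.errSum (p : Path n m) (a : ℝ) (k : ℕ) : Vec m :=
  ∑ t ∈ Finset.range k, ((t : ℝ) + a + 2) • p.mdErr t

/-- All the randomness independent of `v` sits in `remainder`, while `v` meets the noise only
through `errSum`; this separation later allows `v` to depend on the outcome. -/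
theorem IsConExPath.estimate (hN : ∀ v, N v = 0 → v = 0)
    (hω : IsProxGenerator N P.X ω gω) (hP : IsConvexSetting P N ω c) (hB : 1 ≤ B)
    (hdf₀ : ∀ x ∈ P.X, df₀ x ∈ subdiff P.X P.f₀ x)
    (hdf : ∀ i, ∀ x ∈ P.X, df i x ∈ subdiff P.X (P.f i) x)
    (h : IsConExPath P ω gω c.α₀ (c.t₀ B) K df₀ df T p) (hK : 0 < K)
    (hKM : 32 * c.bigM ^ 2 ≤ c.α₀ * K) {k : ℕ} (hk1 : 1 ≤ k) (hk : k ≤ T)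
    {xs : Vec n} (hxs : xs ∈ P.X) {Y : ℝ} (hY : 0 ≤ Y) {v : Vec m} (hv : ∀ i, 0 ≤ v i)
    (hvY : ‖v‖ ≤ Y + 1) :
    ∑ t ∈ Finset.range k, (t + c.t₀ B + 2) * P.gap (p.x (t + 1)) (p.y (t + 1)) xs v
        + c.α₀ * (k + c.t₀ B + 1) * (k + c.t₀ B + 2) / 2 * breg ω gω xs (p.x k)
        + K * (k + c.t₀ B + 1) / k / 4 * ‖v - p.y k‖ ^ 2
      ≤ c.α₀ * (c.t₀ B + 1) * (c.t₀ B + 2) / 2 * breg ω gω xs (p.x 0)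
        + K * (c.t₀ B + 2) / 2 * ‖v‖ ^ 2
        + p.remainder N c.α₀ (c.t₀ B) K (diamX P.X ω gω) (c.Hstar B (diamX P.X ω gω) Y) Y xs k
        - inner ℝ v (p.errSum (c.t₀ B) k) := by
  have ha := Constants.two_le_t₀ hP hB
  have hα := hP.α₀_pos
  set a := c.t₀ B
  set D := diamX P.X ω gω
  set H := c.Hstar B D Y
  have hsum : ∀ j ≤ T, ∑ t ∈ Finset.range j,
        ((t : ℝ) + a + 2) * P.gap (p.x (t + 1)) (p.y (t + 1)) xs v
        + p.potential P ω gω df c.α₀ a K xs v j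
        + ∑ t ∈ Finset.range j, c.α₀ * (t + a + 2) * (3 * t + 8) / 16 * p.stepSq N (t + 1)
      ≤ p.potential P ω gω df c.α₀ a K xs v 0
        + ∑ t ∈ Finset.range j,
          c.α₀ * (t + a + 1) * (t + 1) / 16 * (p.stepSq N t + p.stepSq N (t - 1))
        + ∑ t ∈ Finset.range j, (8 / c.α₀ * (H ^ 2 + p.primalErr N Y t)
          - (t + a + 2) * p.mart xs t + p.dualErr N D a K t)
        - inner ℝ v (p.errSum a j) := by
    intro j
    induction j with
    | zero => intro _; simp [Path.errSum]
    | succ j ih =>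
      intro hj
      have h1 := ih (by omega)
      have h2 := h.one_step hN hω hP hB hdf₀ hdf hK hKM hj hxs hY hv hvY
      simp only [Path.errSum, Finset.sum_range_succ, inner_add_right, inner_smul_right] at h1 ⊢
      linarith
  have h1 := hsum k hk
  have h2 := step_budget' hα.le (by linarith : 0 ≤ a) (p.stepSq_nonneg (N := N)) rfl hk1
  have hp0 : p.potential P ω gω df c.α₀ a K xs v 0
      = c.α₀ * (a + 1) * (a + 2) / 2 * breg ω gω xs (p.x 0) + K * (a + 2) / 2 * ‖v‖ ^ 2 := by
    simp [Path.potential, h.y_init]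
  have hkR : (1 : ℝ) ≤ k := by exact_mod_cast hk1
  have hk0 : (0 : ℝ) < k := by linarith
  have hkc : ((k - 1 : ℕ) : ℝ) = k - 1 := by push_cast [Nat.cast_sub hk1]; ring
  have hq := Path.norm_est_sub_sq_le hN hω hP hdf h.x_mem hk1 hk
  set V := p.noise N D (k - 1) + p.noise N D (k - 2)
  have hV0 : 0 ≤ V := add_nonneg (p.noise_nonneg _ _) (p.noise_nonneg _ _)
  set S := p.stepSq N k + p.stepSq N (k - 1)
  have hS0 : 0 ≤ S := add_nonneg (p.stepSq_nonneg _) (p.stepSq_nonneg _)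
  have hγ : 0 < (k : ℝ) + a + 1 := by positivity
  -- The terminal cross term is absorbed by one half of the dual distance in the potential; the
  -- other half survives in the estimate.
  have hpk : c.α₀ * (k + a + 1) * (k + a + 2) / 2 * breg ω gω xs (p.x k)
        + K * (k + a + 1) / k / 4 * ‖v - p.y k‖ ^ 2
        - c.α₀ * (k + a + 1) * k / 8 * S - 4 * ((k + a + 1) * k / K) * V
      ≤ p.potential P ω gω df c.α₀ a K xs v k := by
    have hc := real_inner_le_norm (p.est P df k - p.est P df (k - 1)) (v - p.y k)
    have hc' := mul_le_mul_of_nonneg_left hc hγ.le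
    have hyo := young (A := k + a + 1) (r := ‖p.est P df k - p.est P df (k - 1)‖)
      (d := ‖v - p.y k‖) (z := K * (k + a + 1) / k / 2) (by positivity)
    have q0 : ((k : ℝ) + a + 1) ^ 2 * ‖p.est P df k - p.est P df (k - 1)‖ ^ 2
          / (2 * (K * (k + a + 1) / k / 2))
        = (k + a + 1) * k / K * ‖p.est P df k - p.est P df (k - 1)‖ ^ 2 := by
      field_simp
    have q2 : (k + a + 1) * k / K * ‖p.est P df k - p.est P df (k - 1)‖ ^ 2
        ≤ (k + a + 1) * k / K * (4 * c.bigM ^ 2 * S + 4 * V) := by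
      gcongr
    have q3 : 4 * c.bigM ^ 2 * S ≤ c.α₀ * K / 8 * S := by
      gcongr
      linarith
    have q4 : ((k : ℝ) + a + 1) * k / K * (4 * c.bigM ^ 2 * S + 4 * V)
        ≤ (k + a + 1) * k / K * (c.α₀ * K / 8 * S + 4 * V) := by
      gcongr
    have q5 : ((k : ℝ) + a + 1) * k / K * (c.α₀ * K / 8 * S + 4 * V)
        = c.α₀ * (k + a + 1) * k / 8 * S + 4 * ((k + a + 1) * k / K) * V := by
      field_simp
    unfold Path.potential
    rw [hkc]
    have e1 : (k : ℝ) - 1 + a + 2 = k + a + 1 := by ring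
    have e2 : (k : ℝ) - 1 + 1 = k := by ring
    rw [e1, e2]
    linarith
  unfold Path.remainder
  linarith

end Pathwise

end ConEx

namespace ConEx

/-! ### Measurability helpers -/

section Measurability

variable {Ω : Type*}

lemma measurable_comp_of_continuousOn {m : MeasurableSpace Ω} {n : ℕ} {F : Type*}
    [TopologicalSpace F] [MeasurableSpace F] [BorelSpace F] [Inhabited F] {f : Vec n → F}
    {X : Set (Vec n)}
    (hf : ContinuousOn f X) (hX : MeasurableSet X) {u : Ω → Vec n} (hu : Measurable u)
    (hmem : ∀ s, u s ∈ X) : Measurable fun s => f (u s) := by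
  classical
  have h := hf.measurable_piecewise (g := fun _ => default) continuousOn_const hX
  have : (fun s => f (u s)) = fun s => X.piecewise f (fun _ => default) (u s) := by
    ext1 s
    rw [Set.piecewise_eq_of_mem _ _ _ (hmem s)]
  rw [this]
  exact h.comp hu

lemma measurable_vec {k : ℕ} {m : MeasurableSpace Ω} {u : Ω → Vec k}
    (h : ∀ i, Measurable fun s => u s i) : Measurable u := by
  have : Measurable fun s => (WithLp.toLp 2 fun i => u s i : Vec k) :=
    (WithLp.measurable_toLp 2 (Fin k → ℝ)).comp (measurable_pi_lambda _ h)
  exact this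

lemma measurable_coord {k : ℕ} (i : Fin k) : Measurable fun u : Vec k => u i := by
  have : Continuous fun u : Vec k => u i := by fun_prop
  exact this.measurable

end Measurability

/-! ### Integration of functions of independent variables -/

section Generic

variable {Ω E Ξ : Type*} [MeasurableSpace Ω] [MeasurableSpace E] [MeasurableSpace Ξ]
  {μ : Measure Ω} [IsProbabilityMeasure μ] {ν : Measure Ξ} [IsProbabilityMeasure ν]

/-- Tonelli on the product law. It replaces conditioning on `U`: a bound for frozen `U` integrates
to a bound, and integrability comes along. -/
lemma integrable_integral_le_of_indepFun {U : Ω → E} {ζ : Ω → Ξ} (hU : Measurable U)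
    (hζ : Measurable ζ) (hind : IndepFun U ζ μ) (hlaw : μ.map ζ = ν) {g : E × Ξ → ℝ}
    (hg : Measurable g) (hg0 : ∀ q, 0 ≤ g q) {b : Ω → ℝ} (hb : Integrable b μ)
    (hint : ∀ s, Integrable (fun z => g (U s, z)) ν) (hle : ∀ s, ∫ z, g (U s, z) ∂ν ≤ b s) :
    Integrable (fun s => g (U s, ζ s)) μ ∧ ∫ s, g (U s, ζ s) ∂μ ≤ ∫ s, b s ∂μ := by
  have hjoint : μ.map (fun s => (U s, ζ s)) = (μ.map U).prod ν := by
    rw [(indepFun_iff_map_prod_eq_prod_map_map hU.aemeasurable hζ.aemeasurable).1 hind, hlaw]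
  have hmeas : Measurable fun s => g (U s, ζ s) := hg.comp (hU.prodMk hζ)
  have hb0 : ∀ s, 0 ≤ b s := fun s => (integral_nonneg fun z => hg0 _).trans (hle s)
  have key : ∫⁻ s, ENNReal.ofReal (g (U s, ζ s)) ∂μ ≤ ENNReal.ofReal (∫ s, b s ∂μ) := by
    calc ∫⁻ s, ENNReal.ofReal (g (U s, ζ s)) ∂μ
        = ∫⁻ q, ENNReal.ofReal (g q) ∂(μ.map fun s => (U s, ζ s)) := by
          rw [lintegral_map hg.ennreal_ofReal (hU.prodMk hζ)]
      _ = ∫⁻ u, ∫⁻ z, ENNReal.ofReal (g (u, z)) ∂ν ∂(μ.map U) := by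
          rw [hjoint, lintegral_prod _ hg.ennreal_ofReal.aemeasurable]
      _ = ∫⁻ s, ∫⁻ z, ENNReal.ofReal (g (U s, z)) ∂ν ∂μ := by
          rw [lintegral_map hg.ennreal_ofReal.lintegral_prod_right' hU]
      _ ≤ ∫⁻ s, ENNReal.ofReal (b s) ∂μ := by
          refine lintegral_mono fun s => ?_
          rw [← ofReal_integral_eq_lintegral_ofReal (hint s)
            (Filter.Eventually.of_forall fun z => hg0 _)]
          exact ENNReal.ofReal_le_ofReal (hle s)
      _ = ENNReal.ofReal (∫ s, b s ∂μ) :=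
          (ofReal_integral_eq_lintegral_ofReal hb (Filter.Eventually.of_forall hb0)).symm
  have hI : Integrable (fun s => g (U s, ζ s)) μ := by
    refine ⟨hmeas.aestronglyMeasurable, ?_⟩
    rw [hasFiniteIntegral_iff_ofReal (Filter.Eventually.of_forall fun s => hg0 _)]
    exact key.trans_lt ENNReal.ofReal_lt_top
  refine ⟨hI, ?_⟩
  rw [← ofReal_integral_eq_lintegral_ofReal hI (Filter.Eventually.of_forall fun s => hg0 _)] at key
  exact (ENNReal.ofReal_le_ofReal_iff (integral_nonneg hb0)).1 key

/-- Fubini in place of conditional expectation; integrability of the composite must be supplied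
because `g` is signed. -/
lemma integral_eq_zero_of_indepFun {U : Ω → E} {ζ : Ω → Ξ} (hU : Measurable U)
    (hζ : Measurable ζ) (hind : IndepFun U ζ μ) (hlaw : μ.map ζ = ν) {g : E × Ξ → ℝ}
    (hg : Measurable g) (hint : Integrable (fun s => g (U s, ζ s)) μ)
    (hzero : ∀ s, ∫ z, g (U s, z) ∂ν = 0) : ∫ s, g (U s, ζ s) ∂μ = 0 := by
  have hjoint : μ.map (fun s => (U s, ζ s)) = (μ.map U).prod ν := by
    rw [(indepFun_iff_map_prod_eq_prod_map_map hU.aemeasurable hζ.aemeasurable).1 hind, hlaw]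
  have hI : Integrable g (μ.map fun s => (U s, ζ s)) :=
    (integrable_map_measure hg.aestronglyMeasurable (hU.prodMk hζ).aemeasurable).2 hint
  calc ∫ s, g (U s, ζ s) ∂μ = ∫ q, g q ∂(μ.map fun s => (U s, ζ s)) := by
        rw [integral_map (hU.prodMk hζ).aemeasurable hg.aestronglyMeasurable]
    _ = ∫ u, ∫ z, g (u, z) ∂ν ∂(μ.map U) := by
        rw [hjoint] at hI ⊢
        rw [integral_prod _ hI]
    _ = ∫ s, ∫ z, g (U s, z) ∂ν ∂μ := by
        rw [integral_map hU.aemeasurable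
          hg.stronglyMeasurable.integral_prod_right'.aestronglyMeasurable]
    _ = 0 := by simp [hzero]

end Generic

/-! ### Past samples and independence -/

section Past

variable {Ω Ξ : Type*} [MeasurableSpace Ξ] {ξ ξbar : ℕ → Ω → Ξ}

/-- The σ-algebra generated by the samples with index in `A`. -/
@[reducible] def sampleSigma (ξ ξbar : ℕ → Ω → Ξ) (A : Set (ℕ ⊕ ℕ)) : MeasurableSpace Ω :=
  ⨆ i ∈ A, MeasurableSpace.comap (Sum.elim ξ ξbar i) inferInstance

/-- The samples that determine `x_t` and `y_{t+1}`. -/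
def past (t : ℕ) : Set (ℕ ⊕ ℕ) := {i | Sum.elim (fun s => s < t) (fun s => s < max t 1) i}

/-- The samples that determine `x_{t+1}`. -/
def pastNext (t : ℕ) : Set (ℕ ⊕ ℕ) := insert (Sum.inl t) (past t)

lemma inl_mem_past {s t : ℕ} : Sum.inl s ∈ past t ↔ s < t := Iff.rfl

lemma inr_mem_past {s t : ℕ} : Sum.inr s ∈ past t ↔ s < max t 1 := Iff.rfl

lemma past_subset_pastNext (t : ℕ) : past t ⊆ pastNext t := Set.subset_insert _ _

lemma pastNext_subset_past {s t : ℕ} (h : s < t) : pastNext s ⊆ past t := by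
  rintro (i | i) hi
  · rcases hi with hi | hi
    · rw [Sum.inl.inj hi]; exact h
    · exact lt_trans (inl_mem_past.1 hi) h
  · rcases hi with hi | hi
    · cases hi
    · have := inr_mem_past.1 hi
      rw [inr_mem_past]; omega

lemma past_mono {s t : ℕ} (h : s ≤ t) : past s ⊆ past t := by
  rcases h.eq_or_lt with rfl | h
  · exact le_rfl
  · exact (past_subset_pastNext s).trans (pastNext_subset_past h)

lemma inl_notMem_past (t : ℕ) : Sum.inl t ∉ past t := by simp [inl_mem_past]

/-- False at `t = 0`, because `y_1` already uses `ξ̄_0`. This single exception is the origin of the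
special treatment of the first iteration. -/
lemma inr_notMem_pastNext {t : ℕ} (ht : t ≠ 0) : Sum.inr t ∉ pastNext t := by
  rintro (h | h)
  · cases h
  · rw [inr_mem_past] at h; omega

lemma sampleSigma_mono {A A' : Set (ℕ ⊕ ℕ)} (h : A ⊆ A') :
    sampleSigma ξ ξbar A ≤ sampleSigma ξ ξbar A' :=
  biSup_mono h

lemma measurable_sample {A : Set (ℕ ⊕ ℕ)} {i : ℕ ⊕ ℕ} (hi : i ∈ A) :
    Measurable[sampleSigma ξ ξbar A] (Sum.elim ξ ξbar i) :=
  (comap_measurable _).mono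
    (le_biSup (fun i => MeasurableSpace.comap (Sum.elim ξ ξbar i) inferInstance) hi) le_rfl

end Past

section Sampling

variable {Ω Ξ : Type*} [MeasurableSpace Ω] [MeasurableSpace Ξ] {μ : Measure Ω}
  {ν : Measure Ξ} {ξ ξbar : ℕ → Ω → Ξ}

lemma IsSampling.measurable_elim (hξ : IsSampling μ ν ξ ξbar) (i : ℕ ⊕ ℕ) :
    Measurable (Sum.elim ξ ξbar i) := by
  cases i with
  | inl t => exact hξ.meas t
  | inr t => exact hξ.meas_bar t

lemma IsSampling.map_elim (hξ : IsSampling μ ν ξ ξbar) (i : ℕ ⊕ ℕ) :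
    μ.map (Sum.elim ξ ξbar i) = ν := by
  cases i with
  | inl t => exact hξ.dist t
  | inr t => exact hξ.dist_bar t

lemma IsSampling.sampleSigma_le (hξ : IsSampling μ ν ξ ξbar) (A : Set (ℕ ⊕ ℕ)) :
    sampleSigma ξ ξbar A ≤ ‹MeasurableSpace Ω› :=
  iSup₂_le fun i _ => (hξ.measurable_elim i).comap_le

lemma IsSampling.indepFun (hξ : IsSampling μ ν ξ ξbar) {A : Set (ℕ ⊕ ℕ)} {j : ℕ ⊕ ℕ}
    (hj : j ∉ A) {E : Type*} [MeasurableSpace E] {U : Ω → E}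
    (hU : Measurable[sampleSigma ξ ξbar A] U) : IndepFun U (Sum.elim ξ ξbar j) μ := by
  have h := indep_iSup_of_disjoint (m := fun i => MeasurableSpace.comap (Sum.elim ξ ξbar i)
    inferInstance) (fun i => (hξ.measurable_elim i).comap_le) hξ.indep
    (Set.disjoint_singleton_right.2 hj)
  rw [iSup_singleton] at h
  exact indep_of_indep_of_le_left h hU.comap_le

end Sampling

/-! ### Oracle errors -/

section OracleErrors

variable {n m : ℕ} {Ξ : Type*} [MeasurableSpace Ξ] {P : Problem n m} {N : Seminorm ℝ (Vec n)}
  {c : Constants m} {O : Oracle n m Ξ} {df₀ : Vec n → Vec n} {df : Fin m → Vec n → Vec n}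

/-- The error of the oracle answer `G₀`. -/
noncomputable def Oracle.err₀ (O : Oracle n m Ξ) (x : Vec n) (z : Ξ) : Vec n :=
  O.G₀ x z - ∫ z', O.G₀ x z' ∂O.law

/-- The error of the oracle answer `Gᵢ`. -/
noncomputable def Oracle.errG (O : Oracle n m Ξ) (i : Fin m) (x : Vec n) (z : Ξ) : Vec n :=
  O.G i x z - ∫ z', O.G i x z' ∂O.law

/-- The error of the oracle answer `F`. -/
noncomputable def Oracle.errF (O : Oracle n m Ξ) (x : Vec n) (z : Ξ) : Vec m :=
  O.F x z - ∫ z', O.F x z' ∂O.law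

/-- The errors are centered at the mean of the oracle rather than at the chosen subgradient: the
former is measurable in the point automatically, while the selection of subgradients need not be. -/
lemma measurable_sub_mean {k : ℕ} {ν : Measure Ξ} [IsProbabilityMeasure ν]
    {G : Vec n → Ξ → Vec k} (hG : Measurable fun q : Vec n × Ξ => G q.1 q.2) :
    Measurable fun q : Vec n × Ξ => G q.1 q.2 - ∫ z', G q.1 z' ∂ν := by
  have h : StronglyMeasurable fun x => ∫ z', G x z' ∂ν :=
    hG.stronglyMeasurable.integral_prod_right'
  exact hG.sub (h.measurable.comp measurable_fst)

lemma IsStochasticOracle.measurable_err₀ (hO : IsStochasticOracle P N c O df₀ df) :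
    Measurable fun q : Vec n × Ξ => O.err₀ q.1 q.2 :=
  have := hO.law_prob
  measurable_sub_mean hO.meas_G₀

lemma IsStochasticOracle.measurable_errG (hO : IsStochasticOracle P N c O df₀ df) (i : Fin m) :
    Measurable fun q : Vec n × Ξ => O.errG i q.1 q.2 :=
  have := hO.law_prob
  measurable_sub_mean (hO.meas_G i)

lemma IsStochasticOracle.measurable_errF (hO : IsStochasticOracle P N c O df₀ df) :
    Measurable fun q : Vec n × Ξ => O.errF q.1 q.2 :=
  have := hO.law_prob
  measurable_sub_mean hO.meas_F

lemma integral_inner_sub_mean {k : ℕ} {ν : Measure Ξ} [IsProbabilityMeasure ν] {G : Ξ → Vec k}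
    (hG : Integrable G ν) (w : Vec k) : ∫ z, inner ℝ w (G z - ∫ z', G z' ∂ν) ∂ν = 0 := by
  have h : Integrable (fun z => G z - ∫ z', G z' ∂ν) ν := hG.sub (integrable_const _)
  rw [integral_inner h, integral_sub hG (integrable_const _), integral_const]
  simp

lemma IsStochasticOracle.integral_inner_err₀ (hO : IsStochasticOracle P N c O df₀ df) {x : Vec n}
    (hx : x ∈ P.X) (w : Vec n) : ∫ z, inner ℝ w (O.err₀ x z) ∂O.law = 0 :=
  have := hO.law_prob
  integral_inner_sub_mean (hO.mean_G₀ x hx).1 w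

lemma IsStochasticOracle.integral_inner_errG (hO : IsStochasticOracle P N c O df₀ df) (i : Fin m)
    {x : Vec n} (hx : x ∈ P.X) (w : Vec n) : ∫ z, inner ℝ w (O.errG i x z) ∂O.law = 0 :=
  have := hO.law_prob
  integral_inner_sub_mean (hO.mean_G i x hx).1 w

lemma IsStochasticOracle.integral_inner_errF (hO : IsStochasticOracle P N c O df₀ df) {x : Vec n}
    (hx : x ∈ P.X) (w : Vec m) : ∫ z, inner ℝ w (O.errF x z) ∂O.law = 0 :=
  have := hO.law_prob
  integral_inner_sub_mean (hO.mean_F x hx).1 w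

lemma IsStochasticOracle.err₀_eq (hO : IsStochasticOracle P N c O df₀ df) {x : Vec n}
    (hx : x ∈ P.X) (z : Ξ) : O.err₀ x z = O.G₀ x z - df₀ x := by
  rw [Oracle.err₀, (hO.mean_G₀ x hx).2]

lemma IsStochasticOracle.errG_eq (hO : IsStochasticOracle P N c O df₀ df) (i : Fin m) {x : Vec n}
    (hx : x ∈ P.X) (z : Ξ) : O.errG i x z = O.G i x z - df i x := by
  rw [Oracle.errG, (hO.mean_G i x hx).2]

lemma IsStochasticOracle.errF_eq (hO : IsStochasticOracle P N c O df₀ df) {x : Vec n}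
    (hx : x ∈ P.X) (z : Ξ) : O.errF x z = O.F x z - WithLp.toLp 2 (fun i => P.f i x) := by
  rw [Oracle.errF, (hO.mean_F x hx).2]

end OracleErrors

end ConEx

/-! ### The iterates are adapted -/

namespace ConEx

variable {n m : ℕ} {Ω Ξ : Type*} [MeasurableSpace Ω] [MeasurableSpace Ξ]
  {N : Seminorm ℝ (Vec n)} {P : Problem n m} {ω : Vec n → ℝ} {gω : Vec n → Vec n}
  {c : Constants m} {O : Oracle n m Ξ} {df₀ : Vec n → Vec n} {df : Fin m → Vec n → Vec n}
  {μ : Measure Ω} {ξ ξbar : ℕ → Ω → Ξ} {B : ℝ} {x0 : Vec n} {T : ℕ}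
  {x : ℕ → Ω → Vec n} {y : ℕ → Ω → Vec m}

/-- The setting of the convergence theorem: a convex problem with a prox-function and a stochastic
oracle, and `T` iterations of the method driven by independent samples. -/
structure IsExperiment (N : Seminorm ℝ (Vec n)) (P : Problem n m) (ω : Vec n → ℝ)
    (gω : Vec n → Vec n) (c : Constants m) (O : Oracle n m Ξ) (df₀ : Vec n → Vec n)
    (df : Fin m → Vec n → Vec n) (μ : Measure Ω) (ξ ξbar : ℕ → Ω → Ξ) (B : ℝ) (x0 : Vec n)
    (T : ℕ) (x : ℕ → Ω → Vec n) (y : ℕ → Ω → Vec m) : Prop where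
  norm : ∀ v, N v = 0 → v = 0
  prox : IsProxGenerator N P.X ω gω
  setting : IsConvexSetting P N ω c
  oracle : IsStochasticOracle P N c O df₀ df
  sampling : IsSampling μ O.law ξ ξbar
  one_le_B : 1 ≤ B
  x0_mem : x0 ∈ P.X
  one_le_T : 1 ≤ T
  run : ∀ s, IsRun P ω gω O (c.steps B (diamX P.X ω gω) T) x0 0 T
      (fun t => ξ t s) (fun t => ξbar t s) (fun t => x t s) (fun t => y t s)

namespace IsExperiment

variable (E : IsExperiment N P ω gω c O df₀ df μ ξ ξbar B x0 T x y)
include E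

lemma x_mem {t : ℕ} (ht : t ≤ T) (s : Ω) : x t s ∈ P.X := by
  cases t with
  | zero => rw [(E.run s).x_init]; exact E.x0_mem
  | succ t => exact ((E.run s).x_step t ht).1

lemma y_nonneg {t : ℕ} (ht : t ≤ T) (s : Ω) (i : Fin m) : 0 ≤ y t s i := by
  cases t with
  | zero => rw [(E.run s).y_init]; exact le_rfl
  | succ t => rw [(E.run s).y_step t ht i]; exact le_max_right _ _

lemma measurable_constrEst {t : ℕ} (ht : t ≤ T)
    (hx : ∀ r ≤ t, Measurable[sampleSigma ξ ξbar (past t)] (x r)) :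
    Measurable[sampleSigma ξ ξbar (past t)]
      fun s => constrEst P O (fun r => x r s) (fun r => ξbar r s) t := by
  have hX : MeasurableSet P.X := E.setting.X_compact.measurableSet
  have hχ : ∀ i, Measurable[sampleSigma ξ ξbar (past t)] fun s => P.χ i (x t s) := fun i =>
    measurable_comp_of_continuousOn (E.setting.χ_cont i) hX (hx t le_rfl) (E.x_mem ht)
  have hbar : ∀ r, r < max t 1 → Measurable[sampleSigma ξ ξbar (past t)] (ξbar r) := fun r hr =>
    measurable_sample (inr_mem_past.2 hr)
  have hF : ∀ r, r ≤ t → r < max t 1 → ∀ i, Measurable[sampleSigma ξ ξbar (past t)]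
      fun s => O.F (x r s) (ξbar r s) i := fun r hr hr' i =>
    (measurable_coord i).comp (E.oracle.meas_F.comp ((hx r hr).prodMk (hbar r hr')))
  refine measurable_vec fun i => ?_
  cases t with
  | zero => exact (hχ i).add (hF 0 le_rfl (by omega) i)
  | succ t =>
    have hG : Measurable[sampleSigma ξ ξbar (past (t + 1))]
        fun s => O.G i (x t s) (ξbar t s) :=
      (E.oracle.meas_G i).comp ((hx t (by omega)).prodMk (hbar t (by omega)))
    exact (hχ i).add ((hF t (by omega) (by omega) i).add
      (hG.inner ((hx (t + 1) le_rfl).sub (hx t (by omega)))))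

/-- `y_{t+1}` uses estimates up to index `t`, which involve `ξ̄` only before `t` (and `ξ̄_0`);
`x_{t+1}` adds `ξ_t` through the measurable prox map. -/
lemma measurable_next {t : ℕ} (ht : t < T)
    (hx : ∀ r ≤ t, Measurable[sampleSigma ξ ξbar (past r)] (x r))
    (hy : Measurable[sampleSigma ξ ξbar (past t)] (y t)) :
    Measurable[sampleSigma ξ ξbar (past t)] (y (t + 1)) ∧
      Measurable[sampleSigma ξ ξbar (pastNext t)] (x (t + 1)) := by
  have hest : ∀ r ≤ t, Measurable[sampleSigma ξ ξbar (past t)]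
      fun s => constrEst P O (fun r => x r s) (fun r => ξbar r s) r := fun r hr =>
    (E.measurable_constrEst (hr.trans ht.le) fun q hq =>
      (hx q (hq.trans hr)).mono (sampleSigma_mono (past_mono hq)) le_rfl).mono
        (sampleSigma_mono (past_mono hr)) le_rfl
  have hextrap : ∀ i, Measurable[sampleSigma ξ ξbar (past t)] fun s =>
      extrap P O (c.steps B (diamX P.X ω gω) T).θ (fun r => x r s) (fun r => ξbar r s) t i := by
    intro i
    generalize (c.steps B (diamX P.X ω gω) T).θ = θ
    have he : (fun s => extrap P O θ (fun r => x r s) (fun r => ξbar r s) t i) = fun s =>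
        (1 + θ t) * constrEst P O (fun r => x r s) (fun r => ξbar r s) t i
          - θ t * constrEst P O (fun r => x r s) (fun r => ξbar r s) (t - 1) i := by
      ext1 s
      cases t <;> simp [extrap]
    rw [he]
    exact (((measurable_coord i).comp (hest t le_rfl)).const_mul _).sub
      (((measurable_coord i).comp (hest (t - 1) (Nat.sub_le t 1))).const_mul _)
  have hy' : Measurable[sampleSigma ξ ξbar (past t)] (y (t + 1)) := by
    refine measurable_vec fun i => ?_
    have : (fun s => y (t + 1) s i) = fun s => max (y t s i
        + 1 / (c.steps B (diamX P.X ω gω) T).τ t * extrap P O (c.steps B (diamX P.X ω gω) T).θ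
          (fun r => x r s) (fun r => ξbar r s) t i) 0 := by
      ext1 s
      exact (E.run s).y_step t ht i
    rw [this]
    exact (((measurable_coord i).comp hy).add
      ((hextrap i).const_mul _)).max measurable_const
  refine ⟨hy', ?_⟩
  have hle : sampleSigma ξ ξbar (past t) ≤ sampleSigma ξ ξbar (pastNext t) :=
    sampleSigma_mono (past_subset_pastNext t)
  have hη : 0 ≤ (c.steps B (diamX P.X ω gω) T).η t := by
    have h1 := E.setting.α₀_pos
    have h2 := Constants.two_le_t₀ E.setting E.one_le_B
    change 0 ≤ c.α₀ * (t + c.t₀ B + 1) / 2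
    positivity
  obtain ⟨p, hp, hpx⟩ := exists_measurable_prox E.norm E.prox E.setting ⟨x0, E.x0_mem⟩ hη
  have hxt : Measurable[sampleSigma ξ ξbar (pastNext t)] (x t) := (hx t le_rfl).mono hle le_rfl
  have hyt : Measurable[sampleSigma ξ ξbar (pastNext t)] (y (t + 1)) := hy'.mono hle le_rfl
  have hξt : Measurable[sampleSigma ξ ξbar (pastNext t)] (ξ t) :=
    measurable_sample (i := Sum.inl t) (Set.mem_insert _ _)
  have hv : Measurable[sampleSigma ξ ξbar (pastNext t)] fun s =>
      O.G₀ (x t s) (ξ t s) + ∑ i, y (t + 1) s i • O.G i (x t s) (ξ t s) := by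
    refine (E.oracle.meas_G₀.comp (hxt.prodMk hξt)).add (Finset.measurable_fun_sum _ fun i _ => ?_)
    exact ((measurable_coord i).comp hyt).smul ((E.oracle.meas_G i).comp (hxt.prodMk hξt))
  have : x (t + 1) = fun s => p (y (t + 1) s,
      O.G₀ (x t s) (ξ t s) + ∑ i, y (t + 1) s i • O.G i (x t s) (ξ t s), x t s) := by
    ext1 s
    exact hpx _ _ _ _ (E.y_nonneg (t := t + 1) ht s) (E.x_mem ht.le s) ((E.run s).x_step t ht)
  rw [this]
  exact hp.comp (hyt.prodMk (hv.prodMk hxt))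

lemma adapted : ∀ t ≤ T, (∀ r ≤ t, Measurable[sampleSigma ξ ξbar (past r)] (x r)) ∧
    Measurable[sampleSigma ξ ξbar (past t)] (y t) := by
  intro t
  induction t with
  | zero =>
    intro _
    constructor
    · intro r hr
      rw [Nat.le_zero.1 hr]
      have : x 0 = fun _ => x0 := by ext1 s; exact (E.run s).x_init
      rw [this]
      exact measurable_const
    · have : y 0 = fun _ => 0 := by ext1 s; exact (E.run s).y_init
      rw [this]
      exact measurable_const
  | succ t ih =>
    intro ht
    obtain ⟨hx, hy⟩ := ih (by omega)
    obtain ⟨h1, h2⟩ := E.measurable_next ht hx hy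
    refine ⟨fun r hr => ?_, h1.mono (sampleSigma_mono (past_mono (Nat.le_succ t))) le_rfl⟩
    rcases hr.eq_or_lt with rfl | hr
    · exact h2.mono (sampleSigma_mono (pastNext_subset_past (Nat.lt_succ_self t))) le_rfl
    · exact hx r (by omega)

lemma adapted_x {t : ℕ} (ht : t ≤ T) : Measurable[sampleSigma ξ ξbar (past t)] (x t) :=
  (E.adapted t ht).1 t le_rfl

lemma adapted_y_next {t : ℕ} (ht : t < T) :
    Measurable[sampleSigma ξ ξbar (past t)] (y (t + 1)) :=
  (E.measurable_next ht (E.adapted t ht.le).1 (E.adapted t ht.le).2).1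

lemma adapted_x_next {t : ℕ} (ht : t < T) :
    Measurable[sampleSigma ξ ξbar (pastNext t)] (x (t + 1)) :=
  (E.measurable_next ht (E.adapted t ht.le).1 (E.adapted t ht.le).2).2

lemma measurable_x {t : ℕ} (ht : t ≤ T) : Measurable (x t) :=
  (E.adapted_x ht).mono (E.sampling.sampleSigma_le _) le_rfl

lemma measurable_y {t : ℕ} (ht : t ≤ T) : Measurable (y t) :=
  (E.adapted t ht).2.mono (E.sampling.sampleSigma_le _) le_rfl

end IsExperiment

end ConEx

/-! ### Second moments of errors, estimates and multipliers -/

namespace ConEx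

/-- The trajectory of the method and the oracle errors for the outcome `s`. -/
noncomputable def runPath {n m : ℕ} {Ω Ξ : Type*} [MeasurableSpace Ξ] (O : Oracle n m Ξ)
    (ξ ξbar : ℕ → Ω → Ξ) (x : ℕ → Ω → Vec n) (y : ℕ → Ω → Vec m) (s : Ω) : Path n m where
  x t := x t s
  y t := y t s
  δ₀ t := O.err₀ (x t s) (ξ t s)
  δ t i := O.errG i (x t s) (ξ t s)
  φ t := O.errF (x t s) (ξbar t s)
  δb t i := O.errG i (x t s) (ξbar t s)

variable {n m : ℕ} {Ω Ξ : Type*} [MeasurableSpace Ω] [MeasurableSpace Ξ]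
  {N : Seminorm ℝ (Vec n)} {P : Problem n m} {ω : Vec n → ℝ} {gω : Vec n → Vec n}
  {c : Constants m} {O : Oracle n m Ξ} {df₀ : Vec n → Vec n} {df : Fin m → Vec n → Vec n}
  {μ : Measure Ω} {ξ ξbar : ℕ → Ω → Ξ} {B : ℝ} {x0 : Vec n} {T : ℕ}
  {x : ℕ → Ω → Vec n} {y : ℕ → Ω → Vec m}

lemma Constants.sq_σX (c : Constants m) (D : ℝ) :
    c.σX D ^ 2 = c.σf ^ 2 + D ^ 2 * l2 c.σ ^ 2 :=
  Real.sq_sqrt (by positivity)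

lemma norm_smul_sub_smul_le {k : ℕ} (a b : ℝ) (u v : Vec k) :
    ‖a • u - b • v‖ ≤ |a| * ‖u‖ + |b| * ‖v‖ := by
  refine (norm_sub_le _ _).trans (le_of_eq ?_)
  rw [norm_smul, norm_smul, Real.norm_eq_abs, Real.norm_eq_abs]

lemma norm_le_of_eq_max {k : ℕ} {u a b : Vec k} {κ : ℝ} (h : ∀ i, u i = max (a i + κ * b i) 0) :
    ‖u‖ ≤ ‖a‖ + |κ| * ‖b‖ := by
  have h1 : ‖u‖ ≤ ‖a + κ • b‖ := by
    have : ‖a + κ • b‖ = l2 fun i => |(a + κ • b) i| := by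
      rw [norm_vec_eq_l2]
      simp [l2, sq_abs]
    rw [this]
    refine norm_le_of_abs_le fun i => ?_
    rw [h i, abs_of_nonneg (le_max_right _ _)]
    refine max_le ?_ (abs_nonneg _)
    simpa using le_abs_self (a i + κ * b i)
  refine h1.trans ((norm_add_le _ _).trans (le_of_eq ?_))
  rw [norm_smul, Real.norm_eq_abs]

namespace IsExperiment

variable (E : IsExperiment N P ω gω c O df₀ df μ ξ ξbar B x0 T x y)
include E

lemma est_eq {t : ℕ} (ht : t ≤ T) (s : Ω) : (runPath O ξ ξbar x y s).est P df t
    = constrEst P O (fun r => x r s) (fun r => ξbar r s) t := by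
  cases t with
  | zero =>
    simp only [Path.est, constrEst, linF, runPath, E.oracle.errF_eq (E.x_mem (Nat.zero_le T) s)]
    ext i
    simp
  | succ t =>
    have hx := E.x_mem (t := t) (by omega) s
    simp only [Path.est, Path.err, constrEst, linF, runPath, E.oracle.errF_eq hx,
      E.oracle.errG_eq _ hx]
    ext i
    simp [inner_sub_left]
    ring

lemma norm_sub_le_diam {u v : Vec n} (hu : u ∈ P.X) (hv : v ∈ P.X) :
    N (u - v) ≤ diamX P.X ω gω :=
  E.prox.seminorm_le_diamX E.setting.X_compact hu hv

lemma measurable_dual_errG (i : Fin m) :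
    Measurable fun q : Vec n × Ξ => dualNorm N (O.errG i q.1 q.2) ^ 2 :=
  ((continuous_dualNorm E.norm).measurable.comp (E.oracle.measurable_errG i)).pow_const 2

lemma measurable_dual_err₀ :
    Measurable fun q : Vec n × Ξ => dualNorm N (O.err₀ q.1 q.2) ^ 2 :=
  ((continuous_dualNorm E.norm).measurable.comp E.oracle.measurable_err₀).pow_const 2

lemma variance_errG (i : Fin m) {v : Vec n} (hv : v ∈ P.X) :
    Integrable (fun z => dualNorm N (O.errG i v z) ^ 2) O.law ∧
      ∫ z, dualNorm N (O.errG i v z) ^ 2 ∂O.law ≤ c.σ i ^ 2 := by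
  simp only [E.oracle.errG_eq i hv]
  exact E.oracle.var_G i v hv

lemma variance_err₀ {v : Vec n} (hv : v ∈ P.X) :
    Integrable (fun z => dualNorm N (O.err₀ v z) ^ 2) O.law ∧
      ∫ z, dualNorm N (O.err₀ v z) ^ 2 ∂O.law ≤ c.σ₀ ^ 2 := by
  simp only [E.oracle.err₀_eq hv]
  exact E.oracle.var_G₀ v hv

lemma variance_errF {v : Vec n} (hv : v ∈ P.X) :
    Integrable (fun z => ‖O.errF v z‖ ^ 2) O.law ∧ ∫ z, ‖O.errF v z‖ ^ 2 ∂O.law ≤ c.σf ^ 2 := by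
  simp only [E.oracle.errF_eq hv]
  exact E.oracle.var_F v hv

/-- For `t = 0` the set `past 0` contains `ξ̄_0`, but `x_0` is constant, so the empty set serves. -/
lemma adapted_const {t : ℕ} (ht : t < T) :
    ∃ A : Set (ℕ ⊕ ℕ), Sum.inr t ∉ A ∧ Measurable[sampleSigma ξ ξbar A] (x t) := by
  rcases Nat.eq_zero_or_pos t with rfl | h
  · refine ⟨∅, by simp, ?_⟩
    have : x 0 = fun _ => x0 := by ext1 s; exact (E.run s).x_init
    rw [this]
    exact measurable_const
  · exact ⟨pastNext t, inr_notMem_pastNext (by omega), (E.adapted_x ht.le).mono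
      (sampleSigma_mono (past_subset_pastNext t)) le_rfl⟩

lemma measurable_φ {t : ℕ} (ht : t < T) : Measurable fun s => (runPath O ξ ξbar x y s).φ t :=
  E.oracle.measurable_errF.comp ((E.measurable_x ht.le).prodMk (E.sampling.meas_bar t))

lemma measurable_δb {t : ℕ} (ht : t < T) (i : Fin m) :
    Measurable fun s => (runPath O ξ ξbar x y s).δb t i :=
  (E.oracle.measurable_errG i).comp ((E.measurable_x ht.le).prodMk (E.sampling.meas_bar t))

lemma measurable_δ {t : ℕ} (ht : t < T) (i : Fin m) :
    Measurable fun s => (runPath O ξ ξbar x y s).δ t i :=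
  (E.oracle.measurable_errG i).comp ((E.measurable_x ht.le).prodMk (E.sampling.meas t))

lemma measurable_δ₀ {t : ℕ} (ht : t < T) : Measurable fun s => (runPath O ξ ξbar x y s).δ₀ t :=
  E.oracle.measurable_err₀.comp ((E.measurable_x ht.le).prodMk (E.sampling.meas t))

lemma measurable_err {t : ℕ} (ht : t < T) : Measurable fun s => (runPath O ξ ξbar x y s).err t := by
  refine (E.measurable_φ ht).add (measurable_vec fun i => ?_)
  exact (E.measurable_δb ht i).inner
    ((E.measurable_x (t := t + 1) ht).sub (E.measurable_x ht.le))

lemma measurable_mdErr {t : ℕ} (ht : t < T) :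
    Measurable fun s => (runPath O ξ ξbar x y s).mdErr t := by
  unfold Path.mdErr
  split_ifs with h
  · exact E.measurable_φ (by omega)
  · exact E.measurable_err ht

variable [IsProbabilityMeasure μ]

/-- The weight will be `‖y_{t+1}‖²`, which is random but known before the sample. -/
lemma weighted_moment {A : Set (ℕ ⊕ ℕ)} {j : ℕ ⊕ ℕ} (hj : j ∉ A) {u : Ω → Vec n}
    (hu : Measurable[sampleSigma ξ ξbar A] u) (hmem : ∀ s, u s ∈ P.X) {r : Ω → ℝ}
    (hr : Measurable[sampleSigma ξ ξbar A] r) (hr0 : ∀ s, 0 ≤ r s) (hri : Integrable r μ)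
    {g : Vec n × Ξ → ℝ} (hg : Measurable g) (hg0 : ∀ q, 0 ≤ g q) {b : ℝ}
    (hgi : ∀ v ∈ P.X, Integrable (fun z => g (v, z)) O.law ∧ ∫ z, g (v, z) ∂O.law ≤ b) :
    Integrable (fun s => r s * g (u s, Sum.elim ξ ξbar j s)) μ ∧
      ∫ s, r s * g (u s, Sum.elim ξ ξbar j s) ∂μ ≤ b * ∫ s, r s ∂μ := by
  have := E.oracle.law_prob
  have hUr : Measurable[sampleSigma ξ ξbar A] fun s => (u s, r s) := hu.prodMk hr
  have h := integrable_integral_le_of_indepFun (U := fun s => (u s, r s))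
    (ζ := Sum.elim ξ ξbar j) (ν := O.law) (μ := μ)
    (hUr.mono (E.sampling.sampleSigma_le A) le_rfl) (E.sampling.measurable_elim j)
    (E.sampling.indepFun hj hUr) (E.sampling.map_elim j)
    -- The absolute value makes the integrand nonnegative on the whole product space, not only along
    -- the nonnegative `r`.
    (g := fun q => |q.1.2| * g (q.1.1, q.2)) (b := fun s => r s * b)
    (by
      have h1 : Measurable fun q : (Vec n × ℝ) × Ξ => g (q.1.1, q.2) :=
        hg.comp (by fun_prop)
      have h2 : Measurable fun q : (Vec n × ℝ) × Ξ => |q.1.2| := by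
        have := measurable_norm.comp
          (measurable_snd.comp measurable_fst : Measurable fun q : (Vec n × ℝ) × Ξ => q.1.2)
        exact this
      exact h2.mul h1)
    (fun q => mul_nonneg (abs_nonneg _) (hg0 _)) (hri.mul_const b)
    (fun s => (hgi (u s) (hmem s)).1.const_mul |r s|)
    (fun s => by
      simp only
      rw [integral_const_mul, abs_of_nonneg (hr0 s)]
      exact mul_le_mul_of_nonneg_left (hgi _ (hmem s)).2 (hr0 s))
  simp only [abs_of_nonneg (hr0 _)] at h
  rw [integral_mul_const, mul_comm] at h
  exact h

lemma moment {A : Set (ℕ ⊕ ℕ)} {j : ℕ ⊕ ℕ} (hj : j ∉ A) {u : Ω → Vec n}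
    (hu : Measurable[sampleSigma ξ ξbar A] u) (hmem : ∀ s, u s ∈ P.X)
    {g : Vec n × Ξ → ℝ} (hg : Measurable g) (hg0 : ∀ q, 0 ≤ g q) {b : ℝ}
    (hgi : ∀ v ∈ P.X, Integrable (fun z => g (v, z)) O.law ∧ ∫ z, g (v, z) ∂O.law ≤ b) :
    Integrable (fun s => g (u s, Sum.elim ξ ξbar j s)) μ ∧
      ∫ s, g (u s, Sum.elim ξ ξbar j s) ∂μ ≤ b := by
  have h := E.weighted_moment hj hu hmem (r := fun _ => 1) measurable_const
    (fun _ => zero_le_one) (integrable_const _) hg hg0 hgi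
  simpa using h

lemma zero_mean {A : Set (ℕ ⊕ ℕ)} {j : ℕ ⊕ ℕ} (hj : j ∉ A) {k : ℕ} {u : Ω → Vec n}
    (hu : Measurable[sampleSigma ξ ξbar A] u) (hmem : ∀ s, u s ∈ P.X) {w : Ω → Vec k}
    (hw : Measurable[sampleSigma ξ ξbar A] w) {e : Vec n → Ξ → Vec k}
    (he : Measurable fun q : Vec n × Ξ => e q.1 q.2)
    (hzero : ∀ v ∈ P.X, ∀ w : Vec k, ∫ z, inner ℝ w (e v z) ∂O.law = 0)
    (hint : Integrable (fun s => (inner ℝ (w s) (e (u s) (Sum.elim ξ ξbar j s)) : ℝ)) μ) :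
    ∫ s, inner ℝ (w s) (e (u s) (Sum.elim ξ ξbar j s)) ∂μ = 0 := by
  have := E.oracle.law_prob
  have hUw : Measurable[sampleSigma ξ ξbar A] fun s => (u s, w s) := hu.prodMk hw
  refine integral_eq_zero_of_indepFun (U := fun s => (u s, w s)) (ν := O.law)
    (hUw.mono (E.sampling.sampleSigma_le A) le_rfl) (E.sampling.measurable_elim j)
    (E.sampling.indepFun hj hUw) (E.sampling.map_elim j)
    (g := fun q => inner ℝ q.1.2 (e q.1.1 q.2)) ?_ hint fun s => hzero _ (hmem s) _
  have h1 : Measurable fun q : (Vec n × Vec k) × Ξ => e q.1.1 q.2 := by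
    have : Measurable fun q : (Vec n × Vec k) × Ξ => (q.1.1, q.2) := by fun_prop
    exact he.comp this
  exact (measurable_snd.comp measurable_fst).inner h1

lemma moment_δ₀ {t : ℕ} (ht : t < T) :
    Integrable (fun s => dualNorm N ((runPath O ξ ξbar x y s).δ₀ t) ^ 2) μ ∧
      ∫ s, dualNorm N ((runPath O ξ ξbar x y s).δ₀ t) ^ 2 ∂μ ≤ c.σ₀ ^ 2 :=
  E.moment (inl_notMem_past t) (E.adapted_x ht.le) (E.x_mem ht.le) E.measurable_dual_err₀
    (fun _ => sq_nonneg _) fun _ hv => E.variance_err₀ hv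

lemma moment_gradErr {t : ℕ} (ht : t < T) {r : Ω → ℝ}
    (hr : Measurable[sampleSigma ξ ξbar (past t)] r) (hr0 : ∀ s, 0 ≤ r s)
    (hri : Integrable r μ) :
    (∀ i, Integrable (fun s => r s * dualNorm N ((runPath O ξ ξbar x y s).δ t i) ^ 2) μ) ∧
    Integrable (fun s => r s * (runPath O ξ ξbar x y s).gradErr N t) μ ∧
      ∫ s, r s * (runPath O ξ ξbar x y s).gradErr N t ∂μ ≤ l2 c.σ ^ 2 * ∫ s, r s ∂μ := by
  have h : ∀ i, Integrable (fun s => r s * dualNorm N ((runPath O ξ ξbar x y s).δ t i) ^ 2) μ ∧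
      ∫ s, r s * dualNorm N ((runPath O ξ ξbar x y s).δ t i) ^ 2 ∂μ ≤ c.σ i ^ 2 * ∫ s, r s ∂μ :=
    fun i => E.weighted_moment (inl_notMem_past t) (E.adapted_x ht.le) (E.x_mem ht.le)
    hr hr0 hri (E.measurable_dual_errG i) (fun _ => sq_nonneg _) fun _ hv => E.variance_errG i hv
  refine ⟨fun i => (h i).1, ?_⟩
  simp only [Path.gradErr, Finset.mul_sum]
  refine ⟨integrable_finsetSum _ fun i _ => (h i).1, ?_⟩
  rw [integral_finsetSum _ fun i _ => (h i).1, l2_sq, Finset.sum_mul]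
  exact Finset.sum_le_sum fun i _ => (h i).2

lemma moment_δb {t : ℕ} (ht : t < T) (i : Fin m) :
    Integrable (fun s => dualNorm N ((runPath O ξ ξbar x y s).δb t i) ^ 2) μ ∧
      ∫ s, dualNorm N ((runPath O ξ ξbar x y s).δb t i) ^ 2 ∂μ ≤ c.σ i ^ 2 := by
  obtain ⟨A, hA, hx⟩ := E.adapted_const ht
  exact E.moment hA hx (E.x_mem ht.le) (E.measurable_dual_errG i) (fun _ => sq_nonneg _)
    fun _ hv => E.variance_errG i hv

lemma moment_gradErrBar {t : ℕ} (ht : t < T) :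
    Integrable (fun s => (runPath O ξ ξbar x y s).gradErrBar N t) μ ∧
      ∫ s, (runPath O ξ ξbar x y s).gradErrBar N t ∂μ ≤ l2 c.σ ^ 2 := by
  simp only [Path.gradErrBar]
  refine ⟨integrable_finsetSum _ fun i _ => (E.moment_δb ht i).1, ?_⟩
  rw [integral_finsetSum _ fun i _ => (E.moment_δb ht i).1, l2_sq]
  exact Finset.sum_le_sum fun i _ => (E.moment_δb ht i).2

lemma moment_φ {t : ℕ} (ht : t < T) :
    Integrable (fun s => ‖(runPath O ξ ξbar x y s).φ t‖ ^ 2) μ ∧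
      ∫ s, ‖(runPath O ξ ξbar x y s).φ t‖ ^ 2 ∂μ ≤ c.σf ^ 2 := by
  obtain ⟨A, hA, hx⟩ := E.adapted_const ht
  exact E.moment hA hx (E.x_mem ht.le) (g := fun q => ‖O.errF q.1 q.2‖ ^ 2)
    (E.oracle.measurable_errF.norm.pow_const 2) (fun _ => sq_nonneg _)
    fun _ hv => E.variance_errF hv

lemma moment_noise {t : ℕ} (ht : t < T) :
    Integrable (fun s => (runPath O ξ ξbar x y s).noise N (diamX P.X ω gω) t) μ ∧
      ∫ s, (runPath O ξ ξbar x y s).noise N (diamX P.X ω gω) t ∂μ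
        ≤ 2 * c.σX (diamX P.X ω gω) ^ 2 := by
  have h1 := E.moment_φ ht
  have h2 := E.moment_gradErrBar ht
  unfold Path.noise
  refine ⟨(h1.1.const_mul _).add (h2.1.const_mul _), ?_⟩
  rw [integral_add (h1.1.const_mul _) (h2.1.const_mul _), integral_const_mul,
    integral_const_mul, c.sq_σX]
  have := mul_le_mul_of_nonneg_left h2.2
    (by positivity : 0 ≤ 2 * diamX P.X ω gω ^ 2)
  linarith [h1.2]

lemma memLp_of_sq_le_noise {u : Ω → Vec m} (hu : Measurable u) {t : ℕ} (ht : t < T)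
    (h : ∀ s, ‖u s‖ ^ 2 ≤ (runPath O ξ ξbar x y s).noise N (diamX P.X ω gω) t) :
    MemLp u 2 μ := by
  rw [memLp_two_iff_integrable_sq_norm hu.aestronglyMeasurable]
  refine (E.moment_noise ht).1.mono' (hu.norm.pow_const 2).aestronglyMeasurable
    (Filter.Eventually.of_forall fun s => ?_)
  rw [Real.norm_of_nonneg (sq_nonneg _)]
  exact h s

lemma memLp_err {t : ℕ} (ht : t < T) : MemLp (fun s => (runPath O ξ ξbar x y s).err t) 2 μ :=
  E.memLp_of_sq_le_noise (E.measurable_err ht) ht fun s => Path.norm_err_sq_le E.norm _ t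
    (E.norm_sub_le_diam (E.x_mem (t := t + 1) ht s) (E.x_mem ht.le s))

lemma memLp_mdErr {t : ℕ} (ht : t < T) : MemLp (fun s => (runPath O ξ ξbar x y s).mdErr t) 2 μ :=
  E.memLp_of_sq_le_noise (E.measurable_mdErr ht) ht fun s => Path.norm_mdErr_sq_le E.norm _ t
    (E.norm_sub_le_diam (E.x_mem (t := t + 1) ht s) (E.x_mem ht.le s))

/-- Apart from the square-integrable error, the estimate is bounded: `f` and `χ` are continuous on a
compact set, and the slope is controlled by the Lipschitz constants. -/
lemma memLp_est {t : ℕ} (ht : t ≤ T) :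
    MemLp (fun s => constrEst P O (fun r => x r s) (fun r => ξbar r s) t) 2 μ := by
  have hmeas : Measurable fun s => constrEst P O (fun r => x r s) (fun r => ξbar r s) t :=
    (E.measurable_constrEst ht fun r hr => (E.adapted_x (hr.trans ht)).mono
      (sampleSigma_mono (past_mono hr)) le_rfl).mono (E.sampling.sampleSigma_le _) le_rfl
  have hbd : ∀ h : Vec n → ℝ, ContinuousOn h P.X → ∃ C, ∀ u ∈ P.X, |h u| ≤ C := fun h hh => by
    obtain ⟨C, hC⟩ := (E.setting.X_compact.image_of_continuousOn hh).isBounded.exists_norm_le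
    exact ⟨C, fun u hu => hC _ ⟨u, hu, rfl⟩⟩
  choose Cχ hCχ using fun i => hbd _ (E.setting.χ_cont i)
  choose Cf hCf using fun i => hbd _ (E.setting.f_cont i)
  have h0T : 0 < T := E.one_le_T
  cases t with
  | zero =>
    have hφ : MemLp (fun s => (runPath O ξ ξbar x y s).φ 0) 2 μ := by
      simpa [Path.mdErr] using E.memLp_mdErr h0T
    refine ((memLp_const (l2 fun i => Cχ i + Cf i)).add hφ.norm).of_le hmeas.aestronglyMeasurable
      (Filter.Eventually.of_forall fun s => ?_)
    rw [← E.est_eq (Nat.zero_le T) s]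
    refine le_trans ?_ (le_abs_self _)
    refine (norm_add_le _ _).trans (add_le_add_left (norm_le_of_abs_le fun i => ?_) _)
    have hx := E.x_mem (Nat.zero_le T) s
    exact (abs_add_le _ _).trans (add_le_add (hCχ i _ hx) (hCf i _ hx))
  | succ t =>
    refine ((memLp_const (l2 fun i => Cχ i + Cf i + c.Mf i * diamX P.X ω gω)).add
      (E.memLp_err ht).norm).of_le hmeas.aestronglyMeasurable
      (Filter.Eventually.of_forall fun s => ?_)
    rw [← E.est_eq ht s]
    refine le_trans ?_ (le_abs_self _)
    refine (norm_add_le _ _).trans (add_le_add_left (norm_le_of_abs_le fun i => ?_) _)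
    have hx := E.x_mem (t := t) (by omega) s
    have hx' := E.x_mem ht s
    refine (abs_add_le _ _).trans (add_le_add ((abs_add_le _ _).trans
      (add_le_add (hCχ i _ hx') (hCf i _ hx))) ?_)
    refine (abs_inner_subdiff_le (E.setting.f_lip i) (E.oracle.df_mem i _ hx)
      (vsub_mem_vectorSpan ℝ hx' hx)).trans ?_
    exact mul_le_mul_of_nonneg_left (E.norm_sub_le_diam hx' hx) (E.setting.Mf_nonneg i)

/-- Only finiteness of the second moments is obtained here; it makes all later integrals legitimate.
The quantitative bound comes from the averaged recursion. -/
lemma memLp_y : ∀ t ≤ T, MemLp (y t) 2 μ := by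
  intro t
  induction t with
  | zero =>
    intro _
    have : y 0 = fun _ => 0 := by ext1 s; exact (E.run s).y_init
    rw [this]
    exact memLp_const 0
  | succ t ih =>
    intro ht
    generalize hS : c.steps B (diamX P.X ω gω) T = S
    have hq := (((E.memLp_est (t := t) (by omega)).norm.const_mul |1 + S.θ t|).add
      ((E.memLp_est (t := t - 1) (by omega)).norm.const_mul |S.θ t|)).const_mul |1 / S.τ t|
    refine ((ih (by omega)).norm.add hq).of_le
      (E.measurable_y ht).aestronglyMeasurable (Filter.Eventually.of_forall fun s => ?_)
    have hy := (E.run s).y_step t ht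
    rw [hS] at hy
    refine (norm_le_of_eq_max hy).trans (le_trans ?_ (le_abs_self _))
    simp only [Pi.add_apply]
    gcongr
    cases t with
    | zero => exact norm_smul_sub_smul_le _ _ _ _
    | succ t => exact norm_smul_sub_smul_le _ _ _ _

lemma integrable_y_sq {t : ℕ} (ht : t ≤ T) : Integrable (fun s => ‖y t s‖ ^ 2) μ :=
  (memLp_two_iff_integrable_sq_norm (E.measurable_y ht).aestronglyMeasurable).1 (E.memLp_y t ht)

end IsExperiment

end ConEx

/-! ### Mean-zero terms and the expected remainder -/

namespace ConEx

variable {n m : ℕ} {Ω Ξ : Type*} [MeasurableSpace Ω] [MeasurableSpace Ξ]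
  {N : Seminorm ℝ (Vec n)} {P : Problem n m} {ω : Vec n → ℝ} {gω : Vec n → Vec n}
  {c : Constants m} {O : Oracle n m Ξ} {df₀ : Vec n → Vec n} {df : Fin m → Vec n → Vec n}
  {μ : Measure Ω} {ξ ξbar : ℕ → Ω → Ξ} {B : ℝ} {x0 : Vec n} {T : ℕ}
  {x : ℕ → Ω → Vec n} {y : ℕ → Ω → Vec m}

/-- An integrable majorant for multiplier times error, when only the product of the squares is known
to be integrable. -/
lemma abs_mul_le_one_add_sq_mul {a d D : ℝ} (hD : 0 ≤ D) :
    |a| * (d * D) ≤ D * (1 + a ^ 2 * d ^ 2) := by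
  have : |a| * d ≤ 1 + (|a| * d) ^ 2 := by nlinarith [sq_nonneg (|a| * d - 1), sq_nonneg (|a| * d)]
  rw [mul_pow, sq_abs] at this
  nlinarith [abs_nonneg a]

lemma sq_coord_le (u : Vec m) (i : Fin m) : u i ^ 2 ≤ ‖u‖ ^ 2 := by
  rw [norm_vec_sq]
  exact Finset.single_le_sum (f := fun i => u i ^ 2) (fun _ _ => sq_nonneg _) (Finset.mem_univ i)

lemma sum_weights_le (a : ℝ) (k : ℕ) :
    ∑ t ∈ Finset.range k, 8 * (((t : ℝ) + a + 1) * (t + 1)) ≤ 4 * (k + a) * k * (k + 1) := by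
  induction k with
  | zero => simp
  | succ k ih =>
    rw [Finset.sum_range_succ]
    push_cast
    nlinarith

lemma integral_add₃ {f g h : Ω → ℝ} (hf : Integrable f μ) (hg : Integrable g μ)
    (hh : Integrable h μ) :
    ∫ s, (f s + g s + h s) ∂μ = ∫ s, f s ∂μ + ∫ s, g s ∂μ + ∫ s, h s ∂μ := by
  have h1 := integral_add (hf.add hg) hh
  have h2 := integral_add hf hg
  simp only [Pi.add_apply] at h1 h2
  rw [h1, h2]

namespace IsExperiment

variable (E : IsExperiment N P ω gω c O df₀ df μ ξ ξbar B x0 T x y)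
include E

lemma adapted_mdErr {t k : ℕ} (htk : t < k) (hk : k ≤ T) :
    Measurable[sampleSigma ξ ξbar (past k)] fun s => (runPath O ξ ξbar x y s).mdErr t := by
  have hxt : Measurable[sampleSigma ξ ξbar (past k)] (x t) :=
    (E.adapted_x (by omega)).mono (sampleSigma_mono (past_mono htk.le)) le_rfl
  have hxt' : Measurable[sampleSigma ξ ξbar (past k)] (x (t + 1)) :=
    (E.adapted_x (by omega)).mono (sampleSigma_mono (past_mono htk)) le_rfl
  have hbar : Measurable[sampleSigma ξ ξbar (past k)] (ξbar t) :=
    measurable_sample (i := Sum.inr t) (inr_mem_past.2 (by omega))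
  have hφ : Measurable[sampleSigma ξ ξbar (past k)] fun s => (runPath O ξ ξbar x y s).φ t :=
    E.oracle.measurable_errF.comp (hxt.prodMk hbar)
  unfold Path.mdErr
  split_ifs with h
  · rwa [h] at hφ
  · refine hφ.add (measurable_vec fun i => ?_)
    exact ((E.oracle.measurable_errG i).comp (hxt.prodMk hbar)).inner (hxt'.sub hxt)

lemma adapted_y_sq {t : ℕ} (ht : t < T) :
    Measurable[sampleSigma ξ ξbar (past t)] fun s => ‖y (t + 1) s‖ ^ 2 :=
  (continuous_norm.pow 2).measurable.comp (E.adapted_y_next ht)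

lemma adapted_errSum {k : ℕ} (hk : k ≤ T) (a : ℝ) :
    Measurable[sampleSigma ξ ξbar (past k)] fun s => (runPath O ξ ξbar x y s).errSum a k := by
  refine measurable_vec fun i => ?_
  have h : (fun s => (runPath O ξ ξbar x y s).errSum a k i) = fun s =>
      ∑ t ∈ Finset.range k, ((t : ℝ) + a + 2) * (runPath O ξ ξbar x y s).mdErr t i := by
    ext1 s
    simp [Path.errSum]
  rw [h]
  exact Finset.measurable_fun_sum _ fun t ht =>
    ((measurable_coord i).comp (E.adapted_mdErr (Finset.mem_range.1 ht) hk)).const_mul _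

variable [IsProbabilityMeasure μ]

lemma mean_δ₀ {xs : Vec n} (hxs : xs ∈ P.X) {t : ℕ} (ht : t < T) :
    Integrable (fun s => (inner ℝ ((runPath O ξ ξbar x y s).δ₀ t) (x t s - xs) : ℝ)) μ ∧
      ∫ s, (inner ℝ ((runPath O ξ ξbar x y s).δ₀ t) (x t s - xs) : ℝ) ∂μ = 0 := by
  have hD := diamX_nonneg P.X ω gω
  have hint : Integrable
      (fun s => (inner ℝ (x t s - xs) ((runPath O ξ ξbar x y s).δ₀ t) : ℝ)) μ := by
    refine (((integrable_const (1 : ℝ)).add (((E.moment_δ₀ ht).1).const_mul (1 ^ 2))).const_mul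
      (diamX P.X ω gω)).mono' (((E.measurable_x ht.le).sub_const xs).inner
        (E.measurable_δ₀ ht)).aestronglyMeasurable (Filter.Eventually.of_forall fun s => ?_)
    rw [real_inner_comm, Real.norm_eq_abs]
    refine (abs_inner_le_dualNorm_mul E.norm _ _).trans ?_
    have h1 := abs_mul_le_one_add_sq_mul (a := 1)
      (d := dualNorm N ((runPath O ξ ξbar x y s).δ₀ t)) hD
    rw [abs_one, one_mul] at h1
    refine le_trans ?_ h1
    exact mul_le_mul_of_nonneg_left (E.norm_sub_le_diam (E.x_mem ht.le s) hxs)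
      (dualNorm_nonneg E.norm _)
  have hz := E.zero_mean (inl_notMem_past t) (E.adapted_x ht.le) (E.x_mem ht.le)
    ((E.adapted_x ht.le).sub_const xs) E.oracle.measurable_err₀
    (fun v hv w => E.oracle.integral_inner_err₀ hv w) hint
  simp only [real_inner_comm (x t _ - xs)]
  exact ⟨hint, hz⟩

lemma mean_δ {xs : Vec n} (hxs : xs ∈ P.X) {t : ℕ} (ht : t < T) (i : Fin m) :
    Integrable (fun s => y (t + 1) s i *
        (inner ℝ ((runPath O ξ ξbar x y s).δ t i) (x t s - xs) : ℝ)) μ ∧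
      ∫ s, y (t + 1) s i *
        (inner ℝ ((runPath O ξ ξbar x y s).δ t i) (x t s - xs) : ℝ) ∂μ = 0 := by
  have hD := diamX_nonneg P.X ω gω
  have heq : (fun s => y (t + 1) s i *
        (inner ℝ ((runPath O ξ ξbar x y s).δ t i) (x t s - xs) : ℝ))
      = fun s => (inner ℝ (y (t + 1) s i • (x t s - xs))
        ((runPath O ξ ξbar x y s).δ t i) : ℝ) := by
    ext1 s
    rw [inner_smul_left, real_inner_comm, RCLike.conj_to_real]
  have hw : Measurable[sampleSigma ξ ξbar (past t)] fun s => y (t + 1) s i • (x t s - xs) :=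
    ((measurable_coord i).comp (E.adapted_y_next ht)).smul ((E.adapted_x ht.le).sub_const xs)
  have hmom := (E.moment_gradErr ht (E.adapted_y_sq ht)
    (fun s => sq_nonneg _) (E.integrable_y_sq ht)).1 i
  have hint : Integrable (fun s => (inner ℝ (y (t + 1) s i • (x t s - xs))
        ((runPath O ξ ξbar x y s).δ t i) : ℝ)) μ := by
    refine (((integrable_const (1 : ℝ)).add hmom).const_mul (diamX P.X ω gω)).mono'
      ((hw.mono (E.sampling.sampleSigma_le _) le_rfl).inner
        (E.measurable_δ ht i)).aestronglyMeasurable (Filter.Eventually.of_forall fun s => ?_)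
    have hd := dualNorm_nonneg E.norm ((runPath O ξ ξbar x y s).δ t i)
    rw [inner_smul_left, real_inner_comm, RCLike.conj_to_real, Real.norm_eq_abs, abs_mul]
    have h1 := abs_mul_le_one_add_sq_mul (a := y (t + 1) s i)
      (d := dualNorm N ((runPath O ξ ξbar x y s).δ t i)) hD
    have h2 : |(inner ℝ ((runPath O ξ ξbar x y s).δ t i) (x t s - xs) : ℝ)|
        ≤ dualNorm N ((runPath O ξ ξbar x y s).δ t i) * diamX P.X ω gω :=
      (abs_inner_le_dualNorm_mul E.norm _ _).trans (mul_le_mul_of_nonneg_left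
        (E.norm_sub_le_diam (E.x_mem ht.le s) hxs) hd)
    refine (mul_le_mul_of_nonneg_left h2 (abs_nonneg _)).trans (h1.trans ?_)
    have h3 := sq_coord_le (y (t + 1) s) i
    simp only [Pi.add_apply]
    gcongr
  rw [heq]
  exact ⟨hint, E.zero_mean (inl_notMem_past t) (E.adapted_x ht.le) (E.x_mem ht.le) hw
    (E.oracle.measurable_errG i) (fun v hv w => E.oracle.integral_inner_errG i hv w) hint⟩

lemma mean_φ {t : ℕ} (ht : t < T) {A : Set (ℕ ⊕ ℕ)} (hA : Sum.inr t ∉ A)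
    (hx : Measurable[sampleSigma ξ ξbar A] (x t)) {w : Ω → Vec m}
    (hw : Measurable[sampleSigma ξ ξbar A] w) (hw2 : Integrable (fun s => ‖w s‖ ^ 2) μ) :
    Integrable (fun s => (inner ℝ (w s) ((runPath O ξ ξbar x y s).φ t) : ℝ)) μ ∧
      ∫ s, (inner ℝ (w s) ((runPath O ξ ξbar x y s).φ t) : ℝ) ∂μ = 0 := by
  have hint : Integrable (fun s => (inner ℝ (w s) ((runPath O ξ ξbar x y s).φ t) : ℝ)) μ := by
    refine (hw2.add (E.moment_φ ht).1).mono' ((hw.mono (E.sampling.sampleSigma_le _) le_rfl).inner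
        (E.measurable_φ ht)).aestronglyMeasurable (Filter.Eventually.of_forall fun s => ?_)
    refine (norm_inner_le_norm _ _).trans ?_
    simp only [Pi.add_apply]
    nlinarith [sq_nonneg (‖w s‖ - ‖(runPath O ξ ξbar x y s).φ t‖), sq_nonneg ‖w s‖,
      sq_nonneg ‖(runPath O ξ ξbar x y s).φ t‖]
  exact ⟨hint, E.zero_mean hA hx (E.x_mem ht.le) hw E.oracle.measurable_errF
    (fun v hv w => E.oracle.integral_inner_errF hv w) hint⟩

lemma mean_δb {t : ℕ} (ht : t < T) {A : Set (ℕ ⊕ ℕ)} (hA : Sum.inr t ∉ A)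
    (hx : Measurable[sampleSigma ξ ξbar A] (x t))
    (hx' : Measurable[sampleSigma ξ ξbar A] (x (t + 1))) {w : Ω → Vec m}
    (hw : Measurable[sampleSigma ξ ξbar A] w) (hw2 : Integrable (fun s => ‖w s‖ ^ 2) μ)
    (i : Fin m) :
    Integrable (fun s => w s i *
        (inner ℝ ((runPath O ξ ξbar x y s).δb t i) (x (t + 1) s - x t s) : ℝ)) μ ∧
      ∫ s, w s i *
        (inner ℝ ((runPath O ξ ξbar x y s).δb t i) (x (t + 1) s - x t s) : ℝ) ∂μ = 0 := by
  have hD := diamX_nonneg P.X ω gω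
  have heq : (fun s => w s i *
        (inner ℝ ((runPath O ξ ξbar x y s).δb t i) (x (t + 1) s - x t s) : ℝ))
      = fun s => (inner ℝ (w s i • (x (t + 1) s - x t s))
        ((runPath O ξ ξbar x y s).δb t i) : ℝ) := by
    ext1 s
    rw [inner_smul_left, real_inner_comm, RCLike.conj_to_real]
  have hw' : Measurable[sampleSigma ξ ξbar A] fun s => w s i • (x (t + 1) s - x t s) :=
    ((measurable_coord i).comp hw).smul (hx'.sub hx)
  have hint : Integrable (fun s => (inner ℝ (w s i • (x (t + 1) s - x t s))
        ((runPath O ξ ξbar x y s).δb t i) : ℝ)) μ := by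
    refine ((hw2.add (E.moment_δb ht i).1).const_mul (diamX P.X ω gω)).mono'
      ((hw'.mono (E.sampling.sampleSigma_le _) le_rfl).inner
        (E.measurable_δb ht i)).aestronglyMeasurable (Filter.Eventually.of_forall fun s => ?_)
    have hd := dualNorm_nonneg E.norm ((runPath O ξ ξbar x y s).δb t i)
    rw [inner_smul_left, real_inner_comm, RCLike.conj_to_real, Real.norm_eq_abs, abs_mul]
    have h2 : |(inner ℝ ((runPath O ξ ξbar x y s).δb t i) (x (t + 1) s - x t s) : ℝ)|
        ≤ dualNorm N ((runPath O ξ ξbar x y s).δb t i) * diamX P.X ω gω :=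
      (abs_inner_le_dualNorm_mul E.norm _ _).trans (mul_le_mul_of_nonneg_left
        (E.norm_sub_le_diam (E.x_mem (t := t + 1) ht s) (E.x_mem ht.le s)) hd)
    refine (mul_le_mul_of_nonneg_left h2 (abs_nonneg _)).trans ?_
    have h3 := sq_coord_le (w s) i
    simp only [Pi.add_apply]
    set d := dualNorm N ((runPath O ξ ξbar x y s).δb t i)
    have h4 : |w s i| * d ≤ ‖w s‖ ^ 2 + d ^ 2 := by
      rw [← sq_abs] at h3
      nlinarith [sq_nonneg (|w s i| - d), sq_nonneg d, sq_nonneg |w s i|]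
    nlinarith
  rw [heq]
  exact ⟨hint, E.zero_mean hA hx (E.x_mem ht.le) hw'
    (E.oracle.measurable_errG i) (fun v hv w => E.oracle.integral_inner_errG i hv w) hint⟩

/-- For `t ≥ 1` the point `x_{t+1}`, hence the direction paired with the gradient error, is
determined before `ξ̄_t` is drawn. -/
lemma mean_err {t : ℕ} (ht : t < T) (ht0 : t ≠ 0) {w : Ω → Vec m}
    (hw : Measurable[sampleSigma ξ ξbar (pastNext t)] w)
    (hw2 : Integrable (fun s => ‖w s‖ ^ 2) μ) :
    Integrable (fun s => (inner ℝ (w s) ((runPath O ξ ξbar x y s).err t) : ℝ)) μ ∧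
      ∫ s, (inner ℝ (w s) ((runPath O ξ ξbar x y s).err t) : ℝ) ∂μ = 0 := by
  have hx : Measurable[sampleSigma ξ ξbar (pastNext t)] (x t) :=
    (E.adapted_x ht.le).mono (sampleSigma_mono (past_subset_pastNext t)) le_rfl
  have h1 := E.mean_φ ht (inr_notMem_pastNext ht0) hx hw hw2
  have h2 := E.mean_δb ht (inr_notMem_pastNext ht0) hx (E.adapted_x_next ht) hw hw2
  have heq : (fun s => (inner ℝ (w s) ((runPath O ξ ξbar x y s).err t) : ℝ))
      = fun s => inner ℝ (w s) ((runPath O ξ ξbar x y s).φ t) + ∑ i, w s i *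
        (inner ℝ ((runPath O ξ ξbar x y s).δb t i) (x (t + 1) s - x t s) : ℝ) := by
    ext1 s
    rw [Path.err, inner_add_right]
    congr 1
    exact inner_vec_eq_sum _ _
  rw [heq]
  have hs := integrable_finsetSum Finset.univ fun i _ => (h2 i).1
  refine ⟨h1.1.add hs, ?_⟩
  rw [integral_add h1.1 hs, h1.2, integral_finsetSum _ fun i _ => (h2 i).1,
    Finset.sum_eq_zero fun i _ => (h2 i).2, add_zero]

lemma mean_mdErr {t : ℕ} (ht : t < T) (v : Vec m) :
    Integrable (fun s => (inner ℝ v ((runPath O ξ ξbar x y s).mdErr t) : ℝ)) μ ∧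
      ∫ s, (inner ℝ v ((runPath O ξ ξbar x y s).mdErr t) : ℝ) ∂μ = 0 := by
  by_cases h0 : t = 0
  · subst h0
    have hx : Measurable[sampleSigma ξ ξbar ∅] (x 0) := by
      have : x 0 = fun _ => x0 := by ext1 s; exact (E.run s).x_init
      rw [this]
      exact measurable_const
    simpa [Path.mdErr] using E.mean_φ ht (A := ∅) (by simp) hx (w := fun _ => v) measurable_const
      (integrable_const _)
  · simpa only [Path.mdErr, if_neg h0] using E.mean_err ht h0 (w := fun _ => v) measurable_const
      (integrable_const _)

lemma mean_errSum {k : ℕ} (hk : k ≤ T) (a : ℝ) (v : Vec m) :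
    Integrable (fun s => (inner ℝ v ((runPath O ξ ξbar x y s).errSum a k) : ℝ)) μ ∧
      ∫ s, (inner ℝ v ((runPath O ξ ξbar x y s).errSum a k) : ℝ) ∂μ = 0 := by
  have h : ∀ t ∈ Finset.range k, Integrable (fun s => ((t : ℝ) + a + 2) *
      (inner ℝ v ((runPath O ξ ξbar x y s).mdErr t) : ℝ)) μ := fun t ht =>
    (E.mean_mdErr (by have := Finset.mem_range.1 ht; omega) v).1.const_mul _
  simp only [Path.errSum, inner_sum, inner_smul_right]
  refine ⟨integrable_finsetSum _ h, ?_⟩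
  rw [integral_finsetSum _ h]
  refine Finset.sum_eq_zero fun t ht => ?_
  rw [integral_const_mul, (E.mean_mdErr (by have := Finset.mem_range.1 ht; omega) v).2, mul_zero]

/-- The weighted errors are orthogonal increments, so their second moments add; each weight is at
most the last one, `k + a + 1`. -/
lemma moment_errSum {a : ℝ} (ha : 0 ≤ a) : ∀ k ≤ T,
    Integrable (fun s => ‖(runPath O ξ ξbar x y s).errSum a k‖ ^ 2) μ ∧
      ∫ s, ‖(runPath O ξ ξbar x y s).errSum a k‖ ^ 2 ∂μ
        ≤ 2 * c.σX (diamX P.X ω gω) ^ 2 * (k * (k + a + 1) ^ 2) := by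
  intro k
  induction k with
  | zero => intro _; simp [Path.errSum]
  | succ k ih =>
    intro hk
    obtain ⟨h1, h2⟩ := ih (by omega)
    have hmd : Integrable (fun s => ‖(runPath O ξ ξbar x y s).mdErr k‖ ^ 2) μ ∧
        ∫ s, ‖(runPath O ξ ξbar x y s).mdErr k‖ ^ 2 ∂μ ≤ 2 * c.σX (diamX P.X ω gω) ^ 2 := by
      have h := (memLp_two_iff_integrable_sq_norm
        (E.measurable_mdErr (t := k) hk).aestronglyMeasurable).1 (E.memLp_mdErr (t := k) hk)
      refine ⟨h, (integral_mono h (E.moment_noise (t := k) hk).1 fun s => ?_).trans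
        (E.moment_noise (t := k) hk).2⟩
      exact Path.norm_mdErr_sq_le E.norm _ k
        (E.norm_sub_le_diam (E.x_mem (t := k + 1) hk s) (E.x_mem (t := k) (by omega) s))
    have hin : Integrable (fun s => (inner ℝ ((runPath O ξ ξbar x y s).errSum a k)
          ((runPath O ξ ξbar x y s).mdErr k) : ℝ)) μ ∧
        ∫ s, (inner ℝ ((runPath O ξ ξbar x y s).errSum a k)
          ((runPath O ξ ξbar x y s).mdErr k) : ℝ) ∂μ = 0 := by
      by_cases h0 : k = 0
      · subst h0
        simp [Path.errSum]
      · simp only [Path.mdErr, if_neg h0]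
        exact E.mean_err (t := k) hk h0 ((E.adapted_errSum (k := k) (by omega) a).mono
          (sampleSigma_mono (past_subset_pastNext k)) le_rfl) h1
    have heq : (fun s => ‖(runPath O ξ ξbar x y s).errSum a (k + 1)‖ ^ 2) = fun s =>
        ‖(runPath O ξ ξbar x y s).errSum a k‖ ^ 2
        + 2 * ((k : ℝ) + a + 2) * (inner ℝ ((runPath O ξ ξbar x y s).errSum a k)
          ((runPath O ξ ξbar x y s).mdErr k) : ℝ)
        + ((k : ℝ) + a + 2) ^ 2 * ‖(runPath O ξ ξbar x y s).mdErr k‖ ^ 2 := by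
      ext1 s
      have : (runPath O ξ ξbar x y s).errSum a (k + 1) = (runPath O ξ ξbar x y s).errSum a k
          + ((k : ℝ) + a + 2) • (runPath O ξ ξbar x y s).mdErr k := by
        rw [Path.errSum, Finset.sum_range_succ]; rfl
      rw [this, norm_add_sq_real, inner_smul_right, norm_smul, mul_pow, Real.norm_eq_abs, sq_abs]
      ring
    have hi2 := hin.1.const_mul (2 * ((k : ℝ) + a + 2))
    have hi3 := hmd.1.const_mul (((k : ℝ) + a + 2) ^ 2)
    rw [heq]
    refine ⟨(h1.add hi2).add hi3, ?_⟩
    rw [integral_add₃ h1 hi2 hi3, integral_const_mul,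
      integral_const_mul, hin.2, mul_zero, add_zero]
    have h5 : ((k : ℝ) + a + 2) ^ 2 * ∫ s, ‖(runPath O ξ ξbar x y s).mdErr k‖ ^ 2 ∂μ
        ≤ (k + a + 2) ^ 2 * (2 * c.σX (diamX P.X ω gω) ^ 2) := by
      gcongr
      exact hmd.2
    have h6 : 2 * c.σX (diamX P.X ω gω) ^ 2 * (k * ((k : ℝ) + a + 1) ^ 2)
        ≤ 2 * c.σX (diamX P.X ω gω) ^ 2 * (k * ((k : ℝ) + a + 2) ^ 2) := by
      gcongr
      linarith
    push_cast
    nlinarith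

lemma mean_mart {xs : Vec n} (hxs : xs ∈ P.X) {t : ℕ} (ht : t < T) :
    Integrable (fun s => (runPath O ξ ξbar x y s).mart xs t) μ ∧
      ∫ s, (runPath O ξ ξbar x y s).mart xs t ∂μ = 0 := by
  have h1 := E.mean_δ₀ hxs ht
  have h2 := E.mean_δ hxs ht
  have h3 : Integrable (fun s => if t = 0 then (0 : ℝ) else
        inner ℝ (y (t + 1) s) ((runPath O ξ ξbar x y s).err t)) μ ∧
      ∫ s, (if t = 0 then (0 : ℝ) else
        inner ℝ (y (t + 1) s) ((runPath O ξ ξbar x y s).err t)) ∂μ = 0 := by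
    split_ifs with h0
    · simp
    · exact E.mean_err ht h0 ((E.adapted_y_next ht).mono
        (sampleSigma_mono (past_subset_pastNext t)) le_rfl) (E.integrable_y_sq ht)
  have hs := integrable_finsetSum Finset.univ fun i _ => (h2 i).1
  have h12 := h1.1.add hs
  have heq : (fun s => (runPath O ξ ξbar x y s).mart xs t) = fun s =>
      (inner ℝ ((runPath O ξ ξbar x y s).δ₀ t) (x t s - xs) + ∑ i, y (t + 1) s i *
        (inner ℝ ((runPath O ξ ξbar x y s).δ t i) (x t s - xs) : ℝ))
      - (if t = 0 then (0 : ℝ) else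
        inner ℝ (y (t + 1) s) ((runPath O ξ ξbar x y s).err t)) := rfl
  rw [heq]
  refine ⟨h12.sub h3.1, ?_⟩
  have e1 := integral_sub h12 h3.1
  have e2 := integral_add h1.1 hs
  simp only [Pi.add_apply] at e1 e2
  rw [e1, e2, h1.2, h3.2, integral_finsetSum _ fun i _ => (h2 i).1, Finset.sum_eq_zero fun i _ => (h2 i).2]
  simp

/-- The second moment of the multiplier stays on the right; bounding it is the task of
`mean_primalErr_le`. -/
lemma moment_primalErr (Y : ℝ) {t : ℕ} (ht : t < T) :
    Integrable (fun s => (runPath O ξ ξbar x y s).primalErr N Y t) μ ∧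
      ∫ s, (runPath O ξ ξbar x y s).primalErr N Y t ∂μ
        ≤ 3 * (c.σ₀ ^ 2 + l2 c.σ ^ 2 * ∫ s, ‖y (t + 1) s‖ ^ 2 ∂μ
          + if t = 0 then (Y + 1) ^ 2 * l2 c.σ ^ 2 else 0) := by
  have h1 := E.moment_δ₀ ht
  have h2 := (E.moment_gradErr ht (E.adapted_y_sq ht)
    (fun s => sq_nonneg _) (E.integrable_y_sq ht)).2
  have h3 : Integrable (fun s => if t = 0 then
        (Y + 1) ^ 2 * (runPath O ξ ξbar x y s).gradErrBar N 0 else 0) μ ∧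
      ∫ s, (if t = 0 then
        (Y + 1) ^ 2 * (runPath O ξ ξbar x y s).gradErrBar N 0 else 0) ∂μ
      ≤ if t = 0 then (Y + 1) ^ 2 * l2 c.σ ^ 2 else 0 := by
    split_ifs with h0
    · have h := E.moment_gradErrBar (t := 0) (by omega)
      refine ⟨h.1.const_mul _, ?_⟩
      rw [integral_const_mul]
      exact mul_le_mul_of_nonneg_left h.2 (sq_nonneg _)
    · simp
  have h12 := h1.1.add h2.1
  refine ⟨(h12.add h3.1).const_mul 3, ?_⟩
  have : ∫ s, (runPath O ξ ξbar x y s).primalErr N Y t ∂μ = 3 *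
      (∫ s, dualNorm N ((runPath O ξ ξbar x y s).δ₀ t) ^ 2 ∂μ
      + ∫ s, ‖y (t + 1) s‖ ^ 2 * (runPath O ξ ξbar x y s).gradErr N t ∂μ
      + ∫ s, (if t = 0 then
        (Y + 1) ^ 2 * (runPath O ξ ξbar x y s).gradErrBar N 0 else 0) ∂μ) := by
    rw [← integral_add₃ h1.1 h2.1 h3.1, ← integral_const_mul]
    rfl
  rw [this]
  linarith [h1.2, h2.2, h3.2]

lemma moment_dualErr {a K : ℝ} (ha : 0 ≤ a) (hK : 0 < K) {t : ℕ} (ht : t < T) :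
    Integrable (fun s => (runPath O ξ ξbar x y s).dualErr N (diamX P.X ω gω) a K t) μ ∧
      ∫ s, (runPath O ξ ξbar x y s).dualErr N (diamX P.X ω gω) a K t ∂μ
        ≤ c.σX (diamX P.X ω gω) ^ 2 / K * (8 * (((t : ℝ) + a + 1) * (t + 1))) := by
  unfold Path.dualErr
  split_ifs with h0
  · have h := E.moment_noise (t := 0) (by omega)
    refine ⟨(h.1.const_mul _).div_const _, ?_⟩
    rw [integral_div, integral_const_mul, div_le_iff₀ (by positivity)]
    have h1 := mul_le_mul_of_nonneg_left h.2 (by positivity : 0 ≤ a + 2)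
    have h2 : c.σX (diamX P.X ω gω) ^ 2 / K * (8 * (((t : ℝ) + a + 1) * (t + 1))) * (2 * K)
        = c.σX (diamX P.X ω gω) ^ 2 * (16 * (a + 1)) := by
      subst h0; field_simp; push_cast; ring
    rw [h2]
    nlinarith [sq_nonneg (c.σX (diamX P.X ω gω))]
  · have h1 := E.moment_noise (t := t - 1) (by omega)
    have h2 := E.moment_noise (t := t - 2) (by omega)
    refine ⟨(h1.1.add h2.1).const_mul _, ?_⟩
    rw [integral_const_mul, integral_add h1.1 h2.1]
    have h3 := mul_le_mul_of_nonneg_left (add_le_add h1.2 h2.2)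
      (by positivity : 0 ≤ 2 * (((t : ℝ) + a + 1) * (t + 1) / K))
    refine h3.trans (le_of_eq ?_)
    field_simp
    ring

/-- The martingale terms vanish. The factor `k + 5` is `k + 1` from the summed dual noise plus `4`
from the terminal noise. -/
lemma moment_remainder {a K α H Y : ℝ} (ha : 0 ≤ a) (hK : 0 < K) {xs : Vec n}
    (hxs : xs ∈ P.X) {k : ℕ} (hk1 : 1 ≤ k) (hk : k ≤ T) :
    Integrable (fun s => (runPath O ξ ξbar x y s).remainder N α a K (diamX P.X ω gω) H Y xs k) μ ∧
      ∫ s, (runPath O ξ ξbar x y s).remainder N α a K (diamX P.X ω gω) H Y xs k ∂μ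
        ≤ 8 / α * ∑ t ∈ Finset.range k,
            (H ^ 2 + ∫ s, (runPath O ξ ξbar x y s).primalErr N Y t ∂μ)
          + 4 * (c.σX (diamX P.X ω gω) ^ 2 / K * (k * (k + a + 1) * (k + 5))) := by
  have hT : ∀ t ∈ Finset.range k, t < T := fun t ht => by
    have := Finset.mem_range.1 ht; omega
  have hp : ∀ t ∈ Finset.range k, Integrable (fun s => 8 / α * (H ^ 2 +
      (runPath O ξ ξbar x y s).primalErr N Y t)) μ := fun t ht =>
    ((integrable_const _).add (E.moment_primalErr Y (hT t ht)).1).const_mul _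
  have hm : ∀ t ∈ Finset.range k, Integrable (fun s => ((t : ℝ) + a + 2) *
      (runPath O ξ ξbar x y s).mart xs t) μ := fun t ht =>
    (E.mean_mart hxs (hT t ht)).1.const_mul _
  have hd : ∀ t ∈ Finset.range k, Integrable (fun s =>
      (runPath O ξ ξbar x y s).dualErr N (diamX P.X ω gω) a K t) μ := fun t ht =>
    (E.moment_dualErr ha hK (hT t ht)).1
  have hall : ∀ t ∈ Finset.range k, Integrable (fun s => 8 / α * (H ^ 2 +
      (runPath O ξ ξbar x y s).primalErr N Y t) - ((t : ℝ) + a + 2) *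
      (runPath O ξ ξbar x y s).mart xs t
      + (runPath O ξ ξbar x y s).dualErr N (diamX P.X ω gω) a K t) μ := fun t ht =>
    ((hp t ht).sub (hm t ht)).add (hd t ht)
  have h1 := E.moment_noise (t := k - 1) (by omega)
  have h2 := E.moment_noise (t := k - 2) (by omega)
  have hlast := (h1.1.add h2.1).const_mul (4 * (((k : ℝ) + a + 1) * k / K))
  unfold Path.remainder
  refine ⟨(integrable_finsetSum _ hall).add hlast, ?_⟩
  have e1 := integral_add (integrable_finsetSum _ hall) hlast
  simp only [Pi.add_apply] at e1
  rw [e1, integral_finsetSum _ hall, integral_const_mul, integral_add h1.1 h2.1]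
  have hsum : ∑ t ∈ Finset.range k, ∫ s, (8 / α * (H ^ 2 +
      (runPath O ξ ξbar x y s).primalErr N Y t) - ((t : ℝ) + a + 2) *
      (runPath O ξ ξbar x y s).mart xs t
      + (runPath O ξ ξbar x y s).dualErr N (diamX P.X ω gω) a K t) ∂μ
      ≤ ∑ t ∈ Finset.range k, (8 / α * (H ^ 2 +
        ∫ s, (runPath O ξ ξbar x y s).primalErr N Y t ∂μ)
        + c.σX (diamX P.X ω gω) ^ 2 / K * (8 * (((t : ℝ) + a + 1) * (t + 1)))) := by
    refine Finset.sum_le_sum fun t ht => ?_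
    have e2 := integral_add ((hp t ht).sub (hm t ht)) (hd t ht)
    have e3 := integral_sub (hp t ht) (hm t ht)
    simp only [Pi.sub_apply] at e2 e3
    rw [e2, e3, integral_const_mul, integral_const_mul, (E.mean_mart hxs (hT t ht)).2,
      integral_add (integrable_const _) (E.moment_primalErr Y (hT t ht)).1]
    have h := (E.moment_dualErr (K := K) ha hK (hT t ht)).2
    simp only [integral_const, probReal_univ, one_smul]
    linarith
  rw [Finset.sum_add_distrib, ← Finset.mul_sum, ← Finset.mul_sum] at hsum
  have hw := mul_le_mul_of_nonneg_left (sum_weights_le a k)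
    (by positivity : 0 ≤ c.σX (diamX P.X ω gω) ^ 2 / K)
  have hl := mul_le_mul_of_nonneg_left (add_le_add h1.2 h2.2)
    (by positivity : 0 ≤ 4 * (((k : ℝ) + a + 1) * k / K))
  have e4 : 4 * (((k : ℝ) + a + 1) * k / K) * (2 * c.σX (diamX P.X ω gω) ^ 2
      + 2 * c.σX (diamX P.X ω gω) ^ 2)
      = c.σX (diamX P.X ω gω) ^ 2 / K * (16 * ((k + a + 1) * k)) := by
    field_simp
    ring
  rw [e4] at hl
  have hfin : c.σX (diamX P.X ω gω) ^ 2 / K * (4 * (k + a) * k * (k + 1))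
      + c.σX (diamX P.X ω gω) ^ 2 / K * (16 * ((k + a + 1) * k))
      ≤ 4 * (c.σX (diamX P.X ω gω) ^ 2 / K * (k * (k + a + 1) * (k + 5))) := by
    have : 0 ≤ c.σX (diamX P.X ω gω) ^ 2 / K * (k * (k + 1)) := by positivity
    nlinarith
  linarith

end IsExperiment

end ConEx

/-! ### Saddle points and the choice of `K` -/

namespace ConEx

variable {n m : ℕ} {Ω Ξ : Type*} [MeasurableSpace Ω] [MeasurableSpace Ξ]
  {N : Seminorm ℝ (Vec n)} {P : Problem n m} {ω : Vec n → ℝ} {gω : Vec n → Vec n}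
  {c : Constants m} {O : Oracle n m Ξ} {df₀ : Vec n → Vec n} {df : Fin m → Vec n → Vec n}
  {μ : Measure Ω} {ξ ξbar : ℕ → Ω → Ξ} {B : ℝ} {x0 : Vec n} {T : ℕ}
  {x : ℕ → Ω → Vec n} {y : ℕ → Ω → Vec m} {xs : Vec n} {ys : Vec m}

section Saddle

/-- Raising one coordinate of the optimal multiplier by `1` must not increase the Lagrange function.
-/
lemma Problem.IsSaddle.feasible (h : P.IsSaddle xs ys) (i : Fin m) : P.ψ i xs ≤ 0 := by
  classical
  have h1 := h.2.2.1 (ys + WithLp.toLp 2 (Pi.single i 1)) (fun j => by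
    have := h.2.1 j
    by_cases hj : j = i
    · subst hj; simp; linarith
    · simpa [hj] using this)
  unfold Problem.lagrangian at h1
  simp only [PiLp.add_apply, add_mul, Finset.sum_add_distrib] at h1
  have h2 : ∑ j, (Pi.single i (1 : ℝ) : Fin m → ℝ) j * P.ψ j xs = P.ψ i xs := by
    rw [Finset.sum_eq_single i] <;> simp +contextual
  change _ + (_ + ∑ j, (Pi.single i (1 : ℝ) : Fin m → ℝ) j * P.ψ j xs) ≤ _ at h1
  rw [h2] at h1
  linarith

lemma Problem.IsSaddle.complementary (h : P.IsSaddle xs ys) : ∑ i, ys i * P.ψ i xs = 0 := by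
  refine le_antisymm (Finset.sum_nonpos fun i _ =>
    mul_nonpos_of_nonneg_of_nonpos (h.2.1 i) (h.feasible i)) ?_
  have h1 := h.2.2.1 0 (fun i => le_rfl)
  unfold Problem.lagrangian at h1
  simpa using h1

lemma Problem.IsSaddle.le_lagrangian (h : P.IsSaddle xs ys) {u : Vec n} (hu : u ∈ P.X) :
    P.ψ₀ xs ≤ P.ψ₀ u + ∑ i, ys i * P.ψ i u := by
  have h1 := h.2.2.2 u hu
  unfold Problem.lagrangian at h1
  rwa [h.complementary, add_zero] at h1

lemma Problem.IsSaddle.sum_mul_nonpos (h : P.IsSaddle xs ys) {v : Vec m} (hv : ∀ i, 0 ≤ v i) :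
    ∑ i, v i * P.ψ i xs ≤ 0 :=
  Finset.sum_nonpos fun i _ => mul_nonpos_of_nonneg_of_nonpos (hv i) (h.feasible i)

lemma Problem.IsSaddle.optVal_eq (h : P.IsSaddle xs ys) : P.optVal = P.ψ₀ xs := by
  refine IsLeast.csInf_eq ⟨⟨xs, ⟨h.1, h.feasible⟩, rfl⟩, ?_⟩
  rintro _ ⟨u, ⟨hu, hfeas⟩, rfl⟩
  have h1 := h.le_lagrangian hu
  have h2 : ∑ i, ys i * P.ψ i u ≤ 0 := Finset.sum_nonpos fun i _ =>
    mul_nonpos_of_nonneg_of_nonpos (h.2.1 i) (hfeas i)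
  linarith

end Saddle

/-- The constant `K` in `τ_t = K / (t + 1)`. -/
noncomputable def Constants.rate (c : Constants m) (B D : ℝ) (T : ℕ) : ℝ :=
  max (max (32 * c.bigM ^ 2 / c.α₀) (384 * l2 c.σ ^ 2 * T / c.α₀))
      (c.σX D * (T : ℝ) ^ (3 / 2 : ℝ) / (B * (c.t₀ B + 2) ^ (1 / 2 : ℝ)))

lemma rpow_three_half {r : ℝ} (hr : 0 ≤ r) : r ^ (3 / 2 : ℝ) = r * Real.sqrt r := by
  rw [Real.sqrt_eq_rpow, show (3 / 2 : ℝ) = 1 + 1 / 2 by norm_num,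
    Real.rpow_add_of_nonneg hr (by norm_num) (by norm_num), Real.rpow_one]

lemma Constants.σX_nonneg (c : Constants m) (D : ℝ) : 0 ≤ c.σX D := Real.sqrt_nonneg _

lemma Constants.rate_eq (c : Constants m) (B D : ℝ) (T : ℕ) : c.rate B D T
    = max (max (32 * c.bigM ^ 2 / c.α₀) (384 * l2 c.σ ^ 2 * T / c.α₀))
      (c.σX D * (T * Real.sqrt T) / (B * Real.sqrt (c.t₀ B + 2))) := by
  rw [Constants.rate, rpow_three_half (Nat.cast_nonneg T), Real.sqrt_eq_rpow (c.t₀ B + 2)]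

namespace IsExperiment

variable (E : IsExperiment N P ω gω c O df₀ df μ ξ ξbar B x0 T x y)
include E

lemma x_step_path {t : ℕ} (ht : t < T) (s : Ω) : IsProx P ω gω (y (t + 1) s)
    (df₀ (x t s) + (runPath O ξ ξbar x y s).δ₀ t
      + ∑ i, y (t + 1) s i • (df i (x t s) + (runPath O ξ ξbar x y s).δ t i)) (x t s)
    (c.α₀ * (t + c.t₀ B + 1) / 2) (x (t + 1) s) := by
  have h := (E.run s).x_step t ht
  simp only [runPath, E.oracle.err₀_eq (E.x_mem ht.le s), E.oracle.errG_eq _ (E.x_mem ht.le s),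
    add_sub_cancel]
  exact h

lemma extrap_eq {t : ℕ} (ht : t ≤ T) (s : Ω) (i : Fin m) :
    extrap P O (c.steps B (diamX P.X ω gω) T).θ (fun r => x r s) (fun r => ξbar r s) t i
      = (runPath O ξ ξbar x y s).est P df t i + (t + c.t₀ B + 1) / (t + c.t₀ B + 2)
        * ((runPath O ξ ξbar x y s).est P df t i
          - (runPath O ξ ξbar x y s).est P df (t - 1) i) := by
  rw [E.est_eq ht, E.est_eq ((Nat.sub_le t 1).trans ht)]
  have hθ : (c.steps B (diamX P.X ω gω) T).θ t = (t + c.t₀ B + 1) / (t + c.t₀ B + 2) := rfl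
  rw [← hθ]
  cases t with
  | zero => simp [extrap]; ring
  | succ t => simp [extrap]; ring

lemma isConExPath_of_pos (h : 0 < c.rate B (diamX P.X ω gω) T) (s : Ω) :
    IsConExPath P ω gω c.α₀ (c.t₀ B) (c.rate B (diamX P.X ω gω) T) df₀ df T
      (runPath O ξ ξbar x y s) where
  x_mem t ht := E.x_mem ht s
  y_init := (E.run s).y_init
  y_step t ht i := by
    have h1 := (E.run s).y_step t ht i
    rw [E.extrap_eq ht.le] at h1
    have h2 : (c.steps B (diamX P.X ω gω) T).τ t
        = 1 / ((t : ℝ) + 1) * c.rate B (diamX P.X ω gω) T := rfl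
    have h3 : 1 / (c.steps B (diamX P.X ω gω) T).τ t
        = (t + 1) / c.rate B (diamX P.X ω gω) T := by
      rw [h2]; field_simp
    rw [h3] at h1
    exact h1
  x_step t ht := E.x_step_path ht s

variable [IsProbabilityMeasure μ]

lemma ae_noise_eq_zero (hs : c.σX (diamX P.X ω gω) = 0) : ∀ᵐ s ∂μ, ∀ t < T,
    (runPath O ξ ξbar x y s).noise N (diamX P.X ω gω) t = 0 := by
  rw [ae_all_iff]
  intro t
  by_cases ht : t < T
  · have h := E.moment_noise ht
    rw [hs] at h
    have h0 : ∫ s, (runPath O ξ ξbar x y s).noise N (diamX P.X ω gω) t ∂μ = 0 :=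
      le_antisymm (by simpa using h.2) (integral_nonneg fun s => Path.noise_nonneg _ _ _)
    have := (integral_eq_zero_iff_of_nonneg (fun s => Path.noise_nonneg _ _ _) h.1).1 h0
    filter_upwards [this] with s hs _ using hs
  · exact Filter.Eventually.of_forall fun s h => absurd h ht

/-- A vanishing rate forces `bigM` and `σX` to vanish: the constraint functions are constant on `X`
and almost surely there is no constraint noise at `ξ̄`. With `1 / 0 = 0` the multipliers never move,
which is also what any positive `K` would produce. -/
lemma isConExPath_of_rate_eq_zero (h0 : c.rate B (diamX P.X ω gω) T = 0)
    (hsaddle : P.IsSaddle xs ys) (K : ℝ) (hK : 0 < K) :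
    ∀ᵐ s ∂μ, IsConExPath P ω gω c.α₀ (c.t₀ B) K df₀ df T (runPath O ξ ξbar x y s) := by
  have hα := E.setting.α₀_pos
  have hT : (0 : ℝ) < T := by exact_mod_cast E.one_le_T
  have hB : 0 < B := by linarith [E.one_le_B]
  have ha := Constants.two_le_t₀ E.setting E.one_le_B
  have hrate := h0
  rw [Constants.rate_eq] at hrate
  have hM : c.bigM = 0 := by
    have : 32 * c.bigM ^ 2 / c.α₀ ≤ 0 := by
      rw [← hrate]; exact (le_max_left _ _).trans (le_max_left _ _)
    rw [div_le_iff₀ hα] at this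
    have h2 : c.bigM ^ 2 = 0 := le_antisymm (by linarith) (sq_nonneg _)
    exact pow_eq_zero_iff two_ne_zero |>.1 h2
  have hs : c.σX (diamX P.X ω gω) = 0 := by
    have h1 : c.σX (diamX P.X ω gω) * (T * Real.sqrt T) / (B * Real.sqrt (c.t₀ B + 2)) ≤ 0 := by
      rw [← hrate]; exact le_max_right _ _
    rw [div_le_iff₀ (by positivity), zero_mul] at h1
    exact le_antisymm (nonpos_of_mul_nonpos_left h1 (by positivity)) (c.σX_nonneg _)
  have hMf0 : l2 c.Mf = 0 := by
    have h1 : 2 * l2 c.Mf ≤ c.bigM := le_max_left _ _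
    linarith [l2_nonneg c.Mf]
  have hMχ0 : l2 c.Mχ = 0 := by
    have h1 : l2 c.Mχ + l2 c.Mf ≤ c.bigM := le_max_right _ _
    linarith [l2_nonneg c.Mχ, l2_nonneg c.Mf]
  have hzero : ∀ a : Fin m → ℝ, l2 a = 0 → ∀ i, a i = 0 := fun a h i => by
    have h1 := l2_sq a
    rw [h] at h1
    have h2 : a i ^ 2 ≤ ∑ i, a i ^ 2 :=
      Finset.single_le_sum (f := fun i => a i ^ 2) (fun _ _ => sq_nonneg _) (Finset.mem_univ i)
    exact pow_eq_zero_iff two_ne_zero |>.1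
      (le_antisymm (by rw [← h1] at h2; simpa using h2) (sq_nonneg _))
  have hMf := hzero _ hMf0
  have hMχ := hzero _ hMχ0
  have hf : ∀ i, ∀ u ∈ P.X, P.f i u = P.f i xs := fun i u hu => by
    have h1 := E.setting.f_lip i u hu xs hsaddle.1
    have h2 := E.setting.f_lip i xs hsaddle.1 u hu
    rw [hMf, zero_mul] at h1 h2
    linarith
  have hχ : ∀ i, ∀ u ∈ P.X, P.χ i u = P.χ i xs := fun i u hu => by
    have h1 := E.setting.χ_lip i u hu xs hsaddle.1
    have h2 := E.setting.χ_lip i xs hsaddle.1 u hu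
    rw [hMχ, zero_mul] at h1 h2
    linarith
  have hy : ∀ s, ∀ t ≤ T, y t s = 0 := fun s t => by
    induction t with
    | zero => intro _; exact (E.run s).y_init
    | succ t ih =>
      intro ht
      ext i
      have h1 := (E.run s).y_step t ht i
      have h2 : (c.steps B (diamX P.X ω gω) T).τ t
          = 1 / ((t : ℝ) + 1) * c.rate B (diamX P.X ω gω) T := rfl
      rw [h2, h0] at h1
      simpa [ih (by omega)] using h1
  filter_upwards [E.ae_noise_eq_zero hs] with s hnoise
  have hest : ∀ t ≤ T, ∀ i, (runPath O ξ ξbar x y s).est P df t i = P.ψ i xs := by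
    intro t ht i
    cases t with
    | zero =>
      have hx := E.x_mem (Nat.zero_le T) s
      have hφ : (runPath O ξ ξbar x y s).mdErr 0 = 0 := by
        have h1 := Path.norm_mdErr_sq_le E.norm (runPath O ξ ξbar x y s) 0
          (E.norm_sub_le_diam (E.x_mem (t := 0 + 1) E.one_le_T s) hx)
        rw [hnoise 0 E.one_le_T] at h1
        exact norm_eq_zero.1 (pow_eq_zero_iff two_ne_zero |>.1 (le_antisymm h1 (sq_nonneg _)))
      simp only [Path.mdErr, if_true] at hφ
      simp only [Path.est, hφ, add_zero]
      change P.χ i (x 0 s) + P.f i (x 0 s) = _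
      rw [hχ i _ hx, hf i _ hx, Problem.ψ, add_comm]
    | succ t =>
      have hx := E.x_mem (t := t) (by omega) s
      have hx' := E.x_mem ht s
      have he : (runPath O ξ ξbar x y s).err t = 0 := by
        have h1 := Path.norm_err_sq_le E.norm (runPath O ξ ξbar x y s) t
          (E.norm_sub_le_diam hx' hx)
        rw [hnoise t ht] at h1
        exact norm_eq_zero.1 (pow_eq_zero_iff two_ne_zero |>.1 (le_antisymm h1 (sq_nonneg _)))
      have hin : inner ℝ (df i (x t s)) (x (t + 1) s - x t s) = 0 := by
        have h1 := abs_inner_subdiff_le (E.setting.f_lip i) (E.oracle.df_mem i _ hx)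
          (vsub_mem_vectorSpan ℝ hx' hx)
        rw [hMf, zero_mul] at h1
        exact abs_nonpos_iff.1 h1
      simp only [Path.est, he, add_zero]
      change P.χ i (x (t + 1) s) + P.f i (x t s)
        + inner ℝ (df i (x t s)) (x (t + 1) s - x t s) = _
      rw [hχ i _ hx', hf i _ hx, hin, Problem.ψ, add_zero, add_comm]
  exact {
    x_mem := fun t ht => E.x_mem ht s
    y_init := (E.run s).y_init
    y_step := fun t ht i => by
      rw [hest t ht.le, hest (t - 1) ((Nat.sub_le t 1).trans ht.le)]
      have e1 : (runPath O ξ ξbar x y s).y (t + 1) i = 0 := by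
        change y (t + 1) s i = 0
        rw [hy s (t + 1) ht]; rfl
      have e2 : (runPath O ξ ξbar x y s).y t i = 0 := by
        change y t s i = 0
        rw [hy s t ht.le]; rfl
      rw [e1, e2, sub_self, mul_zero, add_zero, zero_add, max_eq_right]
      -- The constant value of the estimate is `ψ i xs`, nonpositive by feasibility, so the
      -- projection returns zero.
      exact mul_nonpos_of_nonneg_of_nonpos (by positivity) (hsaddle.feasible i)
    x_step := fun t ht => E.x_step_path ht s }

/-- The prescribed rate if it is positive, otherwise `κ`. The slack `κ` lets the rest of the
argument divide by `K` without distinguishing cases. -/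
lemma exists_rate (hsaddle : P.IsSaddle xs ys) {κ : ℝ} (hκ : 0 < κ) :
    ∃ K : ℝ, 0 < K ∧ 32 * c.bigM ^ 2 ≤ c.α₀ * K ∧ 384 * l2 c.σ ^ 2 * T ≤ c.α₀ * K ∧
      c.σX (diamX P.X ω gω) * (T * Real.sqrt T) ≤ K * (B * Real.sqrt (c.t₀ B + 2)) ∧
      K ≤ 32 * c.bigM ^ 2 / c.α₀ + 384 * l2 c.σ ^ 2 * T / c.α₀
        + c.σX (diamX P.X ω gω) * (T * Real.sqrt T) / (B * Real.sqrt (c.t₀ B + 2)) + κ ∧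
      ∀ᵐ s ∂μ, IsConExPath P ω gω c.α₀ (c.t₀ B) K df₀ df T (runPath O ξ ξbar x y s) := by
  have hα := E.setting.α₀_pos
  have hB : 0 < B := by linarith [E.one_le_B]
  have ha := Constants.two_le_t₀ E.setting E.one_le_B
  have hA : 0 < Real.sqrt (c.t₀ B + 2) := Real.sqrt_pos.2 (by linarith)
  have hs := c.σX_nonneg (diamX P.X ω gω)
  have p1 : 0 ≤ 32 * c.bigM ^ 2 / c.α₀ := by positivity
  have p2 : 0 ≤ 384 * l2 c.σ ^ 2 * T / c.α₀ := by positivity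
  have p3 : 0 ≤ c.σX (diamX P.X ω gω) * (T * Real.sqrt T) / (B * Real.sqrt (c.t₀ B + 2)) := by
    positivity
  have q1 : 32 * c.bigM ^ 2 / c.α₀ ≤ c.rate B (diamX P.X ω gω) T := by
    rw [Constants.rate_eq]; exact (le_max_left _ _).trans (le_max_left _ _)
  have q2 : 384 * l2 c.σ ^ 2 * T / c.α₀ ≤ c.rate B (diamX P.X ω gω) T := by
    rw [Constants.rate_eq]; exact (le_max_right _ _).trans (le_max_left _ _)
  have q3 : c.σX (diamX P.X ω gω) * (T * Real.sqrt T) / (B * Real.sqrt (c.t₀ B + 2))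
      ≤ c.rate B (diamX P.X ω gω) T := by
    rw [Constants.rate_eq]; exact le_max_right _ _
  have q4 : c.rate B (diamX P.X ω gω) T ≤ 32 * c.bigM ^ 2 / c.α₀ + 384 * l2 c.σ ^ 2 * T / c.α₀
        + c.σX (diamX P.X ω gω) * (T * Real.sqrt T) / (B * Real.sqrt (c.t₀ B + 2)) := by
    rw [Constants.rate_eq]
    exact max_le (max_le (by linarith) (by linarith)) (by linarith)
  have hfin : ∀ K, c.rate B (diamX P.X ω gω) T ≤ K → 32 * c.bigM ^ 2 ≤ c.α₀ * K ∧
      384 * l2 c.σ ^ 2 * T ≤ c.α₀ * K ∧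
      c.σX (diamX P.X ω gω) * (T * Real.sqrt T) ≤ K * (B * Real.sqrt (c.t₀ B + 2)) := fun K hK =>
    ⟨(div_le_iff₀' hα).1 (q1.trans hK), (div_le_iff₀' hα).1 (q2.trans hK),
      (div_le_iff₀ (by positivity)).1 (q3.trans hK)⟩
  rcases (p1.trans q1).eq_or_lt with h0 | hpos
  · obtain ⟨r1, r2, r3⟩ := hfin κ (h0 ▸ hκ.le)
    exact ⟨κ, hκ, r1, r2, r3, by linarith,
      E.isConExPath_of_rate_eq_zero h0.symm hsaddle κ hκ⟩
  · obtain ⟨r1, r2, r3⟩ := hfin _ le_rfl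
    exact ⟨_, hpos, r1, r2, r3, by linarith,
      Filter.Eventually.of_forall fun s => E.isConExPath_of_pos hpos s⟩

end IsExperiment

end ConEx

/-! ### Uniform control of the multipliers -/

namespace ConEx

variable {n m : ℕ} {Ω Ξ : Type*} [MeasurableSpace Ω] [MeasurableSpace Ξ]
  {N : Seminorm ℝ (Vec n)} {P : Problem n m} {ω : Vec n → ℝ} {gω : Vec n → Vec n}
  {c : Constants m} {O : Oracle n m Ξ} {df₀ : Vec n → Vec n} {df : Fin m → Vec n → Vec n}
  {μ : Measure Ω} {ξ ξbar : ℕ → Ω → Ξ} {B : ℝ} {x0 : Vec n} {T : ℕ}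
  {x : ℕ → Ω → Vec n} {y : ℕ → Ω → Vec m} {xs : Vec n} {ys : Vec m} {K : ℝ}

lemma Problem.IsSaddle.gap_nonneg (h : P.IsSaddle xs ys) {u : Vec n} (hu : u ∈ P.X) {w : Vec m}
    (hw : ∀ i, 0 ≤ w i) : 0 ≤ P.gap u w xs ys := by
  have h1 := h.le_lagrangian hu
  have h2 := h.sum_mul_nonpos hw
  unfold Problem.gap
  linarith

/-- At the index of the largest `e`, the sum is at most `T` times that maximum, so it feeds back
with factor `6 / 12 = 1 / 2` and is absorbed. -/
lemma le_of_averaged_recursion {T : ℕ} {b C : ℝ} {e V : ℕ → ℝ} (he : ∀ t < T, 0 ≤ e t)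
    (hV : ∀ t < T, V (t + 1) ≤ C + 1 / (12 * T) * ∑ r ∈ Finset.range (t + 1), e r)
    (heV : ∀ t < T, e t ≤ b + 6 * V (t + 1)) {t : ℕ} (ht : t < T) : e t ≤ 2 * b + 12 * C := by
  have hT : (0 : ℝ) < T := by exact_mod_cast Nat.zero_lt_of_lt ht
  obtain ⟨r, hr, hmax⟩ := Finset.exists_max_image (Finset.range T) e
    ⟨t, Finset.mem_range.2 ht⟩
  have hrT := Finset.mem_range.1 hr
  have h1 : ∑ q ∈ Finset.range (r + 1), e q ≤ T * e r := by
    have : ∑ q ∈ Finset.range (r + 1), e q ≤ ∑ _q ∈ Finset.range (r + 1), e r :=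
      Finset.sum_le_sum fun q hq => hmax q (Finset.mem_range.2 (by
        have := Finset.mem_range.1 hq; omega))
    refine this.trans ?_
    rw [Finset.sum_const, Finset.card_range, nsmul_eq_mul]
    gcongr
    · exact he r hrT
    · exact hrT
  have h2 : 1 / (12 * (T : ℝ)) * ∑ q ∈ Finset.range (r + 1), e q ≤ e r / 12 := by
    calc 1 / (12 * (T : ℝ)) * ∑ q ∈ Finset.range (r + 1), e q ≤ 1 / (12 * (T : ℝ)) * (T * e r) := by
          gcongr
      _ = e r / 12 := by field_simp
  have h3 := hV r hrT
  have h4 := heV r hrT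
  have h5 := hmax t (Finset.mem_range.2 ht)
  linarith

/-- The estimate is rescaled by `l` so that the dual distance appears with weight `σ²`. The bound
with `384` makes the coefficient of `S` equal to `1 / (12 T)`; the bound with `s` handles the
initial distance and, squared, the noise. -/
lemma dual_distance_arith {α a D s σ B K Y H S q k T : ℝ} (hα : 0 < α) (ha : 2 ≤ a) (hK : 0 < K)
    (hk1 : 1 ≤ k) (hkT : k ≤ T) (hs : 0 ≤ s) (hS : 0 ≤ S)
    (hσs : D ^ 2 * σ ^ 2 ≤ s ^ 2) (hKσ : 384 * σ ^ 2 * T ≤ α * K)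
    (hKs : s * (T * Real.sqrt T) ≤ K * (B * Real.sqrt (a + 2)))
    (h : K * (k + a + 1) / k / 4 * q ≤ α * (a + 1) * (a + 2) / 2 * (D ^ 2 / 2)
      + K * (a + 2) / 2 * Y ^ 2
      + (8 / α * (k * H ^ 2 + S) + 4 * (s ^ 2 / K * (k * (k + a + 1) * (k + 5))))) :
    σ ^ 2 * q ≤ α * B * s * Real.sqrt (a + 2) * (a + 2) + 2 * (a + 2) * σ ^ 2 * Y ^ 2
      + 96 * B ^ 2 * (a + 2) * σ ^ 2 + H ^ 2 / 12 + 1 / (12 * T) * S := by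
  have hT : 1 ≤ T := hk1.trans hkT
  have hR : 1 ≤ Real.sqrt T := Real.one_le_sqrt.2 hT
  have hR2 : Real.sqrt T ^ 2 = T := Real.sq_sqrt (by linarith)
  set R := Real.sqrt T
  have hA2 : Real.sqrt (a + 2) ^ 2 = a + 2 := Real.sq_sqrt (by linarith)
  have hA0 : 0 ≤ Real.sqrt (a + 2) := Real.sqrt_nonneg _
  set A := Real.sqrt (a + 2)
  have hg : 0 < k + a + 1 := by linarith
  have hk : 0 < k := by linarith
  set l := 4 * k * σ ^ 2 / (K * (k + a + 1)) with hl
  have hl0 : 0 ≤ l := by positivity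
  have e0 : σ ^ 2 * q = l * (K * (k + a + 1) / k / 4 * q) := by
    rw [hl]; field_simp
  have e1 : l * (α * (a + 1) * (a + 2) / 2 * (D ^ 2 / 2)) ≤ α * B * s * A * (a + 2) := by
    have h1 : l * (α * (a + 1) * (a + 2) / 2 * (D ^ 2 / 2))
        = k * (α * (a + 1) * (a + 2)) * (D ^ 2 * σ ^ 2) / (K * (k + a + 1)) := by
      rw [hl]; field_simp; ring
    rw [h1, div_le_iff₀ (by positivity)]
    have h2 : k * s ≤ K * (B * A) := by
      refine le_trans ?_ hKs
      have : k ≤ T * R := by nlinarith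
      nlinarith
    calc k * (α * (a + 1) * (a + 2)) * (D ^ 2 * σ ^ 2)
        ≤ k * (α * (a + 1) * (a + 2)) * s ^ 2 := by gcongr
      _ = (α * (a + 2) * s) * ((a + 1) * (k * s)) := by ring
      _ ≤ (α * (a + 2) * s) * ((k + a + 1) * (K * (B * A))) := by
          gcongr
          linarith
      _ = _ := by ring
  have e2 : l * (K * (a + 2) / 2 * Y ^ 2) ≤ 2 * (a + 2) * σ ^ 2 * Y ^ 2 := by
    have h1 : l * (K * (a + 2) / 2 * Y ^ 2) = k * (2 * (a + 2) * σ ^ 2 * Y ^ 2) / (k + a + 1) := by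
      rw [hl]; field_simp; ring
    rw [h1, div_le_iff₀ hg]
    have : 0 ≤ 2 * (a + 2) * σ ^ 2 * Y ^ 2 := by positivity
    nlinarith
  have e3 : l * (8 / α * (k * H ^ 2 + S)) ≤ H ^ 2 / 12 + 1 / (12 * T) * S := by
    have h1 : l * (8 / α * (k * H ^ 2 + S))
        = (384 * σ ^ 2 * T) * (k * (k * H ^ 2 + S)) / (12 * T * (α * K) * (k + a + 1)) := by
      rw [hl]; field_simp; ring
    rw [h1, div_le_iff₀ (by positivity)]
    calc (384 * σ ^ 2 * T) * (k * (k * H ^ 2 + S))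
        ≤ (α * K) * ((k + a + 1) * (T * H ^ 2 + S)) := by
          gcongr
          linarith
      _ = _ := by field_simp
  have e4 : l * (4 * (s ^ 2 / K * (k * (k + a + 1) * (k + 5)))) ≤ 96 * B ^ 2 * (a + 2) * σ ^ 2 := by
    have h1 : l * (4 * (s ^ 2 / K * (k * (k + a + 1) * (k + 5))))
        = 16 * σ ^ 2 * (s ^ 2 * (k * k * (k + 5))) / K ^ 2 := by
      rw [hl]; field_simp; ring
    rw [h1, div_le_iff₀ (by positivity)]
    have h2 : k * k * (k + 5) ≤ T * T * (6 * T) := by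
      gcongr
      linarith
    have h3 : (s * (T * R)) ^ 2 ≤ (K * (B * A)) ^ 2 := by gcongr
    have h4 : (s * (T * R)) ^ 2 = s ^ 2 * (T * T * T) := by
      rw [mul_pow, mul_pow, hR2]; ring
    have h5 : (K * (B * A)) ^ 2 = K ^ 2 * (B ^ 2 * (a + 2)) := by
      rw [mul_pow, mul_pow, hA2]
    calc 16 * σ ^ 2 * (s ^ 2 * (k * k * (k + 5))) ≤ 16 * σ ^ 2 * (s ^ 2 * (T * T * (6 * T))) := by
          gcongr
      _ = 96 * σ ^ 2 * (s ^ 2 * (T * T * T)) := by ring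
      _ ≤ 96 * σ ^ 2 * (K ^ 2 * (B ^ 2 * (a + 2))) := by
          rw [← h4, ← h5]; gcongr
      _ = _ := by ring
  rw [e0]
  calc l * (K * (k + a + 1) / k / 4 * q)
      ≤ l * (α * (a + 1) * (a + 2) / 2 * (D ^ 2 / 2) + K * (a + 2) / 2 * Y ^ 2
      + (8 / α * (k * H ^ 2 + S) + 4 * (s ^ 2 / K * (k * (k + a + 1) * (k + 5))))) := by gcongr
    _ ≤ _ := by
      rw [mul_add, mul_add, mul_add]
      linarith

/-- The left side is `2 b + 12 C` of the averaged recursion. Only `e² ≥ 7` is used of the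
exponential factor in `ζ`. -/
lemma Constants.le_sq_ζ (c : Constants m) {B D Y : ℝ} (hα : 0 < c.α₀) (hB : 1 ≤ B)
    (ha : 2 ≤ c.t₀ B) :
    2 * (3 * c.σ₀ ^ 2 + 6 * l2 c.σ ^ 2 * Y ^ 2 + 3 * (Y + 1) ^ 2 * l2 c.σ ^ 2)
      + 12 * (c.α₀ * B * c.σX D * Real.sqrt (c.t₀ B + 2) * (c.t₀ B + 2)
        + 2 * (c.t₀ B + 2) * l2 c.σ ^ 2 * Y ^ 2 + 96 * B ^ 2 * (c.t₀ B + 2) * l2 c.σ ^ 2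
        + c.Hstar B D Y ^ 2 / 12) ≤ c.ζ B D Y ^ 2 / 2 := by
  have he : (7 : ℝ) ≤ Real.exp 1 ^ 2 := by
    nlinarith [Real.exp_one_gt_d9]
  have hs := c.σX_nonneg D
  have hl := l2_nonneg c.σ
  rw [Constants.ζ, mul_pow, rpow_three_half (by linarith)]
  have hA : 0 ≤ Real.sqrt (c.t₀ B + 2) := Real.sqrt_nonneg _
  set A := Real.sqrt (c.t₀ B + 2)
  set a := c.t₀ B
  set s := c.σX D
  set H := c.Hstar B D Y
  set σ := l2 c.σ
  rw [Real.sq_sqrt (by positivity)]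
  have h0 : 0 ≤ c.σ₀ ^ 2 + 12 * (a + 3) * σ ^ 2 * Y ^ 2
    + 96 * (a + 2) * B ^ 2 * σ ^ 2 + H ^ 2 / 2 + 3 * c.α₀ * B * s * ((a + 2) * A) / 2 := by
    positivity
  have h1 : 14 * (c.σ₀ ^ 2 + 12 * (a + 3) * σ ^ 2 * Y ^ 2
    + 96 * (a + 2) * B ^ 2 * σ ^ 2 + H ^ 2 / 2 + 3 * c.α₀ * B * s * ((a + 2) * A) / 2)
    ≤ (2 * Real.exp 1) ^ 2 / 2 * (c.σ₀ ^ 2 + 12 * (a + 3) * σ ^ 2 * Y ^ 2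
    + 96 * (a + 2) * B ^ 2 * σ ^ 2 + H ^ 2 / 2 + 3 * c.α₀ * B * s * ((a + 2) * A) / 2) := by
    refine mul_le_mul_of_nonneg_right ?_ h0
    nlinarith
  have h2 : σ ^ 2 ≤ (a + 2) * B ^ 2 * σ ^ 2 := by
    have : 1 ≤ (a + 2) * B ^ 2 := by nlinarith
    nlinarith [sq_nonneg σ]
  have h3 : (Y + 1) ^ 2 * σ ^ 2 ≤ (2 * Y ^ 2 + 2) * σ ^ 2 := by
    gcongr
    nlinarith [sq_nonneg (Y - 1)]
  have h4 : σ ^ 2 * Y ^ 2 ≤ a * (σ ^ 2 * Y ^ 2) := by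
    have : 0 ≤ σ ^ 2 * Y ^ 2 := by positivity
    nlinarith
  have h5 : 0 ≤ c.α₀ * B * s * A * (a + 2) := by positivity
  have h6 : 0 ≤ σ ^ 2 * Y ^ 2 := by positivity
  nlinarith [sq_nonneg c.σ₀, sq_nonneg H, sq_nonneg σ]

namespace IsExperiment

variable (E : IsExperiment N P ω gω c O df₀ df μ ξ ξbar B x0 T x y) [IsProbabilityMeasure μ]
include E

lemma integrable_breg (hxs : xs ∈ P.X) {t : ℕ} (ht : t ≤ T) :
    Integrable (fun s => breg ω gω xs (x t s)) μ := by
  have hc : ContinuousOn (fun u => breg ω gω xs u) P.X :=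
    E.prox.continuousOn_breg.comp (f := fun u => (xs, u)) (by fun_prop) fun u hu => ⟨hxs, hu⟩
  refine Integrable.of_bound (measurable_comp_of_continuousOn hc
    E.setting.X_compact.measurableSet (E.measurable_x ht) (E.x_mem ht)).aestronglyMeasurable
    (diamX P.X ω gω ^ 2) (Filter.Eventually.of_forall fun s => ?_)
  have h1 := E.prox.breg_nonneg hxs (E.x_mem ht s)
  have h2 := E.prox.two_breg_le E.setting.X_compact hxs (E.x_mem ht s)
  rw [Real.norm_eq_abs, abs_of_nonneg h1]
  linarith

lemma integrable_sub_y_sq (v : Vec m) {t : ℕ} (ht : t ≤ T) :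
    Integrable (fun s => ‖v - y t s‖ ^ 2) μ :=
  (memLp_two_iff_integrable_sq_norm ((E.measurable_y ht).const_sub v).aestronglyMeasurable).1
    ((memLp_const v).sub (E.memLp_y t ht))

/-- The expectation of the convergence estimate against the saddle point. -/
lemma mean_estimate (hsaddle : P.IsSaddle xs ys) (hK : 0 < K)
    (hKM : 32 * c.bigM ^ 2 ≤ c.α₀ * K)
    (hpath : ∀ᵐ s ∂μ, IsConExPath P ω gω c.α₀ (c.t₀ B) K df₀ df T (runPath O ξ ξbar x y s))
    {k : ℕ} (hk1 : 1 ≤ k) (hk : k ≤ T) :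
    c.α₀ * (k + c.t₀ B + 1) * (k + c.t₀ B + 2) / 2 * ∫ s, breg ω gω xs (x k s) ∂μ
        + K * (k + c.t₀ B + 1) / k / 4 * ∫ s, ‖ys - y k s‖ ^ 2 ∂μ
      ≤ c.α₀ * (c.t₀ B + 1) * (c.t₀ B + 2) / 2 * (diamX P.X ω gω ^ 2 / 2)
        + K * (c.t₀ B + 2) / 2 * ‖ys‖ ^ 2
        + (8 / c.α₀ * ∑ t ∈ Finset.range k, (c.Hstar B (diamX P.X ω gω) ‖ys‖ ^ 2
            + ∫ s, (runPath O ξ ξbar x y s).primalErr N ‖ys‖ t ∂μ)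
          + 4 * (c.σX (diamX P.X ω gω) ^ 2 / K * (k * (k + c.t₀ B + 1) * (k + 5)))) := by
  have hα := E.setting.α₀_pos
  have ha := Constants.two_le_t₀ E.setting E.one_le_B
  have hr := E.moment_remainder (a := c.t₀ B) (α := c.α₀) (H := c.Hstar B (diamX P.X ω gω) ‖ys‖)
    (Y := ‖ys‖) (by linarith) hK hsaddle.1 hk1 hk
  have hS := E.mean_errSum hk (c.t₀ B) ys
  have hW := (E.integrable_breg hsaddle.1 hk).const_mul
    (c.α₀ * (k + c.t₀ B + 1) * (k + c.t₀ B + 2) / 2)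
  have hy := (E.integrable_sub_y_sq ys hk).const_mul (K * (k + c.t₀ B + 1) / k / 4)
  set C := c.α₀ * (c.t₀ B + 1) * (c.t₀ B + 2) / 2 * (diamX P.X ω gω ^ 2 / 2)
        + K * (c.t₀ B + 2) / 2 * ‖ys‖ ^ 2 with hC
  have hmono := integral_mono_ae (hW.add hy) (((integrable_const C).add hr.1).sub hS.1) (by
    filter_upwards [hpath] with s hp
    have h1 := hp.estimate E.norm E.prox E.setting E.one_le_B E.oracle.df₀_mem E.oracle.df_mem hK
      hKM hk1 hk hsaddle.1 (norm_nonneg ys) hsaddle.2.1 (by linarith)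
    -- Against the saddle point itself every gap is nonnegative and can be dropped.
    have h2 : 0 ≤ ∑ t ∈ Finset.range k, (t + c.t₀ B + 2) * P.gap (x (t + 1) s) (y (t + 1) s) xs ys :=
      Finset.sum_nonneg fun t ht => by
        have htk : t + 1 ≤ T := by have := Finset.mem_range.1 ht; omega
        exact mul_nonneg (by positivity) (hsaddle.gap_nonneg (E.x_mem htk s) (E.y_nonneg htk s))
    have h3 : c.α₀ * (c.t₀ B + 1) * (c.t₀ B + 2) / 2 * breg ω gω xs (x 0 s)
        ≤ c.α₀ * (c.t₀ B + 1) * (c.t₀ B + 2) / 2 * (diamX P.X ω gω ^ 2 / 2) := by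
      gcongr
      linarith [E.prox.two_breg_le E.setting.X_compact hsaddle.1 (E.x_mem (Nat.zero_le T) s)]
    simp only [Pi.add_apply, Pi.sub_apply]
    change _ + _ + _ ≤ _ + _ + _ - _ at h1
    simp only [runPath] at h1 ⊢
    linarith)
  rw [integral_add' hW hy, integral_sub' ((integrable_const C).add hr.1) hS.1,
    integral_add' (integrable_const C) hr.1, hS.2, integral_const_mul, integral_const_mul,
    integral_const] at hmono
  simp only [probReal_univ, one_smul, sub_zero] at hmono
  exact hmono.trans (by linarith [hr.2])

lemma sq_y_le {t : ℕ} (ht : t ≤ T) (v : Vec m) :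
    ∫ s, ‖y t s‖ ^ 2 ∂μ ≤ 2 * ‖v‖ ^ 2 + 2 * ∫ s, ‖v - y t s‖ ^ 2 ∂μ := by
  have h := integral_mono (E.integrable_y_sq ht)
    ((integrable_const (2 * ‖v‖ ^ 2)).add ((E.integrable_sub_y_sq v ht).const_mul 2)) fun s => by
      have h1 : ‖y t s‖ ≤ ‖v‖ + ‖v - y t s‖ := by
        have := norm_sub_le v (v - y t s)
        simpa using this
      have h2 : ‖y t s‖ ^ 2 ≤ (‖v‖ + ‖v - y t s‖) ^ 2 := by gcongr
      simp only [Pi.add_apply]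
      nlinarith [sq_nonneg (‖v‖ - ‖v - y t s‖)]
  rwa [integral_add' (integrable_const _) ((E.integrable_sub_y_sq v ht).const_mul 2),
    integral_const, probReal_univ, one_smul, integral_const_mul] at h

/-- The variance bounds the multiplier and the multiplier bounds the variance; the averaged
recursion with `V` the scaled mean squared dual distance breaks the circle. -/
lemma mean_primalErr_le (hsaddle : P.IsSaddle xs ys) (hK : 0 < K)
    (hKM : 32 * c.bigM ^ 2 ≤ c.α₀ * K) (hKσ : 384 * l2 c.σ ^ 2 * T ≤ c.α₀ * K)
    (hKs : c.σX (diamX P.X ω gω) * (T * Real.sqrt T) ≤ K * (B * Real.sqrt (c.t₀ B + 2)))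
    (hpath : ∀ᵐ s ∂μ, IsConExPath P ω gω c.α₀ (c.t₀ B) K df₀ df T (runPath O ξ ξbar x y s))
    {t : ℕ} (ht : t < T) :
    ∫ s, (runPath O ξ ξbar x y s).primalErr N ‖ys‖ t ∂μ
      ≤ c.ζ B (diamX P.X ω gω) ‖ys‖ ^ 2 / 2 := by
  have hα := E.setting.α₀_pos
  have ha := Constants.two_le_t₀ E.setting E.one_le_B
  have he : ∀ t < T, 0 ≤ ∫ s, (runPath O ξ ξbar x y s).primalErr N ‖ys‖ t ∂μ := fun t _ =>
    integral_nonneg fun s => by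
      unfold Path.primalErr Path.gradErr Path.gradErrBar
      positivity
  refine (le_of_averaged_recursion he (V := fun t => l2 c.σ ^ 2 * ∫ s, ‖ys - y t s‖ ^ 2 ∂μ)
    (fun t ht => ?_) (fun t ht => ?_) ht).trans
    (c.le_sq_ζ hα E.one_le_B ha (D := diamX P.X ω gω))
  · have h1 := E.mean_estimate hsaddle hK hKM hpath (k := t + 1) (by omega) ht
    have h2 : 0 ≤ ∫ s, breg ω gω xs (x (t + 1) s) ∂μ :=
      integral_nonneg fun s => E.prox.breg_nonneg hsaddle.1 (E.x_mem ht s)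
    rw [Finset.sum_add_distrib, Finset.sum_const, Finset.card_range, nsmul_eq_mul] at h1
    have hσs : diamX P.X ω gω ^ 2 * l2 c.σ ^ 2 ≤ c.σX (diamX P.X ω gω) ^ 2 := by
      rw [Constants.sq_σX]
      linarith [sq_nonneg c.σf]
    have h3 : (1 : ℝ) ≤ ((t + 1 : ℕ) : ℝ) := by push_cast; linarith [Nat.cast_nonneg (α := ℝ) t]
    refine dual_distance_arith hα ha hK h3 (by exact_mod_cast ht) (c.σX_nonneg _)
      (Finset.sum_nonneg fun r hr => he r (by have := Finset.mem_range.1 hr; omega)) hσs hKσ hKs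
      (le_trans ?_ h1)
    refine le_add_of_nonneg_left (mul_nonneg ?_ h2)
    positivity
  · have h1 := (E.moment_primalErr ‖ys‖ ht).2
    have h2 := mul_le_mul_of_nonneg_left (E.sq_y_le (t := t + 1) ht ys) (sq_nonneg (l2 c.σ))
    have h3 : (if t = 0 then (‖ys‖ + 1) ^ 2 * l2 c.σ ^ 2 else 0)
        ≤ (‖ys‖ + 1) ^ 2 * l2 c.σ ^ 2 := by
      split_ifs
      · exact le_rfl
      · positivity
    linarith

end IsExperiment

end ConEx

/-! ### Accuracy arithmetic and the averaged output -/

namespace ConEx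

variable {n m : ℕ} {Ω Ξ : Type*} [MeasurableSpace Ω] [MeasurableSpace Ξ]
  {N : Seminorm ℝ (Vec n)} {P : Problem n m} {ω : Vec n → ℝ} {gω : Vec n → Vec n}
  {c : Constants m} {O : Oracle n m Ξ} {df₀ : Vec n → Vec n} {df : Fin m → Vec n → Vec n}
  {μ : Measure Ω} {ξ ξbar : ℕ → Ω → Ξ} {B : ℝ} {x0 : Vec n} {T : ℕ}
  {x : ℕ → Ω → Vec n} {y : ℕ → Ω → Vec m} {xs : Vec n} {ys : Vec m} {K : ℝ}

section Arithmetic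

lemma le_sq_of_rpow_half_le {r t : ℝ} (h : r ^ (1 / 2 : ℝ) ≤ t) : r ≤ t ^ 2 := by
  rw [← Real.sqrt_eq_rpow] at h
  exact (Real.sqrt_le_left ((Real.sqrt_nonneg r).trans h)).1 h

lemma le_mul_sqrt_of_rpow_two_thirds_le {r t : ℝ} (hr : 0 ≤ r) (h : r ^ (2 / 3 : ℝ) ≤ t) :
    r ≤ t * Real.sqrt t := by
  have h0 : 0 ≤ r ^ (2 / 3 : ℝ) := by positivity
  rw [← rpow_three_half (h0.trans h)]
  calc r = (r ^ (2 / 3 : ℝ)) ^ (3 / 2 : ℝ) := by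
        rw [← Real.rpow_mul hr]; norm_num
    _ ≤ _ := by gcongr

lemma mul_sqrt_le_of_sq_mul_div_le {q b ε t : ℝ} (hb : 0 ≤ b) (hε : 0 < ε)
    (h : q ^ 2 * (b / ε ^ 2) ≤ t) : q * Real.sqrt b ≤ ε * Real.sqrt t := by
  rw [← div_le_iff₀' hε]
  refine Real.le_sqrt_of_sq_le (le_of_eq_of_le ?_ h)
  rw [div_pow, mul_pow, Real.sq_sqrt hb, mul_div_assoc]

lemma sum_weights_eq (a : ℝ) (k : ℕ) :
    ∑ t ∈ Finset.range k, ((t : ℝ) + a + 2) = k * (k + 2 * a + 3) / 2 := by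
  induction k with
  | zero => simp
  | succ k ih => rw [Finset.sum_range_succ, ih]; push_cast; ring

/-- In the factor `T + 5`, the part `T` costs `1 / 10` by `hnoise` and the part `5`, using `a + 2 ≥
4`, costs `1 / 12` by `hinit`. -/
lemma noise_budget {a s B K T ε : ℝ} (ha : 2 ≤ a) (hK : 0 < K) (hB : 0 < B) (hT : 1 ≤ T)
    (hs : 0 ≤ s) (hinit : 60 * B * s * ((a + 2) * Real.sqrt (a + 2)) ≤ ε * (T * Real.sqrt T))
    (hnoise : 40 * B * s * Real.sqrt (a + 2) ≤ ε * Real.sqrt T)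
    (hKs : s * (T * Real.sqrt T) ≤ K * (B * Real.sqrt (a + 2))) :
    4 * (s ^ 2 / K * (T * (T + a + 1) * (T + 5))) ≤ 11 / 60 * (ε * (T * (T + a + 1))) := by
  have hR : 0 < Real.sqrt T := Real.sqrt_pos.2 (by linarith)
  set R := Real.sqrt T
  have hA : 0 < Real.sqrt (a + 2) := Real.sqrt_pos.2 (by linarith)
  set A := Real.sqrt (a + 2)
  have e1 : 4 * (s ^ 2 / K * (T * (T + a + 1) * (T + 5))) * R
      = 4 * s * (T + a + 1) * (T + 5) * (s * (T * R)) / K := by field_simp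
  have e2 : 4 * s * (T + a + 1) * (T + 5) * (s * (T * R)) / K
      ≤ 4 * s * (T + a + 1) * (T + 5) * (B * A) := by
    rw [div_le_iff₀ hK]
    calc 4 * s * (T + a + 1) * (T + 5) * (s * (T * R))
        ≤ 4 * s * (T + a + 1) * (T + 5) * (K * (B * A)) := by gcongr
      _ = _ := by ring
  have e3 : 4 * s * (T + 5) * (B * A) ≤ 11 / 60 * (ε * T) * R := by
    have e4 : T * (40 * B * s * A) ≤ T * (ε * R) := by gcongr
    have e5 : s * (B * A) * 5 ≤ s * (B * A) * (5 / 4 * (a + 2)) := by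
      gcongr
      linarith
    linarith
  have e6 : 4 * (s ^ 2 / K * (T * (T + a + 1) * (T + 5))) * R
      ≤ 11 / 60 * (ε * (T * (T + a + 1))) * R := by
    rw [e1]
    refine e2.trans ?_
    calc 4 * s * (T + a + 1) * (T + 5) * (B * A) = (T + a + 1) * (4 * s * (T + 5) * (B * A)) := by
          ring
      _ ≤ (T + a + 1) * (11 / 60 * (ε * T) * R) := by gcongr
      _ = _ := by ring
  exact le_of_mul_le_mul_right e6 hR

/-- Shares of `ε T (T + a + 1)`: `1/20` deterministic, `1/10` variance, `1/10` from the noise term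
of `K`, `1/100` for `κ`, `11/60` dual noise. Together they stay below `9/20`, which leaves `1/20`
for `errSum` in the infeasibility bound. -/
lemma accuracy_budget {α a D s σ B K Q H Z M κ T ε : ℝ} (hα : 0 < α) (ha : 2 ≤ a) (hK : 0 < K)
    (hB : 1 ≤ B) (hT : 1 ≤ T) (hs : 0 ≤ s) (hε : 0 < ε) (hZ : 0 ≤ Z)
    (hdet : 5 * α * (a + 2) * (a + 1) * D ^ 2 + 960 * (a + 2) * Q ^ 2 * M ^ 2 / α ≤ ε * T ^ 2)
    (hinit : 60 * B * s * ((a + 2) * Real.sqrt (a + 2)) ≤ ε * (T * Real.sqrt T))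
    (hvar : 80 * (Z + H ^ 2 + 144 * (a + 2) * Q ^ 2 * σ ^ 2) ≤ α * ε * T)
    (hdual : 5 * Q ^ 2 * s * Real.sqrt (a + 2) ≤ B * ε * Real.sqrt T)
    (hnoise : 40 * B * s * Real.sqrt (a + 2) ≤ ε * Real.sqrt T)
    (hκ : κ * ((a + 2) * Q ^ 2) ≤ ε / 50)
    (hKs : s * (T * Real.sqrt T) ≤ K * (B * Real.sqrt (a + 2)))
    (hKle : K ≤ 32 * M ^ 2 / α + 384 * σ ^ 2 * T / α
      + s * (T * Real.sqrt T) / (B * Real.sqrt (a + 2)) + κ) :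
    α * (a + 1) * (a + 2) / 2 * (D ^ 2 / 2) + K * (a + 2) / 2 * Q ^ 2
      + (8 / α * (T * (H ^ 2 + Z / 2)) + 4 * (s ^ 2 / K * (T * (T + a + 1) * (T + 5))))
      ≤ 9 / 20 * (ε * (T * (T + a + 1))) := by
  have hR : 0 < Real.sqrt T := Real.sqrt_pos.2 (by linarith)
  have hR2 : Real.sqrt T ^ 2 = T := Real.sq_sqrt (by linarith)
  set R := Real.sqrt T
  have hA : 0 < Real.sqrt (a + 2) := Real.sqrt_pos.2 (by linarith)
  have hA2 : Real.sqrt (a + 2) ^ 2 = a + 2 := Real.sq_sqrt (by linarith)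
  set A := Real.sqrt (a + 2)
  have hB0 : 0 < B := by linarith
  have hT2 : ε * T ^ 2 ≤ ε * (T * (T + a + 1)) := by
    gcongr
    nlinarith
  have h1 : K * (a + 2) / 2 * Q ^ 2 ≤ 16 * (a + 2) * Q ^ 2 * M ^ 2 / α
      + 192 * (a + 2) * Q ^ 2 * σ ^ 2 * T / α + s * (T * R) * A * Q ^ 2 / (2 * B) + ε / 100 := by
    have h2 : K * ((a + 2) / 2 * Q ^ 2) ≤ (32 * M ^ 2 / α + 384 * σ ^ 2 * T / α
      + s * (T * R) / (B * A) + κ) * ((a + 2) / 2 * Q ^ 2) := by gcongr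
    have h3 : s * (T * R) / (B * A) * ((a + 2) / 2 * Q ^ 2) = s * (T * R) * A * Q ^ 2 / (2 * B) := by
      rw [← hA2]; field_simp
    have h4 : (32 * M ^ 2 / α + 384 * σ ^ 2 * T / α) * ((a + 2) / 2 * Q ^ 2)
        = 16 * (a + 2) * Q ^ 2 * M ^ 2 / α + 192 * (a + 2) * Q ^ 2 * σ ^ 2 * T / α := by
      field_simp; ring
    rw [add_mul, add_mul, h3, h4] at h2
    linarith
  have h2 : α * (a + 1) * (a + 2) / 2 * (D ^ 2 / 2) + 16 * (a + 2) * Q ^ 2 * M ^ 2 / α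
      ≤ 1 / 20 * (ε * T ^ 2) := by
    have e1 : 0 ≤ (a + 2) * Q ^ 2 * M ^ 2 / α := by positivity
    have e2 : 16 * (a + 2) * Q ^ 2 * M ^ 2 / α = 16 * ((a + 2) * Q ^ 2 * M ^ 2 / α) := by ring
    have e3 : 960 * (a + 2) * Q ^ 2 * M ^ 2 / α = 960 * ((a + 2) * Q ^ 2 * M ^ 2 / α) := by ring
    rw [e2]
    rw [e3] at hdet
    linarith
  have h3 : 192 * (a + 2) * Q ^ 2 * σ ^ 2 * T / α + 8 / α * (T * (H ^ 2 + Z / 2))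
      ≤ 1 / 10 * (ε * T ^ 2) := by
    have e1 : 192 * (a + 2) * Q ^ 2 * σ ^ 2 * T / α + 8 / α * (T * (H ^ 2 + Z / 2))
        = T * (192 * (a + 2) * Q ^ 2 * σ ^ 2 + 8 * (H ^ 2 + Z / 2)) / α := by
      field_simp
    rw [e1, div_le_iff₀ hα]
    have e2 : 0 ≤ (a + 2) * Q ^ 2 * σ ^ 2 := by positivity
    calc T * (192 * (a + 2) * Q ^ 2 * σ ^ 2 + 8 * (H ^ 2 + Z / 2)) ≤ T * (1 / 10 * (α * ε * T)) := by
          gcongr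
          linarith
      _ = _ := by ring
  have h4 : s * (T * R) * A * Q ^ 2 / (2 * B) ≤ 1 / 10 * (ε * T ^ 2) := by
    rw [div_le_iff₀ (by positivity)]
    calc s * (T * R) * A * Q ^ 2 = T * R / 5 * (5 * Q ^ 2 * s * A) := by ring
      _ ≤ T * R / 5 * (B * ε * R) := by gcongr
      _ = T * R ^ 2 / 5 * (B * ε) := by ring
      _ = _ := by rw [hR2]; ring
  have h5 : ε / 100 ≤ 1 / 100 * (ε * T ^ 2) := by
    nlinarith [mul_le_mul_of_nonneg_left hT hε.le]
  have h6 := noise_budget ha hK hB0 hT hs hinit hnoise hKs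
  linarith

end Arithmetic

namespace IsExperiment

variable (E : IsExperiment N P ω gω c O df₀ df μ ξ ξbar B x0 T x y)
include E

lemma output_mem (s : Ω) :
    output (c.steps B (diamX P.X ω gω) T) T (fun t => x t s) ∈ P.X := by
  have ha := Constants.two_le_t₀ E.setting E.one_le_B
  refine E.setting.X_convex.centerMass_mem (t := Finset.range T)
    (w := (c.steps B (diamX P.X ω gω) T).γ) (z := fun t => x (t + 1) s) (fun t _ => ?_) ?_
    fun t ht => E.x_mem (Finset.mem_range.1 ht) s
  · change (0 : ℝ) ≤ t + c.t₀ B + 2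
    positivity
  · exact Finset.sum_pos (fun t _ => by change (0 : ℝ) < t + c.t₀ B + 2; positivity)
      ⟨0, Finset.mem_range.2 E.one_le_T⟩

lemma measurable_output : Measurable fun s =>
    output (c.steps B (diamX P.X ω gω) T) T (fun t => x t s) := by
  have h : Measurable fun s => ∑ t ∈ Finset.range T,
      (c.steps B (diamX P.X ω gω) T).γ t • x (t + 1) s :=
    Finset.measurable_fun_sum _ fun t ht =>
      (E.measurable_x (t := t + 1) (Finset.mem_range.1 ht)).fun_const_smul
        ((c.steps B (diamX P.X ω gω) T).γ t)
  exact h.fun_const_smul (∑ t ∈ Finset.range T, (c.steps B (diamX P.X ω gω) T).γ t)⁻¹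

lemma map_output_le {f : Vec n → ℝ} (hf : ConvexOn ℝ P.X f) (s : Ω) :
    (∑ t ∈ Finset.range T, ((t : ℝ) + c.t₀ B + 2))
        * f (output (c.steps B (diamX P.X ω gω) T) T (fun t => x t s))
      ≤ ∑ t ∈ Finset.range T, ((t : ℝ) + c.t₀ B + 2) * f (x (t + 1) s) := by
  have ha := Constants.two_le_t₀ E.setting E.one_le_B
  have hpos : 0 < ∑ t ∈ Finset.range T, ((t : ℝ) + c.t₀ B + 2) :=
    Finset.sum_pos (fun t _ => by positivity) ⟨0, Finset.mem_range.2 E.one_le_T⟩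
  have h := hf.map_centerMass_le (t := Finset.range T) (w := fun t : ℕ => (t : ℝ) + c.t₀ B + 2)
    (p := fun t => x (t + 1) s) (fun t _ => by positivity) hpos
    fun t ht => E.x_mem (Finset.mem_range.1 ht) s
  rw [← le_div_iff₀' hpos]
  refine h.trans (le_of_eq ?_)
  simp only [Finset.centerMass, smul_eq_mul, Function.comp]
  rw [div_eq_inv_mul]

/-- The Lagrange function at the output, with an arbitrary multiplier `v`. -/
lemma lagrangian_output_le (hsaddle : P.IsSaddle xs ys) (hK : 0 < K)
    (hKM : 32 * c.bigM ^ 2 ≤ c.α₀ * K) {s : Ω}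
    (hpath : IsConExPath P ω gω c.α₀ (c.t₀ B) K df₀ df T (runPath O ξ ξbar x y s))
    {v : Vec m} (hv : ∀ i, 0 ≤ v i) (hvY : ‖v‖ ≤ ‖ys‖ + 1) {u : Vec n}
    (hu : u = output (c.steps B (diamX P.X ω gω) T) T (fun t => x t s)) :
    (∑ t ∈ Finset.range T, ((t : ℝ) + c.t₀ B + 2))
        * (P.ψ₀ u - P.ψ₀ xs + ∑ i, v i * P.ψ i u)
      ≤ c.α₀ * (c.t₀ B + 1) * (c.t₀ B + 2) / 2 * (diamX P.X ω gω ^ 2 / 2)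
        + K * (c.t₀ B + 2) / 2 * (‖ys‖ + 1) ^ 2
        + (runPath O ξ ξbar x y s).remainder N c.α₀ (c.t₀ B) K (diamX P.X ω gω)
            (c.Hstar B (diamX P.X ω gω) ‖ys‖) ‖ys‖ xs T
        - inner ℝ v ((runPath O ξ ξbar x y s).errSum (c.t₀ B) T) := by
  have hα := E.setting.α₀_pos
  have ha := Constants.two_le_t₀ E.setting E.one_le_B
  have h1 := hpath.estimate E.norm E.prox E.setting E.one_le_B E.oracle.df₀_mem E.oracle.df_mem hK
    hKM E.one_le_T le_rfl hsaddle.1 (norm_nonneg ys) hv hvY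
  have h2 : 0 ≤ c.α₀ * (T + c.t₀ B + 1) * (T + c.t₀ B + 2) / 2 * breg ω gω xs (x T s) :=
    mul_nonneg (by positivity) (E.prox.breg_nonneg hsaddle.1 (E.x_mem le_rfl s))
  have h3 : 0 ≤ K * (T + c.t₀ B + 1) / T / 4 * ‖v - y T s‖ ^ 2 := by positivity
  have h4 : c.α₀ * (c.t₀ B + 1) * (c.t₀ B + 2) / 2 * breg ω gω xs (x 0 s)
      ≤ c.α₀ * (c.t₀ B + 1) * (c.t₀ B + 2) / 2 * (diamX P.X ω gω ^ 2 / 2) := by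
    gcongr
    linarith [E.prox.two_breg_le E.setting.X_compact hsaddle.1 (E.x_mem (Nat.zero_le T) s)]
  have h5 : K * (c.t₀ B + 2) / 2 * ‖v‖ ^ 2 ≤ K * (c.t₀ B + 2) / 2 * (‖ys‖ + 1) ^ 2 := by gcongr
  have hψ₀ := E.map_output_le (E.setting.f₀_convex.add E.setting.χ₀_convex) s
  have hψ : ∀ i, _ := fun i => E.map_output_le ((E.setting.f_convex i).add (E.setting.χ_convex i)) s
  rw [← hu] at hψ₀
  simp only [← hu] at hψ
  -- Jensen's inequality for the objective and, as `v ≥ 0`, for the constraints; the term with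
  -- `y_{t+1}` in the gap has the right sign because `xs` is feasible.
  have h6 : (∑ t ∈ Finset.range T, ((t : ℝ) + c.t₀ B + 2))
        * (P.ψ₀ u - P.ψ₀ xs + ∑ i, v i * P.ψ i u)
      ≤ ∑ t ∈ Finset.range T, (t + c.t₀ B + 2) * P.gap (x (t + 1) s) (y (t + 1) s) xs v := by
    calc (∑ t ∈ Finset.range T, ((t : ℝ) + c.t₀ B + 2))
          * (P.ψ₀ u - P.ψ₀ xs + ∑ i, v i * P.ψ i u)
        = (∑ t ∈ Finset.range T, ((t : ℝ) + c.t₀ B + 2)) * P.ψ₀ u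
          - (∑ t ∈ Finset.range T, ((t : ℝ) + c.t₀ B + 2)) * P.ψ₀ xs
          + ∑ i, v i * ((∑ t ∈ Finset.range T, ((t : ℝ) + c.t₀ B + 2)) * P.ψ i u) := by
          rw [mul_add, mul_sub, Finset.mul_sum _ _ (∑ t ∈ Finset.range T, _)]
          congr 1
          exact Finset.sum_congr rfl fun i _ => by ring
      _ ≤ ∑ t ∈ Finset.range T, ((t : ℝ) + c.t₀ B + 2) * P.ψ₀ (x (t + 1) s)
          - (∑ t ∈ Finset.range T, ((t : ℝ) + c.t₀ B + 2)) * P.ψ₀ xs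
          + ∑ i, v i * ∑ t ∈ Finset.range T, ((t : ℝ) + c.t₀ B + 2) * P.ψ i (x (t + 1) s) := by
          gcongr with i
          · exact hψ₀
          · exact hv i
          · exact hψ i
      _ = ∑ t ∈ Finset.range T, ((t : ℝ) + c.t₀ B + 2)
            * (P.ψ₀ (x (t + 1) s) + ∑ i, v i * P.ψ i (x (t + 1) s) - P.ψ₀ xs) := by
          simp only [mul_sub, mul_add, Finset.sum_sub_distrib, Finset.sum_add_distrib,
            Finset.mul_sum, ← Finset.sum_mul]
          rw [Finset.sum_comm, add_sub_right_comm]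
          congr 1
          exact Finset.sum_congr rfl fun t _ => Finset.sum_congr rfl fun i _ => by ring
      _ ≤ _ := by
          refine Finset.sum_le_sum fun t ht => ?_
          have htT : t + 1 ≤ T := Finset.mem_range.1 ht
          have := hsaddle.sum_mul_nonpos (E.y_nonneg htT s)
          refine mul_le_mul_of_nonneg_left ?_ (by positivity)
          unfold Problem.gap
          linarith
  change (∑ t ∈ Finset.range T, (t + c.t₀ B + 2) * P.gap (x (t + 1) s) (y (t + 1) s) xs v) + _ + _
    ≤ _ at h1
  simp only [runPath] at h1 ⊢
  linarith

end IsExperiment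

end ConEx

/-! ### Conclusion: objective, infeasibility and last iterate -/

namespace ConEx

variable {n m : ℕ} {Ω Ξ : Type*} [MeasurableSpace Ω] [MeasurableSpace Ξ]
  {N : Seminorm ℝ (Vec n)} {P : Problem n m} {ω : Vec n → ℝ} {gω : Vec n → Vec n}
  {c : Constants m} {O : Oracle n m Ξ} {df₀ : Vec n → Vec n} {df : Fin m → Vec n → Vec n}
  {μ : Measure Ω} {ξ ξbar : ℕ → Ω → Ξ} {B : ℝ} {x0 : Vec n} {T : ℕ}
  {x : ℕ → Ω → Vec n} {y : ℕ → Ω → Vec m} {xs : Vec n} {ys : Vec m} {K : ℝ}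

namespace Constants

lemma bounds_of_Teps_le (c : Constants m) {B D Y ε T : ℝ} (hα : 0 < c.α₀) (hB : 1 ≤ B)
    (ha : 2 ≤ c.t₀ B) (hε : 0 < ε) (h : c.Teps B D Y ε ≤ T) :
    5 * c.α₀ * (c.t₀ B + 2) * (c.t₀ B + 1) * D ^ 2
        + 960 * (c.t₀ B + 2) * (Y + 1) ^ 2 * c.bigM ^ 2 / c.α₀ ≤ ε * T ^ 2 ∧
      65 * B * c.σX D * ((c.t₀ B + 2) * Real.sqrt (c.t₀ B + 2)) ≤ ε * (T * Real.sqrt T) ∧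
      80 * (c.ζ B D Y ^ 2 + c.Hstar B D Y ^ 2
        + 144 * (c.t₀ B + 2) * (Y + 1) ^ 2 * l2 c.σ ^ 2) ≤ c.α₀ * ε * T ∧
      30 * (Y + 1) ^ 2 * c.σX D * Real.sqrt (c.t₀ B + 2) ≤ B * ε * Real.sqrt T ∧
      130 / 3 * B * c.σX D * Real.sqrt (c.t₀ B + 2) ≤ ε * Real.sqrt T := by
  simp only [Teps, max_le_iff] at h
  obtain ⟨⟨⟨⟨h1, h2⟩, h3⟩, h4⟩, h5⟩ := h
  have hs := c.σX_nonneg D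
  have ha2 : 0 ≤ c.t₀ B + 2 := by linarith
  have h1 := le_sq_of_rpow_half_le h1
  rw [rpow_three_half ha2] at h2
  have h2 := le_mul_sqrt_of_rpow_two_thirds_le (by positivity) h2
  have h4 := mul_sqrt_le_of_sq_mul_div_le ha2 hε h4
  have h5 := mul_sqrt_le_of_sq_mul_div_le ha2 hε h5
  refine ⟨?_, ?_, ?_, ?_, ?_⟩
  · rw [← mul_le_mul_iff_right₀ hε] at h1
    refine le_of_eq_of_le ?_ h1
    field_simp
  · rwa [div_le_iff₀' hε] at h2
  · rwa [div_le_iff₀' (by positivity)] at h3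
  · rw [div_mul_eq_mul_div, div_le_iff₀' (by linarith)] at h4
    linarith
  · linarith

lemma bounds_of_TepsLast_le (c : Constants m) {B D Y ε T : ℝ} (hα : 0 < c.α₀) (hB : 1 ≤ B)
    (ha : 2 ≤ c.t₀ B) (hε : 0 < ε) (h : c.TepsLast B D Y ε ≤ T) :
    5 * c.α₀ * (c.t₀ B + 2) * (c.t₀ B + 1) * D ^ 2
        + 960 * (c.t₀ B + 2) * (Y + 1) ^ 2 * c.bigM ^ 2 / c.α₀ ≤ c.α₀ * ε * T ^ 2 ∧
      60 * B * c.σX D * ((c.t₀ B + 2) * Real.sqrt (c.t₀ B + 2))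
        ≤ c.α₀ * ε * (T * Real.sqrt T) ∧
      80 * (c.ζ B D Y ^ 2 + c.Hstar B D Y ^ 2
        + 144 * (c.t₀ B + 2) * (Y + 1) ^ 2 * l2 c.σ ^ 2) ≤ c.α₀ * (c.α₀ * ε) * T ∧
      5 * Y ^ 2 * c.σX D * Real.sqrt (c.t₀ B + 2) ≤ B * (c.α₀ * ε) * Real.sqrt T ∧
      40 * B * c.σX D * Real.sqrt (c.t₀ B + 2) ≤ c.α₀ * ε * Real.sqrt T := by
  simp only [TepsLast, max_le_iff] at h
  obtain ⟨⟨⟨⟨h1, h2⟩, h3⟩, h4⟩, h5⟩ := h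
  have hs := c.σX_nonneg D
  have ha2 : 0 ≤ c.t₀ B + 2 := by linarith
  have hαε : 0 < c.α₀ * ε := by positivity
  have h1 := le_sq_of_rpow_half_le h1
  rw [rpow_three_half ha2] at h2
  have h2 := le_mul_sqrt_of_rpow_two_thirds_le (by positivity) h2
  have h4 := mul_sqrt_le_of_sq_mul_div_le ha2 hε h4
  have h5 := mul_sqrt_le_of_sq_mul_div_le ha2 hε h5
  refine ⟨?_, ?_, ?_, ?_, ?_⟩
  · rw [← mul_le_mul_iff_right₀ hαε] at h1
    refine le_of_eq_of_le ?_ h1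
    field_simp
  · rwa [div_le_iff₀' hαε] at h2
  · rw [div_le_iff₀' (by positivity)] at h3
    linarith
  · rw [div_mul_eq_mul_div, div_le_iff₀' (by positivity)] at h4
    linarith
  · rw [div_mul_eq_mul_div, div_le_iff₀' (by positivity)] at h5
    linarith

end Constants

/-- With `q = ε T (T + a + 1) / 20` the claim amounts to `800 Q² s² ≤ ε² T`. Multiplying the two
hypotheses cancels `B` and gives the constant `1300 (a + 2)`. -/
lemma errSum_budget {a s B Q T ε r : ℝ} (ha : 2 ≤ a) (hB : 1 ≤ B) (hT : 1 ≤ T) (hs : 0 ≤ s)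
    (hε : 0 < ε) (hdual : 30 * Q ^ 2 * s * Real.sqrt (a + 2) ≤ B * ε * Real.sqrt T)
    (hnoise : 130 / 3 * B * s * Real.sqrt (a + 2) ≤ ε * Real.sqrt T)
    (hr : r ≤ 2 * s ^ 2 * (T * (T + a + 1) ^ 2)) :
    Q ^ 2 / (2 * (ε * (T * (T + a + 1)) / 20)) * r ≤ ε * (T * (T + a + 1)) / 20 / 2 := by
  have hR0 : 0 ≤ Real.sqrt T := Real.sqrt_nonneg T
  have hR2 : Real.sqrt T ^ 2 = T := Real.sq_sqrt (by linarith)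
  set R := Real.sqrt T
  have hA0 : 0 ≤ Real.sqrt (a + 2) := Real.sqrt_nonneg _
  have hA2 : Real.sqrt (a + 2) ^ 2 = a + 2 := Real.sq_sqrt (by linarith)
  set A := Real.sqrt (a + 2)
  have h1 : Q ^ 2 * s ^ 2 * 800 ≤ ε ^ 2 * T := by
    have g1 := mul_le_mul hdual hnoise (by positivity) (by positivity)
    have g2 : 30 * Q ^ 2 * s * A * (130 / 3 * B * s * A)
        = B * (1300 * (a + 2) * (Q ^ 2 * s ^ 2)) := by
      rw [← hA2]; ring
    have g3 : B * ε * R * (ε * R) = B * (ε ^ 2 * T) := by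
      rw [← hR2]; ring
    rw [g2, g3] at g1
    refine le_trans ?_ (le_of_mul_le_mul_left g1 (by linarith))
    have g5 : 0 ≤ Q ^ 2 * s ^ 2 := by positivity
    have g6 : 800 ≤ 1300 * (a + 2) := by linarith
    calc Q ^ 2 * s ^ 2 * 800 ≤ Q ^ 2 * s ^ 2 * (1300 * (a + 2)) := by gcongr
      _ = _ := by ring
  have h2 : Q ^ 2 / (2 * (ε * (T * (T + a + 1)) / 20)) * r
      ≤ Q ^ 2 / (2 * (ε * (T * (T + a + 1)) / 20)) * (2 * s ^ 2 * (T * (T + a + 1) ^ 2)) := by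
    gcongr
  refine h2.trans ?_
  rw [div_mul_eq_mul_div, div_le_iff₀ (by positivity)]
  calc Q ^ 2 * (2 * s ^ 2 * (T * (T + a + 1) ^ 2))
      = (T * (T + a + 1) ^ 2) / 400 * (Q ^ 2 * s ^ 2 * 800) := by ring
    _ ≤ (T * (T + a + 1) ^ 2) / 400 * (ε ^ 2 * T) := by gcongr
    _ = _ := by ring

section Infeasibility

lemma Problem.infeas_nonneg (P : Problem n m) (u : Vec n) : 0 ≤ P.infeas u := Real.sqrt_nonneg _

lemma Problem.infeas_sq (P : Problem n m) (u : Vec n) :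
    P.infeas u ^ 2 = ∑ i, (max (P.ψ i u) 0) ^ 2 :=
  Real.sq_sqrt (Finset.sum_nonneg fun _ _ => sq_nonneg _)

lemma Problem.sum_mul_le_infeas (P : Problem n m) (u : Vec n) {v : Vec m} (hv : ∀ i, 0 ≤ v i) :
    ∑ i, v i * P.ψ i u ≤ ‖v‖ * P.infeas u :=
  (Finset.sum_le_sum fun i _ => mul_le_mul_of_nonneg_left (le_max_left _ 0) (hv i)).trans
    (sum_mul_le_norm_mul_l2 v fun i => max (P.ψ i u) 0)

/-- The vector of violations rescaled to norm `r`, the equality case of Cauchy-Schwarz. For a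
feasible point division by zero yields `v = 0`, which also works. -/
lemma Problem.exists_multiplier (P : Problem n m) (u : Vec n) {r : ℝ} (hr : 0 ≤ r) :
    ∃ v : Vec m, (∀ i, 0 ≤ v i) ∧ ‖v‖ ≤ r ∧ ∑ i, v i * P.ψ i u = r * P.infeas u := by
  have hsum : ∀ i, max (P.ψ i u) 0 * P.ψ i u = max (P.ψ i u) 0 ^ 2 := fun i => by
    rcases le_total (P.ψ i u) 0 with h | h
    · simp [max_eq_right h]
    · rw [max_eq_left h, sq]
  refine ⟨WithLp.toLp 2 fun i => r / P.infeas u * max (P.ψ i u) 0, fun i => ?_, ?_, ?_⟩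
  · have := P.infeas_nonneg u
    change 0 ≤ r / P.infeas u * max (P.ψ i u) 0
    positivity
  · have h : ‖(WithLp.toLp 2 fun i => r / P.infeas u * max (P.ψ i u) 0 : Vec m)‖ ^ 2
        = (r / P.infeas u) ^ 2 * P.infeas u ^ 2 := by
      rw [norm_vec_sq, P.infeas_sq, Finset.mul_sum]
      exact Finset.sum_congr rfl fun i _ => mul_pow _ _ _
    rcases eq_or_ne (P.infeas u) 0 with h0 | h0
    · rw [show (r / P.infeas u) ^ 2 * P.infeas u ^ 2 = 0 by simp [h0]] at h
      exact (pow_eq_zero_iff two_ne_zero |>.1 h).le.trans hr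
    · rw [← mul_pow, div_mul_cancel₀ _ h0] at h
      exact abs_le_of_sq_le_sq' h.le hr |>.2
  · change ∑ i, r / P.infeas u * max (P.ψ i u) 0 * P.ψ i u = _
    simp only [mul_assoc, hsum]
    rw [← Finset.mul_sum, ← P.infeas_sq]
    rcases eq_or_ne (P.infeas u) 0 with h | h
    · simp [h]
    · field_simp

lemma IsConvexSetting.continuousOn_infeas (hP : IsConvexSetting P N ω c) :
    ContinuousOn P.infeas P.X := by
  refine ContinuousOn.sqrt (continuousOn_finsetSum _ fun i _ => ?_)
  exact (((hP.f_cont i).add (hP.χ_cont i)).sup continuousOn_const).pow 2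

/-- `χ₀` is only lower semicontinuous, which still gives Borel measurability on `X`. -/
lemma IsConvexSetting.measurable_ψ₀_comp (hP : IsConvexSetting P N ω c) {u : Ω → Vec n}
    (hu : Measurable u) (hmem : ∀ s, u s ∈ P.X) : Measurable fun s => P.ψ₀ (u s) := by
  have h1 : Measurable (P.X.domRestrict P.χ₀) :=
    (lowerSemicontinuous_restrict_iff.2 hP.χ₀_lsc).measurable
  exact (measurable_comp_of_continuousOn hP.f₀_cont hP.X_compact.measurableSet hu hmem).add
    (h1.comp (hu.subtype_mk (h := hmem)))

end Infeasibility

namespace IsExperiment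

variable (E : IsExperiment N P ω gω c O df₀ df μ ξ ξbar B x0 T x y) [IsProbabilityMeasure μ]
include E

lemma sum_primalErr_le (hsaddle : P.IsSaddle xs ys) (hK : 0 < K)
    (hKM : 32 * c.bigM ^ 2 ≤ c.α₀ * K) (hKσ : 384 * l2 c.σ ^ 2 * T ≤ c.α₀ * K)
    (hKs : c.σX (diamX P.X ω gω) * (T * Real.sqrt T) ≤ K * (B * Real.sqrt (c.t₀ B + 2)))
    (hpath : ∀ᵐ s ∂μ, IsConExPath P ω gω c.α₀ (c.t₀ B) K df₀ df T (runPath O ξ ξbar x y s))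
    (h : ℝ) :
    8 / c.α₀ * ∑ t ∈ Finset.range T,
        (h + ∫ s, (runPath O ξ ξbar x y s).primalErr N ‖ys‖ t ∂μ)
      ≤ 8 / c.α₀ * (T * (h + c.ζ B (diamX P.X ω gω) ‖ys‖ ^ 2 / 2)) := by
  have hα := E.setting.α₀_pos
  refine mul_le_mul_of_nonneg_left ?_ (by positivity)
  refine (Finset.sum_le_card_nsmul _ _ (h + c.ζ B (diamX P.X ω gω) ‖ys‖ ^ 2 / 2)
    fun t ht => ?_).trans (by rw [Finset.card_range, nsmul_eq_mul])
  have := E.mean_primalErr_le hsaddle hK hKM hKσ hKs hpath (Finset.mem_range.1 ht)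
  linarith

/-- The last iterate is close to the solution in the Bregman divergence. -/
theorem mean_breg_last_le (hsaddle : P.IsSaddle xs ys) {ε : ℝ} (hε : 0 < ε)
    (h : c.TepsLast B (diamX P.X ω gω) ‖ys‖ ε ≤ T) :
    Integrable (fun s => breg ω gω xs (x T s)) μ ∧ ∫ s, breg ω gω xs (x T s) ∂μ ≤ ε := by
  refine ⟨E.integrable_breg hsaddle.1 le_rfl, ?_⟩
  have hα := E.setting.α₀_pos
  have hB := E.one_le_B
  have ha := Constants.two_le_t₀ E.setting E.one_le_B
  have hT : (1 : ℝ) ≤ T := by exact_mod_cast E.one_le_T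
  have hY := norm_nonneg ys
  obtain ⟨h1, h2, h3, h4, h5⟩ := c.bounds_of_TepsLast_le hα hB ha hε h
  obtain ⟨K, hK, hKM, hKσ, hKs, hKle, hpath⟩ := E.exists_rate hsaddle
    (κ := c.α₀ * ε / 50 / ((c.t₀ B + 2) * (‖ys‖ + 1) ^ 2)) (by positivity)
  have hm := E.mean_estimate hsaddle hK hKM hpath E.one_le_T le_rfl
  have hS := E.sum_primalErr_le hsaddle hK hKM hKσ hKs hpath
    (c.Hstar B (diamX P.X ω gω) ‖ys‖ ^ 2)
  have hYY : ‖ys‖ ^ 2 ≤ (‖ys‖ + 1) ^ 2 := by gcongr; linarith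
  -- The accuracy is scaled by `α₀`, the factor in front of the divergence in the estimate. No
  -- multiplier beyond `ys` is needed, so `Q = ‖ys‖`.
  have hb := accuracy_budget hα ha hK hB hT (c.σX_nonneg _) (by positivity : 0 < c.α₀ * ε)
    (Q := ‖ys‖) (sq_nonneg (c.ζ B (diamX P.X ω gω) ‖ys‖)) (le_trans (by gcongr) h1) h2
    (le_trans (by gcongr) h3) h4 h5 (by
      rw [div_mul_eq_mul_div, div_le_iff₀ (by positivity)]
      gcongr) hKs hKle
  have hdual : 0 ≤ K * (T + c.t₀ B + 1) / T / 4 * ∫ s, ‖ys - y T s‖ ^ 2 ∂μ :=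
    mul_nonneg (by positivity) (integral_nonneg fun s => sq_nonneg _)
  have hfin : c.α₀ * (T + c.t₀ B + 1) * (T + c.t₀ B + 2) / 2 * ∫ s, breg ω gω xs (x T s) ∂μ
      ≤ c.α₀ * (T + c.t₀ B + 1) * (T + c.t₀ B + 2) / 2 * ε := by
    have : 9 / 20 * (c.α₀ * ε * (T * (T + c.t₀ B + 1)))
        ≤ c.α₀ * (T + c.t₀ B + 1) * (T + c.t₀ B + 2) / 2 * ε := by
      have e1 : T * (c.α₀ * ε * (T + c.t₀ B + 1)) ≤ (T + c.t₀ B + 2) * (c.α₀ * ε * (T + c.t₀ B + 1)) := by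
        gcongr
        linarith
      have e2 : 0 ≤ T * (c.α₀ * ε * (T + c.t₀ B + 1)) := by positivity
      linarith
    linarith
  exact le_of_mul_le_mul_left hfin (by positivity)

/-- The output is approximately optimal and feasible. -/
theorem isStochasticOptimal_output (hsaddle : P.IsSaddle xs ys) {ε : ℝ} (hε : 0 < ε)
    (h : c.Teps B (diamX P.X ω gω) ‖ys‖ ε ≤ T) :
    IsStochasticOptimal P μ
      (fun s => output (c.steps B (diamX P.X ω gω) T) T (fun t => x t s)) ε ε := by
  refine ⟨E.output_mem, ?_⟩
  rw [hsaddle.optVal_eq]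
  have hα := E.setting.α₀_pos
  have hB := E.one_le_B
  have ha := Constants.two_le_t₀ E.setting E.one_le_B
  have hT : (1 : ℝ) ≤ T := by exact_mod_cast E.one_le_T
  have hY := norm_nonneg ys
  obtain ⟨h1, h2, h3, h4, h5⟩ := c.bounds_of_Teps_le hα hB ha hε h
  obtain ⟨K, hK, hKM, hKσ, hKs, hKle, hpath⟩ := E.exists_rate hsaddle
    (κ := ε / 50 / ((c.t₀ B + 2) * (‖ys‖ + 1) ^ 2)) (by positivity)
  have hr := E.moment_remainder (a := c.t₀ B) (α := c.α₀) (H := c.Hstar B (diamX P.X ω gω) ‖ys‖)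
    (Y := ‖ys‖) (by linarith) hK hsaddle.1 E.one_le_T le_rfl
  have hS := E.sum_primalErr_le hsaddle hK hKM hKσ hKs hpath
    (c.Hstar B (diamX P.X ω gω) ‖ys‖ ^ 2)
  have hσ := c.σX_nonneg (diamX P.X ω gω)
  have hA := Real.sqrt_nonneg (c.t₀ B + 2)
  have hb := accuracy_budget hα ha hK hB hT hσ hε
    (Q := ‖ys‖ + 1) (sq_nonneg (c.ζ B (diamX P.X ω gω) ‖ys‖)) h1 (le_trans (by gcongr; norm_num) h2)
    h3 (le_trans (by gcongr; norm_num) h4) (le_trans (by gcongr; norm_num) h5) (by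
      rw [div_mul_cancel₀ _ (by positivity)]) hKs hKle
  have hes := E.moment_errSum (a := c.t₀ B) (by linarith) T le_rfl
  have hlag := fun (s : Ω) hp (v : Vec m) hv hvY =>
    E.lagrangian_output_le hsaddle hK hKM (s := s) hp (v := v) hv hvY rfl
  set a := c.t₀ B
  set D := diamX P.X ω gω
  set C := c.α₀ * (a + 1) * (a + 2) / 2 * (D ^ 2 / 2) + K * (a + 2) / 2 * (‖ys‖ + 1) ^ 2
  set rem := fun s => (runPath O ξ ξbar x y s).remainder N c.α₀ a K D (c.Hstar B D ‖ys‖) ‖ys‖ xs T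
  set xbar := fun s => output (c.steps B D T) T (fun t => x t s)
  set G := ε * (T * (T + a + 1)) with hG
  have hG0 : 0 < G := by positivity
  have hC : C + ∫ s, rem s ∂μ ≤ 9 / 20 * G := by linarith [hr.2]
  set Γ := ∑ t ∈ Finset.range T, ((t : ℝ) + a + 2) with hΓ
  -- The sum of the weights is `T (T + 2 a + 3) / 2`, so a total error of `G / 2` is affordable.
  have hΓG : G / 2 ≤ Γ * ε := by
    rw [hΓ, sum_weights_eq, hG]
    have : 0 ≤ ε * T * (a + 2) := by positivity
    linarith
  have hΓ0 : 0 < Γ := pos_of_mul_pos_left (by linarith) hε.le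
  have hmeas : Measurable xbar := E.measurable_output
  obtain ⟨I, hI⟩ := E.setting.X_compact.exists_bound_of_continuousOn E.setting.continuousOn_infeas
  have hinf : Integrable (fun s => P.infeas (xbar s)) μ :=
    Integrable.of_bound (measurable_comp_of_continuousOn E.setting.continuousOn_infeas
      E.setting.X_compact.measurableSet hmeas E.output_mem).aestronglyMeasurable I
      (Filter.Eventually.of_forall fun s => hI _ (E.output_mem s))
  -- An infeasible output can undercut the optimal value, but by no more than the multiplier times
  -- the violation.
  have hlow : ∀ s, -(‖ys‖ * P.infeas (xbar s)) ≤ P.ψ₀ (xbar s) - P.ψ₀ xs := fun s => by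
    have e1 := hsaddle.le_lagrangian (E.output_mem s)
    have e2 := P.sum_mul_le_infeas (xbar s) hsaddle.2.1
    change P.ψ₀ xs ≤ P.ψ₀ (xbar s) + _ at e1
    linarith
  have hup : ∀ᵐ s ∂μ, Γ * (P.ψ₀ (xbar s) - P.ψ₀ xs) ≤ C + rem s := by
    filter_upwards [hpath] with s hp
    have := hlag s hp 0 (fun i => le_rfl) (by rw [norm_zero]; positivity)
    simpa using this
  -- `χ₀` need not be bounded above on `X`, so integrability comes from the convergence estimate
  -- above and the saddle inequality below.
  have hobj : Integrable (fun s => P.ψ₀ (xbar s) - P.ψ₀ xs) μ := by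
    refine Integrable.mono' ((((integrable_const C).add hr.1).abs.div_const Γ).add
      (hinf.const_mul ‖ys‖))
      ((E.setting.measurable_ψ₀_comp hmeas E.output_mem).sub_const _).aestronglyMeasurable ?_
    filter_upwards [hup] with s hs
    have e0 : 0 ≤ ‖ys‖ * P.infeas (xbar s) := mul_nonneg hY (P.infeas_nonneg _)
    have e1 : P.ψ₀ (xbar s) - P.ψ₀ xs ≤ |C + rem s| / Γ := by
      rw [le_div_iff₀' hΓ0]
      exact hs.trans (le_abs_self _)
    have e2 : 0 ≤ |C + rem s| / Γ := by positivity
    rw [Real.norm_eq_abs]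
    change |P.ψ₀ (xbar s) - P.ψ₀ xs| ≤ |C + rem s| / Γ + ‖ys‖ * P.infeas (xbar s)
    rw [abs_le]
    constructor <;> linarith [hlow s]
  refine ⟨⟨hobj, ?_⟩, hinf, ?_⟩
  · have e1 := integral_mono_ae (hobj.const_mul Γ) ((integrable_const C).add hr.1) hup
    rw [integral_const_mul, integral_add' (integrable_const C) hr.1, integral_const,
      probReal_univ, one_smul] at e1
    refine le_of_mul_le_mul_left (e1.trans (hC.trans ?_)) hΓ0
    linarith
  · set q := G / 20 with hq
    have hq0 : 0 < q := by positivity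
    -- The aligned multiplier depends on the outcome. Norm `‖ys‖ + 1` leaves one unit of
    -- infeasibility after `hlow` has used up `‖ys‖`, and Young's inequality replaces the pairing
    -- with `errSum` by its second moment.
    have e1 : ∀ᵐ s ∂μ, Γ * P.infeas (xbar s) ≤ (C + rem s) + (q / 2
        + (‖ys‖ + 1) ^ 2 / (2 * q) * ‖(runPath O ξ ξbar x y s).errSum a T‖ ^ 2) := by
      filter_upwards [hpath] with s hp
      obtain ⟨v, hv, hvY, hvs⟩ := P.exists_multiplier (xbar s) (r := ‖ys‖ + 1) (by positivity)
      have f1 := hlag s hp v hv hvY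
      change Γ * (P.ψ₀ (xbar s) - P.ψ₀ xs + ∑ i, v i * P.ψ i (xbar s)) ≤ C + rem s - _ at f1
      rw [hvs] at f1
      have f2 : Γ * P.infeas (xbar s)
          ≤ Γ * (P.ψ₀ (xbar s) - P.ψ₀ xs + (‖ys‖ + 1) * P.infeas (xbar s)) := by
        gcongr
        linarith [hlow s]
      set r := ‖(runPath O ξ ξbar x y s).errSum a T‖
      have f3 : -inner ℝ v ((runPath O ξ ξbar x y s).errSum a T) ≤ (‖ys‖ + 1) * r :=
        (neg_le_abs _).trans ((abs_real_inner_le_norm _ _).trans (by gcongr))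
      have f4 : (‖ys‖ + 1) * r ≤ q / 2 + (‖ys‖ + 1) ^ 2 / (2 * q) * r ^ 2 := by
        have : q / 2 + (‖ys‖ + 1) ^ 2 / (2 * q) * r ^ 2 - (‖ys‖ + 1) * r
            = ((‖ys‖ + 1) * r - q) ^ 2 / (2 * q) := by field_simp; ring
        have g : 0 ≤ ((‖ys‖ + 1) * r - q) ^ 2 / (2 * q) := by positivity
        linarith
      linarith
    have hi := (hes.1.const_mul ((‖ys‖ + 1) ^ 2 / (2 * q)))
    have e2 := integral_mono_ae (hinf.const_mul Γ)
      (((integrable_const C).add hr.1).add ((integrable_const (q / 2)).add hi)) e1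
    rw [integral_const_mul, integral_add' ((integrable_const C).add hr.1)
      ((integrable_const (q / 2)).add hi), integral_add' (integrable_const C) hr.1,
      integral_add' (integrable_const (q / 2)) hi, integral_const, integral_const,
      probReal_univ, one_smul, one_smul, integral_const_mul] at e2
    have e3 : (‖ys‖ + 1) ^ 2 / (2 * q) * ∫ s, ‖(runPath O ξ ξbar x y s).errSum a T‖ ^ 2 ∂μ
        ≤ q / 2 := errSum_budget ha hB hT hσ hε h4 h5 hes.2
    refine le_of_mul_le_mul_left (e2.trans ?_) hΓ0
    linarith

end IsExperiment

end ConEx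

theorem corollary2p2 {n m : ℕ} {Ω Ξ : Type*} [MeasurableSpace Ω] [MeasurableSpace Ξ]
    (N : Seminorm ℝ (ConEx.Vec n)) (hN : ∀ v, N v = 0 → v = 0)
    (P : ConEx.Problem n m) (ω : ConEx.Vec n → ℝ) (gω : ConEx.Vec n → ConEx.Vec n)
    (hω : ConEx.IsProxGenerator N P.X ω gω)
    (c : ConEx.Constants m) (hP : ConEx.IsConvexSetting P N ω c)
    (O : ConEx.Oracle n m Ξ) (df₀ : ConEx.Vec n → ConEx.Vec n)
    (df : Fin m → ConEx.Vec n → ConEx.Vec n) (hO : ConEx.IsStochasticOracle P N c O df₀ df)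
    (xs : ConEx.Vec n) (ys : ConEx.Vec m) (hsaddle : P.IsSaddle xs ys)
    (μ : MeasureTheory.Measure Ω) [MeasureTheory.IsProbabilityMeasure μ]
    (ξ ξbar : ℕ → Ω → Ξ) (hξ : ConEx.IsSampling μ O.law ξ ξbar)
    (B : ℝ) (hB : 1 ≤ B) (x0 : ConEx.Vec n) (hx0 : x0 ∈ P.X) (ε : ℝ) (hε : 0 < ε)
    (T : ℕ) (hT : 1 ≤ T) (x : ℕ → Ω → ConEx.Vec n) (y : ℕ → Ω → ConEx.Vec m)
    (hrun : ∀ s, ConEx.IsRun P ω gω O (c.steps B (ConEx.diamX P.X ω gω) T) x0 0 T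
      (fun t => ξ t s) (fun t => ξbar t s) (fun t => x t s) (fun t => y t s)) :
    (c.Teps B (ConEx.diamX P.X ω gω) ‖ys‖ ε ≤ T →
      ConEx.IsStochasticOptimal P μ
        (fun s => ConEx.output (c.steps B (ConEx.diamX P.X ω gω) T) T (fun t => x t s)) ε ε) ∧
    (c.TepsLast B (ConEx.diamX P.X ω gω) ‖ys‖ ε ≤ T →
      MeasureTheory.Integrable (fun s => ConEx.breg ω gω xs (x T s)) μ ∧
        ∫ s, ConEx.breg ω gω xs (x T s) ∂μ ≤ ε) := by
  have E : ConEx.IsExperiment N P ω gω c O df₀ df μ ξ ξbar B x0 T x y :=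
    ⟨hN, hω, hP, hO, hξ, hB, hx0, hT, hrun⟩
  exact ⟨E.isStochasticOptimal_output hsaddle hε, E.mean_breg_last_le hsaddle hε⟩
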